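/- Let $P_u$ and $P_v$ be probability measures on $\mathbb{R}$ with zero mean, unit variance and supports contained in $[-K_u,K_u]$ and $[-K_v,K_v]$ respectively. For $\beta\ge 0$ let $\mathbb{P}_\beta$ be the law of the $N\times M$ random matrix $Y=\sqrt{\beta/N}\,uv^{\top}+W$, where $u\in\mathbb{R}^N$ has i.i.d. entries of law $P_u$, $v\in\mathbb{R}^M$ has i.i.d. entries of law $P_v$, $W$ has i.i.d. standard Gaussian entries, and $u,v,W$ are independent. Let $L(\cdot;\beta)=\mathrm{d}\mathbb{P}_\beta/\mathrm{d}\mathbb{P}_0$ be the likelihood ratio. Let $s\in\mathbb{R}$, $\alpha,\beta\ge 0$ with $\alpha\beta^2K_u^4K_v^4<1$, and let $C\in\mathbb{R}$. Put $\mu=-\frac14\log(1-\alpha\beta^2)$, $\sigma^2=-\frac12\log(1-\alpha\beta^2)$ and $\phi(s)=\exp\{\mathrm{i}s\mu-\frac{\sigma^2}{2}s^2\}$. There exist $K<\infty$ and $N_0$, depending only on $s,\alpha,\beta,K_u,K_v$ and $C$, such that for all priors $P_u,P_v$ as above, all $N\ge \max(N_0,1)$ and all $M\geq 0$ with $|M-\alpha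 N|\le C\sqrt N$ (that is, $M=\alpha N+O(\sqrt N)$ with implied constant $C$), \[\Bigl|\mathbb{E}_{Y\sim\mathbb{P}_\beta}\bigl[e^{\mathrm{i}s\log L(Y;\beta)}\bigr]-\phi(s)\Bigr|\le\frac{K}{\sqrt N}.\] -/

import Mathlib

open MeasureTheory ProbabilityTheory

noncomputable section

/-- A base prior: a probability measure on `ℝ` with zero mean and unit variance, whose support is
contained in `[-K, K]`. -/
structure IsBoundedPrior (P : Measure ℝ) (K : ℝ) : Prop where
  isProbabilityMeasure : IsProbabilityMeasure P
  mean_zero : ∫ x, x ∂P = 0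
  unit_variance : variance id P = 1
  bounded_support : ∀ᵐ x ∂P, |x| ≤ K

/-- The law of an `N × M` matrix with i.i.d. standard Gaussian entries. -/
def noiseLaw (N M : ℕ) : Measure (Fin N → Fin M → ℝ) :=
  Measure.pi fun _ => Measure.pi fun _ => gaussianReal 0 1

/-- The matrix `√(β/N) u vᵀ + W`. -/
def spikedMatrix {N M : ℕ} (β : ℝ) (u : Fin N → ℝ) (v : Fin M → ℝ) (W : Fin N → Fin M → ℝ) :
    Fin N → Fin M → ℝ :=
  fun i j => Real.sqrt (β / N) * (u i * v j) + W i j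

/-- The law `P_β` of `Y = √(β/N) u vᵀ + W`, where `u` has i.i.d. entries of law `Pu`, `v` has
i.i.d. entries of law `Pv`, `W` has i.i.d. standard Gaussian entries, and `u`, `v`, `W` are
independent. -/
def spikedLaw (Pu Pv : Measure ℝ) (N M : ℕ) (β : ℝ) : Measure (Fin N → Fin M → ℝ) :=
  (((Measure.pi fun _ : Fin N => Pu).prod (Measure.pi fun _ : Fin M => Pv)).prod
    (noiseLaw N M)).map fun p => spikedMatrix β p.1.1 p.1.2 p.2

/-- The likelihood ratio `L(·; β) = dP_β / dP_0`, as a Radon-Nikodym derivative. -/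
def likelihoodRatio (Pu Pv : Measure ℝ) (N M : ℕ) (β : ℝ) (Y : Fin N → Fin M → ℝ) : ℝ :=
  ((spikedLaw Pu Pv N M β).rnDeriv (spikedLaw Pu Pv N M 0) Y).toReal

/-- The characteristic function `s ↦ E_{P_β}[exp(i s log L(Y; β))]` of the log-likelihood ratio
under the alternative. -/
def llrCharFun (Pu Pv : Measure ℝ) (N M : ℕ) (β s : ℝ) : ℂ :=
  ∫ Y, Complex.exp (Complex.I * s * Real.log (likelihoodRatio Pu Pv N M β Y))
    ∂(spikedLaw Pu Pv N M β)

/-- The mean `μ = -(1/4) log (1 - α β²)` of the limiting Gaussian. -/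
def limitMean (α β : ℝ) : ℝ := -(1 / 4) * Real.log (1 - α * β ^ 2)

/-- The variance `σ² = -(1/2) log (1 - α β²)` of the limiting Gaussian. -/
def limitVar (α β : ℝ) : ℝ := -(1 / 2) * Real.log (1 - α * β ^ 2)

/-- The characteristic function `φ(s) = exp (i s μ - σ² s² / 2)` of the limiting Gaussian. -/
def limitCharFun (α β s : ℝ) : ℂ :=
  Complex.exp (Complex.I * s * limitMean α β - limitVar α β / 2 * s ^ 2)

end

/-! Idea of the proof. By the Gaussian shift formula the likelihood ratio is the partition function
`Z(Y)` of the spike prior with Hamiltonian `energy`. Changing measure to pure noise turns the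
characteristic function into `E[Z^q]` with `q = 1 + i s` (`llrCharFun_eq_obsAvg`). Since `Re q = 1`,
`|Z^q| = Z`, and `Z` is the density of the planted law: every error estimate for the complex weight
`Z^q` reduces to a real one under that law (`norm_obsAvg_le`).

Let the signal strength be `b = τ²` and `Φ(τ) = E[Z^q]`. Differentiation and Gaussian integration by
parts in the noise give `Φ' = τ q (q - 1) X` with `X = E[Z^q ⟨R_u R_v⟩] / N`, where `⟨·⟩` averages
over replicas (independent Gibbs samples) and `R_u`, `R_v` are the overlaps of the two spikes
between two replicas. It remains to express `X` through `Φ`.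

This is a cavity computation (`IsCavity.norm_overlap_sub_le`). Expand `R_u = ∑ u_i u_i'`. If row `i`
carries no signal, `u_i` keeps its centred prior law and is independent of the rest, so the average
vanishes; switching the row on gives `E[Z^q ⟨u_i u_i' R_v⟩] ≈ (b/N) E[Z^q ⟨R_v²⟩]`. Similarly a
column gives `E[Z^q ⟨v_j v_j' R_v⟩] ≈ Φ + (b/N) E[Z^q ⟨R_u R_v⟩]`, the extra `Φ` coming from the
diagonal part `v_j² v_j'²`. Summing over rows and columns and eliminating `⟨R_v²⟩`, one gets `(1 - α
b²) X = α b Φ + O(N^{-1/2})` (`IsSubcritical.norm_fixedPoint_le`). The resulting linear differential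
equation has exact solution `exp(-(q (q - 1) / 4) log(1 - α τ⁴))`, which at `τ² = β` is `φ(s)`; an
integrating factor controls the perturbation (`norm_sub_exp_log_le`).

The main cavity remainders are `λ²` times averages of products of three overlaps, with `λ = b/N`, so
third moments of order `N^{3/2}` suffice. They come from a second-moment bound: `Z ⟨F⟩ ≤ (1 + Z²
⟨F²⟩) / 2`, and the noise average of `Z² ⟨F²⟩` is the prior average of `F² exp(λ R_u R_v)`. Under
the prior the overlaps are sub-Gaussian with proxies `N K_u⁴` and `M K_v⁴`, so this stays bounded
when `λ² N M K_u⁴ K_v⁴` stays below `1`; this is the role of the hypothesis `α β² K_u⁴ K_v⁴ < 1`. -/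

/-! ### Product measures: resampling, relabelling and tilting. -/

section ProductMeasures

/-- Resampling one coordinate of a product probability measure leaves it unchanged. -/
theorem measurePreserving_update_pi {κ : Type*} [Fintype κ] [DecidableEq κ] {E : κ → Type*}
    [∀ k, MeasurableSpace (E k)] (μ : ∀ k, Measure (E k)) [∀ k, IsProbabilityMeasure (μ k)]
    (c : κ) :
    MeasurePreserving (fun p : (∀ k, E k) × E c => Function.update p.1 c p.2)
      ((Measure.pi μ).prod (μ c)) (Measure.pi μ) := by
  have hm : Measurable (fun p : (∀ k, E k) × E c => Function.update p.1 c p.2) := by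
    fun_prop
  refine ⟨hm, ?_⟩
  symm
  refine Measure.pi_eq fun s hs => ?_
  rw [Measure.map_apply hm (MeasurableSet.univ_pi hs)]
  have : (fun p : (∀ k, E k) × E c => Function.update p.1 c p.2) ⁻¹' (Set.univ.pi s)
      = (Set.univ.pi (Function.update s c Set.univ)) ×ˢ (s c) := by
    ext p
    simp only [Set.mem_preimage, Set.mem_pi, Set.mem_univ, forall_true_left, Set.mem_prod]
    constructor
    · intro h
      refine ⟨fun k => ?_, by simpa using h c⟩
      by_cases hk : k = c
      · subst hk; simp
      · simpa [hk] using h k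
    · rintro ⟨h, h'⟩ k
      by_cases hk : k = c
      · subst hk; simpa using h'
      · simpa [hk] using h k
  rw [this, Measure.prod_prod, Measure.pi_pi, ← Finset.mul_prod_erase _ _ (Finset.mem_univ c),
    ← Finset.mul_prod_erase Finset.univ (fun k => μ k (s k)) (Finset.mem_univ c)]
  have h2 : ∏ k ∈ Finset.univ.erase c, μ k (Function.update s c Set.univ k)
      = ∏ k ∈ Finset.univ.erase c, μ k (s k) :=
    Finset.prod_congr rfl fun k hk => by simp [Finset.ne_of_mem_erase hk]
  rw [h2]
  simp [mul_comm]

theorem measurePreserving_comp_pi {κ κ' : Type*} [Fintype κ] [Fintype κ'] {Ω : Type*}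
    [MeasurableSpace Ω] (μ : Measure Ω) [IsProbabilityMeasure μ] {e : κ' → κ}
    (he : Function.Injective e) :
    MeasurePreserving (fun (ω : κ → Ω) (k : κ') => ω (e k))
      (Measure.pi fun _ => μ) (Measure.pi fun _ => μ) := by
  have hm : Measurable (fun (ω : κ → Ω) (k : κ') => ω (e k)) := by fun_prop
  refine ⟨hm, ?_⟩
  have h : iIndepFun (fun (k : κ) (ω : κ → Ω) => ω k) (Measure.pi fun _ => μ) :=
    iIndepFun_pi (X := fun _ => id) (μ := fun _ : κ => μ) (fun _ => aemeasurable_id)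
  have h' := h.precomp he
  rw [iIndepFun_iff_map_fun_eq_pi_map (fun k => (measurable_pi_apply (e k)).aemeasurable)] at h'
  rw [h']
  congr 1
  ext1 k
  exact (measurePreserving_eval (fun _ : κ => μ) (e k)).map_eq

/-- The Gibbs weight of independent replicas and its normalisation both factor over the replicas. -/
theorem pi_tilted {κ : Type*} [Fintype κ] {Ω : Type*} [MeasurableSpace Ω] (μ : Measure Ω)
    [IsProbabilityMeasure μ] {H : κ → Ω → ℝ}
    (hi : ∀ k, Integrable (fun ω => Real.exp (H k ω)) μ) :
    Measure.pi (fun k : κ => μ.tilted (H k))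
      = (Measure.pi fun _ : κ => μ).tilted (fun ω => ∑ k, H k (ω k)) := by
  have := fun k => isProbabilityMeasure_tilted (hi k)
  refine Measure.pi_eq fun s hs => ?_
  simp_rw [tilted_apply_eq_ofReal_integral]
  rw [← ENNReal.ofReal_prod_of_nonneg, Measure.restrict_pi_pi]
  · congr 1
    rw [← integral_fintype_prod_eq_prod (𝕜 := ℝ)]
    congr 1
    ext ω
    rw [Finset.prod_div_distrib]
    congr 1
    · rw [Real.exp_sum]
    · rw [← integral_fintype_prod_eq_prod (𝕜 := ℝ)]
      simp_rw [Real.exp_sum]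
  · intro k _
    positivity

end ProductMeasures

/-! ### Gaussian moment bounds and integration by parts. -/

section GaussianIntegration

theorem integrable_exp_mul_abs_gaussianReal (K : ℝ) :
    Integrable (fun x => Real.exp (K * |x|)) (gaussianReal 0 1) := by
  have := integrable_exp_mul_abs (X := id) (μ := gaussianReal 0 1) (t := K)
    (by simpa using integrable_exp_mul_gaussianReal K)
    (by simpa using integrable_exp_mul_gaussianReal (-K))
  simpa using this

/-- The law of a standard Gaussian vector indexed by `ι`. -/
noncomputable def stdGauss (ι : Type*) [Fintype ι] : Measure (ι → ℝ) :=
  Measure.pi fun _ => gaussianReal 0 1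

instance {ι : Type*} [Fintype ι] : IsProbabilityMeasure (stdGauss ι) := by
  unfold stdGauss; infer_instance

theorem integrable_exp_sum_abs {ι : Type*} [Fintype ι] (K : ℝ) :
    Integrable (fun y : ι → ℝ => Real.exp (K * ∑ i, |y i|)) (stdGauss ι) := by
  simp_rw [Finset.mul_sum, Real.exp_sum]
  exact Integrable.fintype_prod (f := fun _ x => Real.exp (K * |x|))
    (fun _ => integrable_exp_mul_abs_gaussianReal K)

theorem integral_exp_sum_mul {ι : Type*} [Fintype ι] (x : ι → ℝ) :
    ∫ y, Real.exp (∑ i, y i * x i) ∂(stdGauss ι) = Real.exp (∑ i, x i ^ 2 / 2) := by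
  simp_rw [Real.exp_sum]
  rw [stdGauss, integral_fintype_prod_eq_prod (𝕜 := ℝ) (f := fun i y => Real.exp (y * x i))]
  refine Finset.prod_congr rfl fun i _ => ?_
  have := congrFun (mgf_id_gaussianReal (μ := 0) (v := 1)) (x i)
  simp only [mgf, id] at this
  simp_rw [mul_comm _ (x i)]
  rw [this]
  simp

/-- Stein's identity: the Gaussian density has derivative `-x` times itself, and integrability
removes the boundary terms. The values are complex because `Z^q` is. -/
theorem integral_gaussianReal_mul_eq_integral_deriv {f f' : ℝ → ℂ}
    (hf : ∀ x, HasDerivAt f (f' x) x)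
    (h0 : Integrable f (gaussianReal 0 1))
    (h1 : Integrable (fun x : ℝ => (x : ℂ) * f x) (gaussianReal 0 1))
    (h2 : Integrable f' (gaussianReal 0 1)) :
    ∫ x : ℝ, (x : ℂ) * f x ∂(gaussianReal 0 1) = ∫ x, f' x ∂(gaussianReal 0 1) := by
  have h10 : (1 : NNReal) ≠ 0 := one_ne_zero
  have key : ∀ g : ℝ → ℂ, Integrable g (gaussianReal 0 1) →
      Integrable (fun x : ℝ => (gaussianPDFReal 0 1 x : ℂ) * g x) := by
    intro g hg
    rw [gaussianReal_of_var_ne_zero _ h10] at hg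
    rw [integrable_withDensity_iff_integrable_smul' (by fun_prop) (by simp [gaussianPDF])] at hg
    simpa [gaussianPDF, gaussianPDFReal_nonneg] using hg
  have hd : ∀ x : ℝ, HasDerivAt (fun x : ℝ => (gaussianPDFReal 0 1 x : ℂ))
      (-(x : ℂ) * gaussianPDFReal 0 1 x) x := by
    intro x
    have : HasDerivAt (fun x => gaussianPDFReal 0 1 x) (-x * gaussianPDFReal 0 1 x) x := by
      simp only [gaussianPDFReal_def]
      have h' : HasDerivAt (fun x : ℝ => -(x - 0) ^ 2 / (2 * ((1 : NNReal) : ℝ))) (-x) x := by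
        refine (((((hasDerivAt_id x).sub_const 0).pow 2).neg).div_const _).congr_deriv ?_
        simp
        ring
      have := h'.exp.const_mul ((Real.sqrt (2 * Real.pi * ((1 : NNReal) : ℝ)))⁻¹)
      refine this.congr_deriv ?_
      ring
    simpa using this.ofReal_comp
  simp_rw [integral_gaussianReal_eq_integral_smul h10]
  have := integral_mul_deriv_eq_deriv_mul_of_integrable (u := f) (v := fun x : ℝ => (gaussianPDFReal 0 1 x : ℂ))
    (u' := f') (v' := fun x : ℝ => -(x : ℂ) * gaussianPDFReal 0 1 x) (fun x _ => hf x) (fun x _ => hd x)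
    ?_ ?_ ?_
  · have h3 : ∫ x : ℝ, f x * (-(x : ℂ) * gaussianPDFReal 0 1 x)
        = - ∫ x : ℝ, gaussianPDFReal 0 1 x • ((x : ℂ) * f x) := by
      rw [← integral_neg]
      congr 1; ext x; simp; ring
    rw [h3] at this
    have h4 : ∫ x : ℝ, f' x * (gaussianPDFReal 0 1 x : ℂ) = ∫ x : ℝ, gaussianPDFReal 0 1 x • f' x := by
      congr 1; ext x; simp; ring
    rw [h4] at this
    exact neg_injective this
  · refine (key _ h1).neg.congr (ae_of_all _ fun x => ?_)
    simp; ring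
  · refine (key _ h2).congr (ae_of_all _ fun x => ?_)
    simp; ring
  · refine (key _ h0).congr (ae_of_all _ fun x => ?_)
    simp; ring

/-- Gaussian integration by parts in one coordinate. -/
theorem integral_stdGauss_mul_eq_integral_deriv {ι : Type*} [Fintype ι] [DecidableEq ι] (i : ι)
    {f f' : (ι → ℝ) → ℂ}
    (hf : ∀ y, HasDerivAt (fun t => f (Function.update y i t)) (f' y) (y i))
    (h0 : Integrable f (stdGauss ι))
    (h1 : Integrable (fun y => (y i : ℂ) * f y) (stdGauss ι))
    (h2 : Integrable f' (stdGauss ι)) :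
    ∫ y, (y i : ℂ) * f y ∂(stdGauss ι) = ∫ y, f' y ∂(stdGauss ι) := by
  -- Redrawing coordinate `i` preserves the law, so the one-dimensional identity can be applied in a
  -- fresh variable with the other coordinates frozen.
  have mp := measurePreserving_update_pi (fun _ : ι => gaussianReal 0 1) i
  have key : ∀ g : (ι → ℝ) → ℂ, Integrable g (stdGauss ι) →
      Integrable (fun p : (ι → ℝ) × ℝ => g (Function.update p.1 i p.2))
        ((stdGauss ι).prod (gaussianReal 0 1)) ∧
      ∫ y, g y ∂(stdGauss ι)
        = ∫ y, ∫ t, g (Function.update y i t) ∂(gaussianReal 0 1) ∂(stdGauss ι) := by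
    intro g hg
    have hi : Integrable (fun p : (ι → ℝ) × ℝ => g (Function.update p.1 i p.2))
        ((stdGauss ι).prod (gaussianReal 0 1)) :=
      mp.integrable_comp_of_integrable hg
    refine ⟨hi, ?_⟩
    rw [← integral_prod _ hi]
    have hg' : AEStronglyMeasurable g (Measure.map
        (fun p : (ι → ℝ) × ℝ => Function.update p.1 i p.2)
        ((stdGauss ι).prod (gaussianReal 0 1))) := by
      rw [stdGauss, mp.map_eq]; exact hg.1
    rw [← integral_map mp.measurable.aemeasurable hg']
    rw [stdGauss, mp.map_eq]
  rw [(key _ h1).2, (key _ h2).2]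
  refine integral_congr_ae ?_
  filter_upwards [(key _ h0).1.prod_right_ae, (key _ h1).1.prod_right_ae,
    (key _ h2).1.prod_right_ae] with y a0 a1 a2
  simp only [Function.update_self] at a1 ⊢
  refine integral_gaussianReal_mul_eq_integral_deriv (fun x => ?_) a0 a1 a2
  simpa using hf (Function.update y i x)

end GaussianIntegration

/-! ### Replica averages and their derivative in the Hamiltonian. -/

section Replicas

variable {Ω : Type*} [MeasurableSpace Ω]

/-- The partition function of the Hamiltonian `H` under the reference measure `π`. -/
noncomputable def partFn (π : Measure Ω) (H : Ω → ℝ) : ℝ := ∫ ω, Real.exp (H ω) ∂π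

/-- The average of `F` over `n` independent samples from the Gibbs measure `π.tilted H`. -/
noncomputable def gibbsAvg (π : Measure Ω) (H : Ω → ℝ) {n : ℕ} (F : (Fin n → Ω) → ℝ) : ℝ :=
  ∫ ω, F ω ∂(Measure.pi fun _ : Fin n => π.tilted H)

variable {π : Measure Ω} [IsProbabilityMeasure π]

theorem integrable_exp_of_abs_le {H : Ω → ℝ} (hm : Measurable H) {C : ℝ} (hb : ∀ ω, |H ω| ≤ C) :
    Integrable (fun ω => Real.exp (H ω)) π := by
  refine Integrable.of_bound (by fun_prop) (Real.exp C) (ae_of_all _ fun ω => ?_)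
  rw [Real.norm_eq_abs, abs_of_pos (Real.exp_pos _)]
  exact Real.exp_le_exp.2 ((le_abs_self _).trans (hb ω))

theorem partFn_pos {H : Ω → ℝ} (hi : Integrable (fun ω => Real.exp (H ω)) π) :
    0 < partFn π H := integral_exp_pos hi

theorem partFn_le {H : Ω → ℝ} (hm : Measurable H) {C : ℝ} (hb : ∀ ω, |H ω| ≤ C) :
    partFn π H ≤ Real.exp C := by
  have : partFn π H ≤ ∫ _, Real.exp C ∂π :=
    integral_mono (integrable_exp_of_abs_le hm hb) (integrable_const _)
      fun ω => Real.exp_le_exp.2 ((le_abs_self _).trans (hb ω))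
  simpa using this

theorem isProbabilityMeasure_pi_tilted {κ : Type*} [Fintype κ] {H : Ω → ℝ}
    (hi : Integrable (fun ω => Real.exp (H ω)) π) :
    IsProbabilityMeasure (Measure.pi fun _ : κ => π.tilted H) := by
  have := isProbabilityMeasure_tilted hi
  infer_instance

theorem integrable_gibbs_of_bounded {H : Ω → ℝ} (hi : Integrable (fun ω => Real.exp (H ω)) π)
    {n : ℕ} {F : (Fin n → Ω) → ℝ} (hF : Measurable F) {K : ℝ} (hK : ∀ ω, |F ω| ≤ K) :
    Integrable F (Measure.pi fun _ : Fin n => π.tilted H) := by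
  have := isProbabilityMeasure_pi_tilted (κ := Fin n) hi
  exact Integrable.of_bound hF.aestronglyMeasurable K (ae_of_all _ hK)

theorem abs_gibbsAvg_le {H : Ω → ℝ} (hi : Integrable (fun ω => Real.exp (H ω)) π)
    {n : ℕ} {F : (Fin n → Ω) → ℝ} {K : ℝ} (hK : ∀ ω, |F ω| ≤ K) :
    |gibbsAvg π H F| ≤ K := by
  have := isProbabilityMeasure_pi_tilted (κ := Fin n) hi
  have := norm_integral_le_of_norm_le_const (μ := Measure.pi fun _ : Fin n => π.tilted H)
    (f := F) (ae_of_all _ hK)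
  simpa [gibbsAvg] using this

/-- Confines the Hamiltonian to explicit integrals against the fixed measure `π`, which is what
differentiation and measurability in a parameter need. -/
theorem gibbsAvg_eq_div (H : Ω → ℝ) (hi : Integrable (fun ω => Real.exp (H ω)) π)
    {n : ℕ} (F : (Fin n → Ω) → ℝ) :
    gibbsAvg π H F
      = (∫ ω, F ω * Real.exp (∑ k, H (ω k)) ∂(Measure.pi fun _ : Fin n => π)) / partFn π H ^ n := by
  rw [gibbsAvg, pi_tilted π fun _ => hi, integral_tilted]
  have : ∫ ω, Real.exp (∑ k, H (ω k)) ∂(Measure.pi fun _ : Fin n => π) = partFn π H ^ n := by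
    simp_rw [Real.exp_sum]
    rw [integral_fintype_prod_eq_prod (𝕜 := ℝ) (fun _ x => Real.exp (H x))]
    simp [partFn]
  rw [this, ← integral_div]
  congr 1; ext ω
  simp only [smul_eq_mul]; ring

/-- Replicas are i.i.d., so they may be relabelled, and idle ones added or dropped. -/
theorem gibbsAvg_comp {H : Ω → ℝ} (hi : Integrable (fun ω => Real.exp (H ω)) π)
    {n m : ℕ} {e : Fin m → Fin n} (he : Function.Injective e) {F : (Fin m → Ω) → ℝ}
    (hF : Measurable F) :
    gibbsAvg π H (fun ω : Fin n → Ω => F fun k => ω (e k)) = gibbsAvg π H F := by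
  have := isProbabilityMeasure_tilted hi
  have mp := measurePreserving_comp_pi (π.tilted H) he
  unfold gibbsAvg
  rw [← mp.map_eq, integral_map mp.measurable.aemeasurable hF.aestronglyMeasurable]

theorem gibbsAvg_init_mul_last {H : Ω → ℝ} (hi : Integrable (fun ω => Real.exp (H ω)) π)
    {n : ℕ} (F : (Fin n → Ω) → ℝ) (f : Ω → ℝ) :
    gibbsAvg π H (fun ω : Fin (n + 1) → Ω => F (fun k => ω k.castSucc) * f (ω (Fin.last n)))
      = gibbsAvg π H F * ∫ ω, f ω ∂(π.tilted H) := by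
  have := isProbabilityMeasure_tilted hi
  have mp := measurePreserving_piFinSuccAbove (fun _ : Fin (n + 1) => π.tilted H) (Fin.last n)
  unfold gibbsAvg
  rw [mul_comm, ← integral_prod_mul, ← mp.map_eq]
  rw [integral_map_equiv]
  congr 1; ext ω
  simp only [MeasurableEquiv.piFinSuccAbove, Fin.insertNthEquiv, MeasurableEquiv.coe_mk,
    Equiv.coe_fn_symm_mk, Fin.removeNth_last]
  exact mul_comm _ _

theorem gibbsAvg_sum {H : Ω → ℝ} (hi : Integrable (fun ω => Real.exp (H ω)) π)
    {n : ℕ} {σ : Type*} (s : Finset σ) (F : σ → (Fin n → Ω) → ℝ) (hF : ∀ j, Measurable (F j))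
    (K : σ → ℝ) (hK : ∀ j ω, |F j ω| ≤ K j) :
    gibbsAvg π H (fun ω => ∑ j ∈ s, F j ω) = ∑ j ∈ s, gibbsAvg π H (F j) := by
  unfold gibbsAvg
  exact integral_finsetSum _ fun j _ => integrable_gibbs_of_bounded hi (hF j) (hK j)

theorem gibbsAvg_const_mul {π : Measure Ω} (H : Ω → ℝ) {n : ℕ} (c : ℝ) (F : (Fin n → Ω) → ℝ) :
    gibbsAvg π H (fun ω => c * F ω) = c * gibbsAvg π H F :=
  integral_const_mul _ _

theorem hasDerivAt_integral_mul_exp {Θ : Type*} [MeasurableSpace Θ] (ν : Measure Θ)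
    [IsProbabilityMeasure ν] {F : Θ → ℝ} (hF : Measurable F) {K : ℝ} (hK : ∀ θ, |F θ| ≤ K)
    {H H' : ℝ → Θ → ℝ} {z : ℝ} {C : ℝ} (hm : ∀ x, Measurable (H x)) (hm' : ∀ x, Measurable (H' x))
    (hb : ∀ x ∈ Metric.ball z 1, ∀ θ, |H x θ| ≤ C) (hb' : ∀ x ∈ Metric.ball z 1, ∀ θ, |H' x θ| ≤ C)
    (hd : ∀ x θ, HasDerivAt (fun x => H x θ) (H' x θ) x) :
    HasDerivAt (fun x => ∫ θ, F θ * Real.exp (H x θ) ∂ν)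
      (∫ θ, F θ * H' z θ * Real.exp (H z θ) ∂ν) z := by
  have hz : z ∈ Metric.ball z (1 : ℝ) := Metric.mem_ball_self one_pos
  refine (hasDerivAt_integral_of_dominated_loc_of_deriv_le (𝕜 := ℝ) (μ := ν)
    (F := fun x θ => F θ * Real.exp (H x θ)) (F' := fun x θ => F θ * H' x θ * Real.exp (H x θ))
    (bound := fun _ => K * C * Real.exp C) (Metric.ball_mem_nhds z one_pos)
    (Filter.Eventually.of_forall fun x => ?_) ?_ ?_ (ae_of_all _ fun θ x hx => ?_)
    (integrable_const _) (ae_of_all _ fun θ x hx => ?_)).2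
  · have := hm x
    fun_prop
  · refine Integrable.of_bound (by have := hm z; fun_prop) (K * Real.exp C)
      (ae_of_all _ fun θ => ?_)
    rw [norm_mul, Real.norm_eq_abs, Real.norm_eq_abs, abs_of_pos (Real.exp_pos _)]
    have h1 := hK θ
    have h2 := Real.exp_le_exp.2 ((le_abs_self _).trans (hb z hz θ))
    have := (abs_nonneg _).trans h1
    gcongr
  · have := hm z
    have := hm' z
    fun_prop
  · rw [norm_mul, norm_mul, Real.norm_eq_abs, Real.norm_eq_abs, Real.norm_eq_abs,
      abs_of_pos (Real.exp_pos _)]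
    have h1 := hK θ
    have h3 := hb' x hx θ
    have h2 := Real.exp_le_exp.2 ((le_abs_self _).trans (hb x hx θ))
    have := (abs_nonneg _).trans h1
    have := (abs_nonneg _).trans h3
    gcongr
  · refine (((hd x θ).exp).const_mul (F θ)).congr_deriv ?_
    ring

/-- The weights of the replicas produced by differentiating `Z ^ q ⟨F⟩`. -/
noncomputable def replicaWeight (q : ℂ) (n : ℕ) (a : Fin (n + 1)) : ℂ :=
  if a = Fin.last n then q - n else 1

/-- `Z ^ q` times the Gibbs average of `F`. -/
noncomputable def weightedAvg (q : ℂ) (π : Measure Ω) (H : Ω → ℝ) {n : ℕ} (F : (Fin n → Ω) → ℝ) :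
    ℂ :=
  Complex.exp (q * Real.log (partFn π H)) * gibbsAvg π H F

theorem hasDerivAt_weightedAvg (q : ℂ) {n : ℕ} {F : (Fin n → Ω) → ℝ} (hF : Measurable F)
    {K : ℝ} (hK : ∀ ω, |F ω| ≤ K) {H H' : ℝ → Ω → ℝ} {z : ℝ} {C : ℝ}
    (hm : ∀ x, Measurable (H x)) (hm' : ∀ x, Measurable (H' x))
    (hb : ∀ x ∈ Metric.ball z 1, ∀ ω, |H x ω| ≤ C)
    (hb' : ∀ x ∈ Metric.ball z 1, ∀ ω, |H' x ω| ≤ C)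
    (hi : ∀ x, Integrable (fun ω => Real.exp (H x ω)) π)
    (hd : ∀ x ω, HasDerivAt (fun x => H x ω) (H' x ω) x) :
    HasDerivAt (fun x => weightedAvg q π (H x) F)
      (∑ a : Fin (n + 1), replicaWeight q n a *
        weightedAvg q π (H z) (fun ω : Fin (n + 1) → Ω => F (fun k => ω k.castSucc) * H' z (ω a)))
      z := by
  have hz : z ∈ Metric.ball z (1 : ℝ) := Metric.mem_ball_self one_pos
  have hZ : 0 < partFn π (H z) := partFn_pos (hi z)
  have dZ : HasDerivAt (fun x => partFn π (H x)) (∫ ω, H' z ω * Real.exp (H z ω) ∂π) z := by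
    have := hasDerivAt_integral_mul_exp π (F := fun _ => 1) measurable_const (K := 1) (by simp)
      hm hm' hb hb' hd
    simpa [partFn] using this
  have dA : HasDerivAt
      (fun x => ∫ ω, F ω * Real.exp (∑ k, H x (ω k)) ∂(Measure.pi fun _ : Fin n => π))
      (∫ ω, F ω * (∑ k, H' z (ω k)) * Real.exp (∑ k, H z (ω k)) ∂(Measure.pi fun _ : Fin n => π))
      z := by
    refine hasDerivAt_integral_mul_exp (C := n * C) (Measure.pi fun _ : Fin n => π) hF hK
      (H := fun x ω => ∑ k, H x (ω k)) (H' := fun x ω => ∑ k, H' x (ω k))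
      (fun x => by have := hm x; fun_prop) (fun x => by have := hm' x; fun_prop)
      (fun x hx ω => ?_) (fun x hx ω => ?_) (fun x ω => ?_)
    · refine (Finset.abs_sum_le_sum_abs _ _).trans ?_
      refine (Finset.sum_le_card_nsmul _ _ C fun k _ => hb x hx _).trans (by simp)
    · refine (Finset.abs_sum_le_sum_abs _ _).trans ?_
      refine (Finset.sum_le_card_nsmul _ _ C fun k _ => hb' x hx _).trans (by simp)
    · exact HasDerivAt.fun_sum fun k _ => hd x (ω k)
  have hdZ' : ∫ ω, H' z ω ∂(π.tilted (H z))
      = (∫ ω, H' z ω * Real.exp (H z ω) ∂π) / partFn π (H z) := by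
    rw [integral_tilted, ← integral_div]
    congr 1; ext ω
    simp only [smul_eq_mul, partFn]; ring
  -- The terms where the derivative falls on one of the `n` replicas, rewritten with an idle extra
  -- replica so that all terms live on `n + 1` replicas.
  have hdA' : ∑ k : Fin n, gibbsAvg π (H z)
        (fun ω : Fin (n + 1) → Ω => F (fun k => ω k.castSucc) * H' z (ω k.castSucc))
      = (∫ ω, F ω * (∑ k, H' z (ω k)) * Real.exp (∑ k, H z (ω k))
        ∂(Measure.pi fun _ : Fin n => π)) / partFn π (H z) ^ n := by
    rw [← gibbsAvg_eq_div (H z) (hi z)]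
    simp_rw [Finset.mul_sum]
    rw [gibbsAvg_sum (hi z) _ _ (fun j => by have := hm' z; fun_prop) (fun _ => K * C)]
    · refine Finset.sum_congr rfl fun k _ => ?_
      exact gibbsAvg_comp (F := fun ω : Fin n → Ω => F ω * H' z (ω k)) (hi z)
        (Fin.castSucc_injective n) (by have := hm' z; fun_prop)
    · intro k ω
      rw [abs_mul]
      have := (abs_nonneg _).trans (hK ω)
      exact mul_le_mul (hK ω) (hb' z hz _) (abs_nonneg _) this
  -- `Z^q ⟨F⟩` is `exp (q log Z)` times `A / Z^n`. The exponential contributes `q Z'/Z` and the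
  -- denominator `-n Z'/Z`, where `Z'/Z` is the average of `H'` over a fresh replica: hence the
  -- weight `q - n`.
  have h1 : HasDerivAt (fun x => weightedAvg q π (H x) F) _ z :=
    (((dZ.log hZ.ne').ofReal_comp.const_mul q).cexp.mul
      ((dA.div (dZ.pow n) (pow_ne_zero n hZ.ne')).ofReal_comp)).congr_of_eventuallyEq
      (Filter.Eventually.of_forall fun x => by
        simp only [weightedAvg]
        rw [gibbsAvg_eq_div (H x) (hi x)]
        rfl)
  refine h1.congr_deriv ?_
  rw [Fin.sum_univ_castSucc]
  have hw : ∀ k : Fin n, replicaWeight q n k.castSucc = 1 := fun k => by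
    simp [replicaWeight, Fin.castSucc_ne_last]
  simp only [weightedAvg, hw, one_mul]
  rw [← Finset.mul_sum, ← Complex.ofReal_sum, hdA']
  rw [gibbsAvg_init_mul_last (hi z) F (H' z), hdZ', gibbsAvg_eq_div (H z) (hi z) F]
  simp only [replicaWeight, if_true, Pi.pow_apply, Pi.div_apply]
  generalize (∫ ω, H' z ω * Real.exp (H z ω) ∂π) = Z'
  generalize (∫ ω, F ω * Real.exp (∑ k, H z (ω k)) ∂(Measure.pi fun _ : Fin n => π)) = A
  generalize (∫ ω, F ω * (∑ k, H' z (ω k)) * Real.exp (∑ k, H z (ω k))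
        ∂(Measure.pi fun _ : Fin n => π)) = A'
  have hZc : ((partFn π (H z) : ℝ) : ℂ) ≠ 0 := by exact_mod_cast hZ.ne'
  generalize partFn π (H z) = Z at *
  push_cast
  -- The power rule produces the truncated exponent `n - 1`, so `n = 0` is separate.
  rcases n with _ | m
  · simp; field_simp; ring
  · simp only [Nat.add_sub_cancel]
    push_cast
    field_simp
    ring

end Replicas

/-! ### Closure properties of bounded measurable functions. -/

section BoundedMeasurable

/-- Bounded measurable real functions. -/
structure IsBddMeas {α : Type*} [MeasurableSpace α] (f : α → ℝ) : Prop where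
  measurable : Measurable f
  bounded : ∃ K, ∀ x, |f x| ≤ K

namespace IsBddMeas

variable {α β : Type*} [MeasurableSpace α] [MeasurableSpace β] {f g : α → ℝ}

theorem const (c : ℝ) : IsBddMeas (fun _ : α => c) := ⟨measurable_const, |c|, fun _ => le_rfl⟩

theorem mul (hf : IsBddMeas f) (hg : IsBddMeas g) : IsBddMeas (fun x => f x * g x) := by
  obtain ⟨K, hK⟩ := hf.bounded
  obtain ⟨L, hL⟩ := hg.bounded
  refine ⟨hf.measurable.mul hg.measurable, K * L, fun x => ?_⟩
  rw [abs_mul]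
  exact mul_le_mul (hK x) (hL x) (abs_nonneg _) ((abs_nonneg _).trans (hK x))

theorem add (hf : IsBddMeas f) (hg : IsBddMeas g) : IsBddMeas (fun x => f x + g x) := by
  obtain ⟨K, hK⟩ := hf.bounded
  obtain ⟨L, hL⟩ := hg.bounded
  exact ⟨hf.measurable.add hg.measurable, K + L,
    fun x => (abs_add_le _ _).trans (add_le_add (hK x) (hL x))⟩

theorem sub (hf : IsBddMeas f) (hg : IsBddMeas g) : IsBddMeas (fun x => f x - g x) := by
  simpa [sub_eq_add_neg] using hf.add ((const (-1)).mul hg)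

theorem abs (hf : IsBddMeas f) : IsBddMeas (fun x => |f x|) := by
  obtain ⟨K, hK⟩ := hf.bounded
  exact ⟨hf.measurable.abs, K, fun x => by simpa using hK x⟩

theorem pow (hf : IsBddMeas f) (n : ℕ) : IsBddMeas (fun x => f x ^ n) := by
  induction n with
  | zero => simpa using const 1
  | succ n ih => simpa [pow_succ] using ih.mul hf

theorem comp (hf : IsBddMeas f) {e : β → α} (he : Measurable e) : IsBddMeas (fun x => f (e x)) :=
  ⟨hf.measurable.comp he, hf.bounded.imp fun _ h x => h (e x)⟩

theorem sum {σ : Type*} (s : Finset σ) {f : σ → α → ℝ} (hf : ∀ j, IsBddMeas (f j)) :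
    IsBddMeas (fun x => ∑ j ∈ s, f j x) := by
  classical
  induction s using Finset.induction_on with
  | empty => simpa using const 0
  | insert j s hj ih => simpa [Finset.sum_insert hj] using (hf j).add ih

end IsBddMeas

end BoundedMeasurable

/-! ### Averages over the Gaussian observation. -/

section Interpolation

variable {Ω : Type*} [MeasurableSpace Ω] {ι : Type*} [Fintype ι]

/-- The log-density at `y` of the Gaussian shifted by `x` relative to the centred one. -/
noncomputable def energy (x y : ι → ℝ) : ℝ := ∑ i, (y i * x i - x i ^ 2 / 2)

/-- Linear growth in `|y|` for bounded signals: all integrands below are then dominated by `A exp (K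
∑ |y i|)`, which is Gaussian-integrable. -/
theorem abs_energy_le {x y : ι → ℝ} {C : ℝ} (hx : ∀ i, |x i| ≤ C) :
    |energy x y| ≤ C * ∑ i, |y i| + Fintype.card ι * (C ^ 2 / 2) := by
  have : ∀ i, |y i * x i - x i ^ 2 / 2| ≤ C * |y i| + C ^ 2 / 2 := fun i => by
    have h1 : |y i * x i| ≤ C * |y i| := by
      rw [abs_mul, mul_comm]
      exact mul_le_mul_of_nonneg_right (hx i) (abs_nonneg _)
    have h2 : |x i ^ 2 / 2| ≤ C ^ 2 / 2 := by
      rw [abs_of_nonneg (by positivity), ← sq_abs]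
      have := hx i
      gcongr
    exact (abs_sub _ _).trans (add_le_add h1 h2)
  refine (Finset.abs_sum_le_sum_abs _ _).trans ((Finset.sum_le_sum fun i _ => this i).trans ?_)
  rw [Finset.sum_add_distrib, ← Finset.mul_sum]
  simp

/-- The weighted Gibbs average of `F` integrated over a standard Gaussian observation. -/
noncomputable def obsAvg (q : ℂ) (π : Measure Ω) (h : Ω → ι → ℝ) {n : ℕ} (F : (Fin n → Ω) → ℝ) :
    ℂ :=
  ∫ y, weightedAvg q π (fun ω => energy (h ω) y) F ∂(stdGauss ι)

theorem exists_field_bound {h : Ω → ι → ℝ} (hh : ∀ i, IsBddMeas fun ω => h ω i) :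
    ∃ C, 0 ≤ C ∧ ∀ ω i, |h ω i| ≤ C := by
  choose K hK using fun i => (hh i).bounded
  refine ⟨∑ i, |K i|, Finset.sum_nonneg fun _ _ => abs_nonneg _, fun ω i => ?_⟩
  exact ((hK i ω).trans (le_abs_self _)).trans
    (Finset.single_le_sum (f := fun i => |K i|) (fun _ _ => abs_nonneg _) (Finset.mem_univ i))

theorem measurable_energy {h : Ω → ι → ℝ} (hh : ∀ i, IsBddMeas fun ω => h ω i) (y : ι → ℝ) :
    Measurable fun ω => energy (h ω) y := by
  have := fun i => (hh i).measurable
  unfold energy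
  fun_prop

variable {π : Measure Ω} [IsProbabilityMeasure π]

theorem integrable_exp_energy {h : Ω → ι → ℝ} (hh : ∀ i, IsBddMeas fun ω => h ω i) (y : ι → ℝ) :
    Integrable (fun ω => Real.exp (energy (h ω) y)) π := by
  obtain ⟨C, -, hC⟩ := exists_field_bound hh
  exact integrable_exp_of_abs_le (measurable_energy hh y) fun ω => abs_energy_le (hC ω)

/-- `|Z^q| = Z` because `Re q = 1`: the oscillating factor disappears in modulus. -/
theorem norm_weightedAvg_le {q : ℂ} (hq : q.re = 1) {H : Ω → ℝ}
    (hi : Integrable (fun ω => Real.exp (H ω)) π) {n : ℕ} (F : (Fin n → Ω) → ℝ) :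
    ‖weightedAvg q π H F‖ ≤ partFn π H * gibbsAvg π H (fun ω => |F ω|) := by
  have hZ := partFn_pos hi
  rw [weightedAvg, norm_mul, Complex.norm_exp]
  have : (q * (Real.log (partFn π H) : ℂ)).re = Real.log (partFn π H) := by
    simp [hq]
  rw [this, Real.exp_log hZ]
  refine mul_le_mul_of_nonneg_left ?_ hZ.le
  rw [Complex.norm_real]
  exact norm_integral_le_integral_norm _

theorem norm_weightedAvg_le_of_bound {q : ℂ} (hq : q.re = 1) {H : Ω → ℝ} (hm : Measurable H)
    {C : ℝ} (hb : ∀ ω, |H ω| ≤ C) {n : ℕ} {F : (Fin n → Ω) → ℝ} {K : ℝ} (hK : ∀ ω, |F ω| ≤ K) :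
    ‖weightedAvg q π H F‖ ≤ Real.exp C * K := by
  have hi := integrable_exp_of_abs_le (π := π) hm hb
  have h1 : gibbsAvg π H (fun ω => |F ω|) ≤ K :=
    (le_abs_self _).trans (abs_gibbsAvg_le hi fun ω => by simpa using hK ω)
  have h0 : 0 ≤ gibbsAvg π H (fun ω => |F ω|) := integral_nonneg fun _ => abs_nonneg _
  refine (norm_weightedAvg_le hq hi F).trans ?_
  exact mul_le_mul (partFn_le hm hb) h1 h0 (Real.exp_pos _).le

theorem measurable_energy_uncurry {h : Ω → ι → ℝ} (hh : ∀ i, IsBddMeas fun ω => h ω i) :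
    Measurable fun p : (ι → ℝ) × Ω => energy (h p.2) p.1 := by
  have := fun i => (hh i).measurable
  unfold energy
  fun_prop

theorem measurable_partFn {h : Ω → ι → ℝ} (hh : ∀ i, IsBddMeas fun ω => h ω i) :
    Measurable fun y => partFn π (fun ω => energy (h ω) y) := by
  have hm := measurable_energy_uncurry hh
  have : StronglyMeasurable fun p : (ι → ℝ) × Ω => Real.exp (energy (h p.2) p.1) :=
    (by fun_prop : Measurable _).stronglyMeasurable
  exact this.integral_prod_right'.measurable

theorem measurable_gibbsAvg {h : Ω → ι → ℝ} (hh : ∀ i, IsBddMeas fun ω => h ω i)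
    {n : ℕ} {F : (Fin n → Ω) → ℝ} (hF : IsBddMeas F) :
    Measurable fun y => gibbsAvg π (fun ω => energy (h ω) y) F := by
  have h1 := fun i => (hh i).measurable
  have hFm := hF.measurable
  have : StronglyMeasurable fun p : (ι → ℝ) × (Fin n → Ω) =>
      F p.2 * Real.exp (∑ k, energy (h (p.2 k)) p.1) := by
    refine Measurable.stronglyMeasurable ?_
    unfold energy
    fun_prop
  have h2 := this.integral_prod_right' (ν := Measure.pi fun _ : Fin n => π)
  have h3 := (h2.measurable).div ((measurable_partFn (π := π) hh).pow_const n)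
  convert h3 using 2 with y
  exact gibbsAvg_eq_div _ (integrable_exp_energy hh y) F

theorem measurable_weightedAvg (q : ℂ) {h : Ω → ι → ℝ} (hh : ∀ i, IsBddMeas fun ω => h ω i)
    {n : ℕ} {F : (Fin n → Ω) → ℝ} (hF : IsBddMeas F) :
    Measurable fun y => weightedAvg q π (fun ω => energy (h ω) y) F := by
  have h1 := measurable_gibbsAvg (π := π) hh hF
  have h2 := measurable_partFn (π := π) hh
  unfold weightedAvg
  fun_prop

theorem integrable_of_norm_le_exp {E : Type*} [NormedAddCommGroup E] [MeasurableSpace E]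
    [BorelSpace E] [SecondCountableTopology E] {f : (ι → ℝ) → E} (hf : Measurable f) {A K : ℝ}
    (hb : ∀ y, ‖f y‖ ≤ A * Real.exp (K * ∑ i, |y i|)) : Integrable f (stdGauss ι) :=
  ((integrable_exp_sum_abs K).const_mul A).mono' hf.aestronglyMeasurable (ae_of_all _ hb)

theorem abs_coord_le_exp (y : ι → ℝ) (i : ι) : |y i| ≤ Real.exp (∑ j, |y j|) := by
  have h1 : |y i| ≤ ∑ j, |y j| :=
    Finset.single_le_sum (f := fun j => |y j|) (fun _ _ => abs_nonneg _) (Finset.mem_univ i)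
  have h2 := Real.add_one_le_exp (∑ j, |y j|)
  linarith

theorem exists_norm_weightedAvg_le {q : ℂ} (hq : q.re = 1) {h : Ω → ι → ℝ}
    (hh : ∀ i, IsBddMeas fun ω => h ω i) {n : ℕ} {F : (Fin n → Ω) → ℝ} (hF : IsBddMeas F) :
    ∃ A K, 0 ≤ A ∧ ∀ y, ‖weightedAvg q π (fun ω => energy (h ω) y) F‖
      ≤ A * Real.exp (K * ∑ i, |y i|) := by
  obtain ⟨C, hC0, hC⟩ := exists_field_bound hh
  obtain ⟨L, hL⟩ := hF.bounded
  refine ⟨Real.exp (Fintype.card ι * (C ^ 2 / 2)) * |L|, C, by positivity, fun y => ?_⟩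
  refine (norm_weightedAvg_le_of_bound hq (measurable_energy hh y)
    (fun ω => abs_energy_le (hC ω)) (fun ω => (hL ω).trans (le_abs_self _))).trans (le_of_eq ?_)
  rw [Real.exp_add]; ring

theorem integrable_weightedAvg {q : ℂ} (hq : q.re = 1) {h : Ω → ι → ℝ}
    (hh : ∀ i, IsBddMeas fun ω => h ω i) {n : ℕ} {F : (Fin n → Ω) → ℝ} (hF : IsBddMeas F) :
    Integrable (fun y => weightedAvg q π (fun ω => energy (h ω) y) F) (stdGauss ι) := by
  obtain ⟨A, K, -, hb⟩ := exists_norm_weightedAvg_le (π := π) hq hh hF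
  exact integrable_of_norm_le_exp (measurable_weightedAvg q hh hF) hb

theorem integrable_coord_mul_weightedAvg {q : ℂ} (hq : q.re = 1) {h : Ω → ι → ℝ}
    (hh : ∀ i, IsBddMeas fun ω => h ω i) {n : ℕ} {F : (Fin n → Ω) → ℝ} (hF : IsBddMeas F) (i : ι) :
    Integrable (fun y => (y i : ℂ) * weightedAvg q π (fun ω => energy (h ω) y) F)
      (stdGauss ι) := by
  obtain ⟨A, K, hA, hb⟩ := exists_norm_weightedAvg_le (π := π) hq hh hF
  have := measurable_weightedAvg (π := π) q hh hF
  refine integrable_of_norm_le_exp (A := A) (K := 1 + K) (by fun_prop) fun y => ?_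
  rw [norm_mul, Complex.norm_real, add_mul, Real.exp_add, one_mul]
  calc _ ≤ Real.exp (∑ j, |y j|) * (A * Real.exp (K * ∑ i, |y i|)) :=
        mul_le_mul (abs_coord_le_exp y i) (hb y) (norm_nonneg _) (Real.exp_pos _).le
    _ = _ := by ring

theorem weightedAvg_sum (q : ℂ) {H : Ω → ℝ} (hi : Integrable (fun ω => Real.exp (H ω)) π)
    {n : ℕ} {σ : Type*} (s : Finset σ) {F : σ → (Fin n → Ω) → ℝ} (hF : ∀ j, IsBddMeas (F j)) :
    weightedAvg q π H (fun ω => ∑ j ∈ s, F j ω) = ∑ j ∈ s, weightedAvg q π H (F j) := by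
  unfold weightedAvg
  choose K hK using fun j => (hF j).bounded
  rw [gibbsAvg_sum hi s F (fun j => (hF j).measurable) K hK, Complex.ofReal_sum, Finset.mul_sum]

theorem weightedAvg_const_mul {π : Measure Ω} (q : ℂ) (H : Ω → ℝ) {n : ℕ} (c : ℝ)
    (F : (Fin n → Ω) → ℝ) :
    weightedAvg q π H (fun ω => c * F ω) = c * weightedAvg q π H F := by
  rw [weightedAvg, gibbsAvg_const_mul, weightedAvg]; push_cast; ring

theorem obsAvg_sum {q : ℂ} (hq : q.re = 1) {h : Ω → ι → ℝ}
    (hh : ∀ i, IsBddMeas fun ω => h ω i) {n : ℕ} {σ : Type*} (s : Finset σ)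
    {F : σ → (Fin n → Ω) → ℝ} (hF : ∀ j, IsBddMeas (F j)) :
    obsAvg q π h (fun ω => ∑ j ∈ s, F j ω) = ∑ j ∈ s, obsAvg q π h (F j) := by
  unfold obsAvg
  rw [← integral_finsetSum _ fun j _ => integrable_weightedAvg hq hh (hF j)]
  congr 1; ext y
  exact weightedAvg_sum q (integrable_exp_energy hh y) s hF

theorem obsAvg_const_mul {π : Measure Ω} (q : ℂ) (h : Ω → ι → ℝ) {n : ℕ} (c : ℝ)
    (F : (Fin n → Ω) → ℝ) :
    obsAvg q π h (fun ω => c * F ω) = c * obsAvg q π h F := by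
  simp only [obsAvg, weightedAvg_const_mul, integral_const_mul]

theorem obsAvg_add {q : ℂ} (hq : q.re = 1) {h : Ω → ι → ℝ}
    (hh : ∀ i, IsBddMeas fun ω => h ω i) {n : ℕ} {F G : (Fin n → Ω) → ℝ}
    (hF : IsBddMeas F) (hG : IsBddMeas G) :
    obsAvg q π h (fun ω => F ω + G ω) = obsAvg q π h F + obsAvg q π h G := by
  have := obsAvg_sum (π := π) hq hh Finset.univ
    (F := fun j : Fin 2 => if j = 0 then F else G) (fun j => by split_ifs <;> assumption)
  simpa using this

theorem obsAvg_sub {q : ℂ} (hq : q.re = 1) {h : Ω → ι → ℝ}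
    (hh : ∀ i, IsBddMeas fun ω => h ω i) {n : ℕ} {F G : (Fin n → Ω) → ℝ}
    (hF : IsBddMeas F) (hG : IsBddMeas G) :
    obsAvg q π h (fun ω => F ω - G ω) = obsAvg q π h F - obsAvg q π h G := by
  have := obsAvg_add (π := π) hq hh hF ((IsBddMeas.const (-1)).mul hG)
  rw [obsAvg_const_mul] at this
  simpa [sub_eq_add_neg] using this

theorem weightedAvg_comp (q : ℂ) {H : Ω → ℝ} (hi : Integrable (fun ω => Real.exp (H ω)) π)
    {n m : ℕ} {e : Fin m → Fin n} (he : Function.Injective e) {F : (Fin m → Ω) → ℝ}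
    (hF : Measurable F) :
    weightedAvg q π H (fun ω : Fin n → Ω => F fun k => ω (e k)) = weightedAvg q π H F := by
  rw [weightedAvg, gibbsAvg_comp hi he hF, weightedAvg]

theorem obsAvg_comp (q : ℂ) {h : Ω → ι → ℝ} (hh : ∀ i, IsBddMeas fun ω => h ω i)
    {n m : ℕ} {e : Fin m → Fin n} (he : Function.Injective e) {F : (Fin m → Ω) → ℝ}
    (hF : Measurable F) :
    obsAvg q π h (fun ω : Fin n → Ω => F fun k => ω (e k)) = obsAvg q π h F := by
  unfold obsAvg
  congr 1; ext y
  exact weightedAvg_comp q (integrable_exp_energy hh y) he hF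

/-- Gaussian integration by parts for weighted Gibbs averages. -/
theorem integral_coord_mul_weightedAvg {q : ℂ} (hq : q.re = 1) {h : Ω → ι → ℝ}
    (hh : ∀ i, IsBddMeas fun ω => h ω i) {n : ℕ} {F : (Fin n → Ω) → ℝ} (hF : IsBddMeas F) (i : ι) :
    ∫ y, (y i : ℂ) * weightedAvg q π (fun ω => energy (h ω) y) F ∂(stdGauss ι)
      = ∑ b : Fin (n + 1), replicaWeight q n b *
        obsAvg q π h (fun ω : Fin (n + 1) → Ω => F (fun k => ω k.castSucc) * h (ω b) i) := by
  classical
  have hG : ∀ b, IsBddMeas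
      (fun ω : Fin (n + 1) → Ω => F (fun k => ω k.castSucc) * h (ω b) i) := fun b =>
    (hF.comp (by fun_prop)).mul ((hh i).comp (by fun_prop))
  rw [integral_stdGauss_mul_eq_integral_deriv i (f' := fun y => ∑ b : Fin (n + 1),
    replicaWeight q n b * weightedAvg q π (fun ω => energy (h ω) y)
      (fun ω : Fin (n + 1) → Ω => F (fun k => ω k.castSucc) * h (ω b) i)) ?hd
    (integrable_weightedAvg hq hh hF) (integrable_coord_mul_weightedAvg hq hh hF i) ?hint]
  case hint => exact integrable_finsetSum _ fun b _ => (integrable_weightedAvg hq hh (hG b)).const_mul _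
  · rw [integral_finsetSum _ fun b _ => (integrable_weightedAvg hq hh (hG b)).const_mul _]
    simp_rw [integral_const_mul]
    rfl
  · intro y
    obtain ⟨C, hC0, hC⟩ := exists_field_bound hh
    obtain ⟨K, hK⟩ := hF.bounded
    -- The constant must dominate both the derivative `h ω i` and the energy while coordinate `i`
    -- moves by at most `1`, hence the maximum and the `|y j| + 1`.
    have key := hasDerivAt_weightedAvg (π := π) q hF.measurable hK
      (H := fun t ω => energy (h ω) (Function.update y i t)) (H' := fun _ ω => h ω i) (z := y i)
      (C := max C (C * ∑ j, (|y j| + 1) + Fintype.card ι * (C ^ 2 / 2)))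
      (fun t => measurable_energy hh _) (fun t => (hh i).measurable)
      (fun t ht ω => le_max_of_le_right ?_) (fun t _ ω => le_max_of_le_left (hC ω i))
      (fun t => integrable_exp_energy hh _) (fun t ω => ?_)
    · simpa using key
    · refine (abs_energy_le (hC ω)).trans ?_
      gcongr with j
      by_cases hj : j = i
      · subst hj
        rw [Metric.mem_ball, Real.dist_eq] at ht
        have := abs_add_le (t - y j) (y j)
        simp only [sub_add_cancel] at this
        simp only [Function.update_self]
        linarith
      · simp [hj]
    · unfold energy
      have : ∀ j, HasDerivAt (fun t => Function.update y i t j * h ω j - h ω j ^ 2 / 2)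
          (if j = i then h ω i else 0) t := fun j => by
        by_cases hj : j = i
        · subst hj
          simpa using ((hasDerivAt_id t).mul_const (h ω j)).sub_const (h ω j ^ 2 / 2)
        · simpa [hj] using hasDerivAt_const t (y j * h ω j)
      simpa using HasDerivAt.fun_sum (u := Finset.univ) fun j _ => this j

end Interpolation

/-! ### Derivative of the averages along an affine path of signals. -/

section PathDerivative

variable {Ω : Type*} [MeasurableSpace Ω] {ι : Type*}

/-- The affine path of signals `a + τ b`. -/
def pathField (a b : Ω → ι → ℝ) (τ : ℝ) : Ω → ι → ℝ := fun ω i => a ω i + τ * b ω i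

theorem isBddMeas_pathField {a b : Ω → ι → ℝ} (ha : ∀ i, IsBddMeas fun ω => a ω i)
    (hb : ∀ i, IsBddMeas fun ω => b ω i) (τ : ℝ) (i : ι) :
    IsBddMeas fun ω => pathField a b τ ω i :=
  (ha i).add ((IsBddMeas.const τ).mul (hb i))

variable [Fintype ι] {π : Measure Ω} [IsProbabilityMeasure π]

theorem replicaWeight_castSucc (q : ℂ) {n : ℕ} (x : Fin n) : replicaWeight q n x.castSucc = 1 := by
  simp [replicaWeight, Fin.castSucc_ne_last]

/-- Integration by parts replaces `y i` by a sum of `h (ω z) i` over replicas `z`. The term `z = x`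
cancels the `-h (ω x) i` coming from the quadratic part of the energy, so only pairs of distinct
replicas survive. -/
theorem sum_integral_eq_sum_obsAvg {q : ℂ} (hq : q.re = 1) {h : Ω → ι → ℝ} {b : Ω → ι → ℝ}
    (hh : ∀ i, IsBddMeas fun ω => h ω i) (hb : ∀ i, IsBddMeas fun ω => b ω i)
    {n : ℕ} {F : (Fin n → Ω) → ℝ} (hF : IsBddMeas F) (x : Fin (n + 1)) :
    ∫ y, weightedAvg q π (fun ω => energy (h ω) y) (fun ω : Fin (n + 1) → Ω =>
        F (fun k => ω k.castSucc) * ∑ i, b (ω x) i * (y i - h (ω x) i)) ∂(stdGauss ι)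
      = ∑ z : Fin (n + 2), if z = x.castSucc then 0 else replicaWeight q (n + 1) z *
        obsAvg q π h (fun ω : Fin (n + 2) → Ω =>
          F (fun k => ω k.castSucc.castSucc) * ∑ i, b (ω x.castSucc) i * h (ω z) i) := by
  have hFc : IsBddMeas (fun ω : Fin (n + 1) → Ω => F (fun k => ω k.castSucc)) :=
    hF.comp (by fun_prop)
  have hbx : ∀ i, IsBddMeas (fun ω : Fin (n + 1) → Ω => b (ω x) i) := fun i =>
    (hb i).comp (by fun_prop)
  have hhx : ∀ i, IsBddMeas (fun ω : Fin (n + 1) → Ω => h (ω x) i) := fun i =>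
    (hh i).comp (by fun_prop)
  have hG : ∀ i, IsBddMeas (fun ω : Fin (n + 1) → Ω => F (fun k => ω k.castSucc) * b (ω x) i) :=
    fun i => hFc.mul (hbx i)
  have hL : ∀ i z, IsBddMeas (fun ω : Fin (n + 2) → Ω =>
      F (fun k => ω k.castSucc.castSucc) * (b (ω x.castSucc) i * h (ω z) i)) := fun i z =>
    (hF.comp (by fun_prop)).mul (((hb i).comp (by fun_prop)).mul ((hh i).comp (by fun_prop)))
  have e1 : ∀ y : ι → ℝ, weightedAvg q π (fun ω => energy (h ω) y) (fun ω : Fin (n + 1) → Ω =>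
        F (fun k => ω k.castSucc) * ∑ i, b (ω x) i * (y i - h (ω x) i))
      = ∑ i, ((y i : ℂ) * weightedAvg q π (fun ω => energy (h ω) y)
          (fun ω : Fin (n + 1) → Ω => F (fun k => ω k.castSucc) * b (ω x) i)
        - weightedAvg q π (fun ω => energy (h ω) y)
          (fun ω : Fin (n + 1) → Ω => F (fun k => ω k.castSucc) * b (ω x) i * h (ω x) i)) := by
    intro y
    have hi := integrable_exp_energy (π := π) hh y
    have : (fun ω : Fin (n + 1) → Ω =>
        F (fun k => ω k.castSucc) * ∑ i, b (ω x) i * (y i - h (ω x) i))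
        = fun ω => ∑ i, ∑ j : Fin 2, if j = 0 then y i * (F (fun k => ω k.castSucc) * b (ω x) i)
          else -1 * (F (fun k => ω k.castSucc) * b (ω x) i * h (ω x) i) := by
      ext ω
      rw [Finset.mul_sum]
      refine Finset.sum_congr rfl fun i _ => ?_
      simp; ring
    rw [this]
    have hj : ∀ i (j : Fin 2), IsBddMeas (fun ω : Fin (n + 1) → Ω =>
        if j = 0 then y i * (F (fun k => ω k.castSucc) * b (ω x) i)
          else -1 * (F (fun k => ω k.castSucc) * b (ω x) i * h (ω x) i)) := fun i j => by
      split_ifs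
      · exact (IsBddMeas.const _).mul (hG i)
      · exact (IsBddMeas.const _).mul ((hG i).mul (hhx i))
    rw [weightedAvg_sum q hi Finset.univ fun i => IsBddMeas.sum Finset.univ (hj i)]
    refine Finset.sum_congr rfl fun i _ => ?_
    rw [weightedAvg_sum q hi Finset.univ (hj i)]
    simp only [Fin.sum_univ_two, if_true, one_ne_zero, if_false, weightedAvg_const_mul]
    push_cast; ring
  simp_rw [e1]
  rw [integral_finsetSum]
  swap
  · exact fun i _ => (integrable_coord_mul_weightedAvg hq hh (hG i) i).sub
      (integrable_weightedAvg hq hh ((hG i).mul (hhx i)))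
  have e2 : ∀ i, ∫ y, ((y i : ℂ) * weightedAvg q π (fun ω => energy (h ω) y)
          (fun ω : Fin (n + 1) → Ω => F (fun k => ω k.castSucc) * b (ω x) i)
        - weightedAvg q π (fun ω => energy (h ω) y)
          (fun ω : Fin (n + 1) → Ω => F (fun k => ω k.castSucc) * b (ω x) i * h (ω x) i))
        ∂(stdGauss ι)
      = ∑ z : Fin (n + 2), if z = x.castSucc then 0 else replicaWeight q (n + 1) z *
        obsAvg q π h (fun ω : Fin (n + 2) → Ω =>
          F (fun k => ω k.castSucc.castSucc) * (b (ω x.castSucc) i * h (ω z) i)) := by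
    intro i
    rw [integral_sub (integrable_coord_mul_weightedAvg hq hh (hG i) i)
      (integrable_weightedAvg hq hh ((hG i).mul (hhx i))),
      integral_coord_mul_weightedAvg hq hh (hG i) i,
      ← Finset.add_sum_erase _ _ (Finset.mem_univ x.castSucc),
      ← Finset.add_sum_erase (Finset.univ : Finset (Fin (n + 2))) (fun z => if z = x.castSucc then
        (0 : ℂ) else _) (Finset.mem_univ x.castSucc)]
    -- The diagonal term does not see the last replica; dropping it identifies this term with the
    -- subtracted one.
    have : obsAvg q π h (fun ω : Fin (n + 1 + 1) → Ω =>
          F (fun k => ω k.castSucc.castSucc) * b (ω x.castSucc) i * h (ω x.castSucc) i)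
        = ∫ y, weightedAvg q π (fun ω => energy (h ω) y)
          (fun ω : Fin (n + 1) → Ω => F (fun k => ω k.castSucc) * b (ω x) i * h (ω x) i)
          ∂(stdGauss ι) :=
      obsAvg_comp q hh (Fin.castSucc_injective (n + 1)) ((hG i).mul (hhx i)).measurable
    rw [replicaWeight_castSucc, one_mul, this, if_pos rfl, zero_add, add_sub_cancel_left]
    refine Finset.sum_congr rfl fun z hz => ?_
    rw [if_neg (Finset.ne_of_mem_erase hz)]
    simp only [mul_assoc]
  simp_rw [e2]
  rw [Finset.sum_comm]
  refine Finset.sum_congr rfl fun z _ => ?_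
  split_ifs with hz
  · simp
  · simp_rw [Finset.mul_sum]
    rw [← Finset.mul_sum, ← obsAvg_sum hq hh _ fun i => hL i z]

/-- The derivative of a weighted Gibbs average along an affine path of signals. -/
theorem hasDerivAt_obsAvg {q : ℂ} (hq : q.re = 1) {a b : Ω → ι → ℝ}
    (ha : ∀ i, IsBddMeas fun ω => a ω i) (hb : ∀ i, IsBddMeas fun ω => b ω i)
    {n : ℕ} {F : (Fin n → Ω) → ℝ} (hF : IsBddMeas F) (τ : ℝ) :
    HasDerivAt (fun τ => obsAvg q π (pathField a b τ) F)
      (∑ x : Fin (n + 1), ∑ z : Fin (n + 2), if z = x.castSucc then 0 else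
        replicaWeight q n x * replicaWeight q (n + 1) z *
        obsAvg q π (pathField a b τ) (fun ω : Fin (n + 2) → Ω =>
          F (fun k => ω k.castSucc.castSucc) *
            ∑ i, b (ω x.castSucc) i * pathField a b τ (ω z) i)) τ := by
  have hh := isBddMeas_pathField ha hb
  obtain ⟨A, hA0, hA⟩ := exists_field_bound ha
  obtain ⟨B, hB0, hB⟩ := exists_field_bound hb
  obtain ⟨K, hK⟩ := hF.bounded
  -- Radius `2`, since the pointwise derivative is taken at every `t` within `1` of `τ` and itself
  -- needs bounds on the unit ball around `t`.
  set D : ℝ := A + (|τ| + 2) * B with hD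
  have hD0 : 0 ≤ D := by positivity
  have hpath : ∀ t ∈ Metric.ball τ 2, ∀ ω i, |pathField a b t ω i| ≤ D := by
    intro t ht ω i
    rw [Metric.mem_ball, Real.dist_eq] at ht
    have h1 := abs_add_le (t - τ) τ
    simp only [sub_add_cancel] at h1
    refine (abs_add_le _ _).trans (add_le_add (hA ω i) ?_)
    rw [abs_mul]
    exact mul_le_mul (by linarith) (hB ω i) (abs_nonneg _) (by positivity)
  set E : (ι → ℝ) → ℝ := fun y => D * ∑ i, |y i| + Fintype.card ι * (D ^ 2 / 2) with hE
  have hen : ∀ y, ∀ t ∈ Metric.ball τ 2, ∀ ω, |energy (pathField a b t ω) y| ≤ E y :=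
    fun y t ht ω => abs_energy_le (hpath t ht ω)
  set H' : (ι → ℝ) → ℝ → Ω → ℝ := fun y t ω => ∑ i, b ω i * (y i - pathField a b t ω i) with hH'
  have hH'b : ∀ y, ∀ t ∈ Metric.ball τ 2, ∀ ω, |H' y t ω| ≤ B * ∑ i, (|y i| + D) := by
    intro y t ht ω
    rw [Finset.mul_sum]
    refine (Finset.abs_sum_le_sum_abs _ _).trans (Finset.sum_le_sum fun i _ => ?_)
    rw [abs_mul]
    exact mul_le_mul (hB ω i) ((abs_sub _ _).trans (add_le_add_right (hpath t ht ω i) _))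
      (abs_nonneg _) hB0
  have hH'm : ∀ y t, Measurable (H' y t) := fun y t => by
    have h1 := fun i => (hb i).measurable
    have h2 := fun i => (hh t i).measurable
    fun_prop
  have hder : ∀ y t ω, HasDerivAt (fun t => energy (pathField a b t ω) y) (H' y t ω) t := by
    intro y t ω
    unfold energy
    refine HasDerivAt.fun_sum fun i _ => ?_
    have h1 : HasDerivAt (fun t => pathField a b t ω i) (b ω i) t := by
      simpa [pathField] using ((hasDerivAt_id t).mul_const (b ω i)).const_add (a ω i)
    refine ((h1.const_mul (y i)).sub ((h1.pow 2).div_const 2)).congr_deriv ?_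
    simp; ring
  have hsub : ∀ t ∈ Metric.ball τ (1 : ℝ), ∀ x ∈ Metric.ball t (1 : ℝ),
      x ∈ Metric.ball τ (2 : ℝ) := by
    intro t ht x hx
    rw [Metric.mem_ball] at *
    linarith [dist_triangle x t τ]
  have hsub1 : ∀ t ∈ Metric.ball τ (1 : ℝ), t ∈ Metric.ball τ (2 : ℝ) := fun t ht =>
    Metric.ball_subset_ball (by norm_num) ht
  have key : ∀ y, ∀ t ∈ Metric.ball τ (1 : ℝ),
      HasDerivAt (fun t => weightedAvg q π (fun ω => energy (pathField a b t ω) y) F)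
      (∑ x : Fin (n + 1), replicaWeight q n x *
        weightedAvg q π (fun ω => energy (pathField a b t ω) y)
          (fun ω : Fin (n + 1) → Ω => F (fun k => ω k.castSucc) * H' y t (ω x))) t := by
    intro y t ht
    exact hasDerivAt_weightedAvg (π := π) q hF.measurable hK
      (C := max (E y) (B * ∑ i, (|y i| + D)))
      (fun t => measurable_energy (hh t) _) (fun t => hH'm y t)
      (fun x hx ω => (hen y x (hsub t ht x hx) ω).trans (le_max_left _ _))
      (fun x hx ω => (hH'b y x (hsub t ht x hx) ω).trans (le_max_right _ _))
      (fun t => integrable_exp_energy (hh t) y) (fun t ω => hder y t ω)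
  have hbound : ∀ y, ∀ t ∈ Metric.ball τ (1 : ℝ), ∀ x : Fin (n + 1),
      ‖replicaWeight q n x * weightedAvg q π (fun ω => energy (pathField a b t ω) y)
          (fun ω : Fin (n + 1) → Ω => F (fun k => ω k.castSucc) * H' y t (ω x))‖
      ≤ ‖replicaWeight q n x‖ * (Real.exp (E y) * (|K| * (B * ∑ i, (|y i| + D)))) := by
    intro y t ht x
    rw [norm_mul]
    refine mul_le_mul_of_nonneg_left ?_ (norm_nonneg _)
    refine norm_weightedAvg_le_of_bound hq (measurable_energy (hh t) y)
      (hen y t (hsub1 t ht)) fun ω => ?_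
    rw [abs_mul]
    exact mul_le_mul ((hK _).trans (le_abs_self _)) (hH'b y t (hsub1 t ht) _) (abs_nonneg _)
      (abs_nonneg _)
  have hdom : ∀ x : Fin (n + 1), Integrable (fun y : ι → ℝ =>
      ‖replicaWeight q n x‖ * (Real.exp (E y) * (|K| * (B * ∑ i, (|y i| + D))))) (stdGauss ι) := by
    intro x
    refine Integrable.const_mul ?_ _
    refine integrable_of_norm_le_exp (by fun_prop)
      (A := Real.exp (Fintype.card ι * (D ^ 2 / 2)) * (|K| * (B * (1 + Fintype.card ι * D))))
      (K := D + 1) fun y => ?_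
    have hs : ∑ i, (|y i| + D) ≤ (1 + Fintype.card ι * D) * Real.exp (∑ i, |y i|) := by
      have hS : 0 ≤ ∑ i, |y i| := Finset.sum_nonneg fun _ _ => abs_nonneg _
      have h1 := Real.add_one_le_exp (∑ i, |y i|)
      have h2 := Real.one_le_exp hS
      rw [Finset.sum_add_distrib, Finset.sum_const, Finset.card_univ, nsmul_eq_mul]
      have h3 : 0 ≤ Fintype.card ι * D := by positivity
      nlinarith
    rw [Real.norm_eq_abs, abs_of_nonneg (by positivity), hE]
    calc _ ≤ Real.exp (D * ∑ i, |y i| + Fintype.card ι * (D ^ 2 / 2)) *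
          (|K| * (B * ((1 + Fintype.card ι * D) * Real.exp (∑ i, |y i|)))) := by gcongr
      _ = _ := by rw [Real.exp_add, add_mul D 1, one_mul, Real.exp_add (D * _)]; ring
  have hmeas : ∀ x : Fin (n + 1), Integrable (fun y => replicaWeight q n x *
      weightedAvg q π (fun ω => energy (pathField a b τ ω) y)
          (fun ω : Fin (n + 1) → Ω => F (fun k => ω k.castSucc) * H' y τ (ω x)))
      (stdGauss ι) := by
    intro x
    refine (hdom x).mono' (Measurable.aestronglyMeasurable (Measurable.const_mul ?_ _))
      (ae_of_all _ fun y => hbound y τ (Metric.mem_ball_self one_pos) x)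
    have hFc : IsBddMeas (fun ω : Fin (n + 1) → Ω => F (fun k => ω k.castSucc)) :=
      hF.comp (by fun_prop)
    -- `H'` depends on `y`, whereas measurability is known for averages of a fixed function.
    -- Expanding over coordinates pulls `y i` out of the average.
    have hex : ∀ y, weightedAvg q π (fun ω => energy (pathField a b τ ω) y)
          (fun ω : Fin (n + 1) → Ω => F (fun k => ω k.castSucc) * H' y τ (ω x))
        = ∑ i, ((y i : ℝ) * weightedAvg q π (fun ω => energy (pathField a b τ ω) y)
          (fun ω : Fin (n + 1) → Ω => F (fun k => ω k.castSucc) * b (ω x) i)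
          + weightedAvg q π (fun ω => energy (pathField a b τ ω) y)
          (fun ω : Fin (n + 1) → Ω => F (fun k => ω k.castSucc) *
            (b (ω x) i * (-1 * pathField a b τ (ω x) i)))) := by
      intro y
      have hi := integrable_exp_energy (π := π) (hh τ) y
      have hb1 : ∀ i, IsBddMeas (fun ω : Fin (n + 1) → Ω =>
          F (fun k => ω k.castSucc) * b (ω x) i) := fun i => hFc.mul ((hb i).comp (by fun_prop))
      have hb2 : ∀ i, IsBddMeas (fun ω : Fin (n + 1) → Ω => F (fun k => ω k.castSucc) *
            (b (ω x) i * (-1 * pathField a b τ (ω x) i))) := fun i =>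
        hFc.mul (((hb i).comp (by fun_prop)).mul ((IsBddMeas.const _).mul
          ((hh τ i).comp (by fun_prop))))
      simp_rw [← weightedAvg_const_mul]
      rw [Finset.sum_add_distrib, ← weightedAvg_sum q hi _ fun i => (IsBddMeas.const _).mul (hb1 i),
        ← weightedAvg_sum q hi _ hb2, weightedAvg, weightedAvg, weightedAvg, ← mul_add,
        ← Complex.ofReal_add]
      congr 2
      have hint1 := IsBddMeas.sum Finset.univ (fun i => (IsBddMeas.const (y i)).mul (hb1 i))
      have hint2 := IsBddMeas.sum Finset.univ hb2
      obtain ⟨_, hK1⟩ := hint1.bounded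
      obtain ⟨_, hK2⟩ := hint2.bounded
      rw [gibbsAvg, gibbsAvg, gibbsAvg, ← integral_add
        (integrable_gibbs_of_bounded hi hint1.measurable hK1)
        (integrable_gibbs_of_bounded hi hint2.measurable hK2)]
      congr 1; ext ω
      rw [← Finset.sum_add_distrib, hH', Finset.mul_sum]
      refine Finset.sum_congr rfl fun i _ => ?_
      ring
    simp_rw [hex]
    refine Finset.measurable_fun_sum _ fun i _ => ?_
    have h1 := measurable_weightedAvg (π := π) q (hh τ) (hFc.mul ((hb i).comp
      (measurable_pi_apply x)))
    have h2 := measurable_weightedAvg (π := π) q (hh τ) (hFc.mul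
      (((hb i).mul ((IsBddMeas.const (-1)).mul (hh τ i))).comp (measurable_pi_apply x)))
    fun_prop
  have main := (hasDerivAt_integral_of_dominated_loc_of_deriv_le (𝕜 := ℝ) (μ := stdGauss ι)
    (F := fun t y => weightedAvg q π (fun ω => energy (pathField a b t ω) y) F)
    (F' := fun t y => ∑ x : Fin (n + 1), replicaWeight q n x *
        weightedAvg q π (fun ω => energy (pathField a b t ω) y)
          (fun ω : Fin (n + 1) → Ω => F (fun k => ω k.castSucc) * H' y t (ω x)))
    (bound := fun y => ∑ x : Fin (n + 1),
      ‖replicaWeight q n x‖ * (Real.exp (E y) * (|K| * (B * ∑ i, (|y i| + D)))))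
    (x₀ := τ) (Metric.ball_mem_nhds τ one_pos)
    (Filter.Eventually.of_forall fun t =>
      (measurable_weightedAvg q (hh t) hF).aestronglyMeasurable)
    (integrable_weightedAvg hq (hh τ) hF)
    (integrable_finsetSum _ fun x _ => hmeas x).aestronglyMeasurable
    (ae_of_all _ fun y t ht => (norm_sum_le _ _).trans
      (Finset.sum_le_sum fun x _ => hbound y t ht x))
    (integrable_finsetSum _ fun x _ => hdom x)
    (ae_of_all _ fun y t ht => key y t ht)).2
  refine main.congr_deriv ?_
  rw [integral_finsetSum _ fun x _ => hmeas x]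
  refine Finset.sum_congr rfl fun x _ => ?_
  rw [integral_const_mul, hH', sum_integral_eq_sum_obsAvg hq (hh τ) hb hF x, Finset.mul_sum]
  refine Finset.sum_congr rfl fun z _ => ?_
  split_ifs <;> simp [mul_assoc]

end PathDerivative

/-! ### The planted average and its second-moment bound. -/

section PlantedAverage

variable {Ω : Type*} [MeasurableSpace Ω] {ι : Type*} [Fintype ι]

/-- The Gibbs average of `F` integrated against the law of the observation of a planted signal. -/
noncomputable def plantedAvg (π : Measure Ω) (h : Ω → ι → ℝ) {n : ℕ} (F : (Fin n → Ω) → ℝ) : ℝ :=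
  ∫ y, partFn π (fun ω => energy (h ω) y) * gibbsAvg π (fun ω => energy (h ω) y) F ∂(stdGauss ι)

variable {π : Measure Ω} [IsProbabilityMeasure π]

theorem weightedAvg_one {h : Ω → ι → ℝ} (hh : ∀ i, IsBddMeas fun ω => h ω i) {n : ℕ}
    (F : (Fin n → Ω) → ℝ) (y : ι → ℝ) :
    weightedAvg 1 π (fun ω => energy (h ω) y) F
      = ((partFn π (fun ω => energy (h ω) y) * gibbsAvg π (fun ω => energy (h ω) y) F : ℝ) : ℂ) := by
  rw [weightedAvg, one_mul, ← Complex.ofReal_exp,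
    Real.exp_log (partFn_pos (integrable_exp_energy hh y)), Complex.ofReal_mul]

theorem obsAvg_one {h : Ω → ι → ℝ} (hh : ∀ i, IsBddMeas fun ω => h ω i) {n : ℕ}
    (F : (Fin n → Ω) → ℝ) : obsAvg 1 π h F = plantedAvg π h F := by
  simp only [obsAvg, plantedAvg, weightedAvg_one hh]
  exact integral_ofReal

theorem integrable_partFn_mul_gibbsAvg {h : Ω → ι → ℝ} (hh : ∀ i, IsBddMeas fun ω => h ω i)
    {n : ℕ} {F : (Fin n → Ω) → ℝ} (hF : IsBddMeas F) :
    Integrable (fun y => partFn π (fun ω => energy (h ω) y) *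
      gibbsAvg π (fun ω => energy (h ω) y) F) (stdGauss ι) := by
  have := integrable_weightedAvg (π := π) (q := 1) rfl hh hF
  simp_rw [weightedAvg_one hh] at this
  exact this.re

theorem norm_obsAvg_le {q : ℂ} (hq : q.re = 1) {h : Ω → ι → ℝ}
    (hh : ∀ i, IsBddMeas fun ω => h ω i) {n : ℕ} {F : (Fin n → Ω) → ℝ} (hF : IsBddMeas F) :
    ‖obsAvg q π h F‖ ≤ plantedAvg π h fun ω => |F ω| :=
  norm_integral_le_of_norm_le (integrable_partFn_mul_gibbsAvg hh hF.abs)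
    (ae_of_all _ fun y => norm_weightedAvg_le hq (integrable_exp_energy hh y) F)

theorem plantedAvg_mono {h : Ω → ι → ℝ} (hh : ∀ i, IsBddMeas fun ω => h ω i) {n : ℕ}
    {F G : (Fin n → Ω) → ℝ} (hF : IsBddMeas F) (hG : IsBddMeas G) (hFG : ∀ ω, F ω ≤ G ω) :
    plantedAvg π h F ≤ plantedAvg π h G := by
  refine integral_mono (integrable_partFn_mul_gibbsAvg hh hF)
    (integrable_partFn_mul_gibbsAvg hh hG) fun y => ?_
  have hi := integrable_exp_energy (π := π) hh y
  refine mul_le_mul_of_nonneg_left ?_ (partFn_pos hi).le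
  obtain ⟨_, hK⟩ := hF.bounded
  obtain ⟨_, hL⟩ := hG.bounded
  exact integral_mono (integrable_gibbs_of_bounded hi hF.measurable hK)
    (integrable_gibbs_of_bounded hi hG.measurable hL) hFG

theorem plantedAvg_add {h : Ω → ι → ℝ} (hh : ∀ i, IsBddMeas fun ω => h ω i) {n : ℕ}
    {F G : (Fin n → Ω) → ℝ} (hF : IsBddMeas F) (hG : IsBddMeas G) :
    plantedAvg π h (fun ω => F ω + G ω) = plantedAvg π h F + plantedAvg π h G := by
  have := obsAvg_add (π := π) (q := 1) rfl hh hF hG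
  simp only [obsAvg_one hh] at this
  exact_mod_cast this

theorem plantedAvg_const_mul {h : Ω → ι → ℝ} (hh : ∀ i, IsBddMeas fun ω => h ω i) {n : ℕ}
    (c : ℝ) (F : (Fin n → Ω) → ℝ) :
    plantedAvg π h (fun ω => c * F ω) = c * plantedAvg π h F := by
  have := obsAvg_const_mul (π := π) 1 h c F
  simp only [obsAvg_one hh] at this
  exact_mod_cast this

theorem plantedAvg_comp {h : Ω → ι → ℝ} (hh : ∀ i, IsBddMeas fun ω => h ω i)
    {n m : ℕ} {e : Fin m → Fin n} (he : Function.Injective e) {F : (Fin m → Ω) → ℝ}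
    (hF : Measurable F) :
    plantedAvg π h (fun ω : Fin n → Ω => F fun k => ω (e k)) = plantedAvg π h F := by
  have := obsAvg_comp (π := π) 1 hh he hF
  simp only [obsAvg_one hh] at this
  exact_mod_cast this

/-- Completing the square: the self terms cancel against the quadratic parts of the energies and
only the inner product of the two signals remains. -/
theorem integral_exp_energy_add (x x' : ι → ℝ) :
    ∫ y, Real.exp (energy x y + energy x' y) ∂(stdGauss ι) = Real.exp (∑ i, x i * x' i) := by
  have : ∀ y : ι → ℝ, Real.exp (energy x y + energy x' y)
      = Real.exp (∑ i, y i * (x i + x' i)) * Real.exp (- ∑ i, (x i ^ 2 + x' i ^ 2) / 2) := by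
    intro y
    rw [← Real.exp_add, energy, energy, ← Finset.sum_add_distrib, ← sub_eq_add_neg,
      ← Finset.sum_sub_distrib]
    congr 1
    exact Finset.sum_congr rfl fun i _ => by ring
  simp_rw [this]
  rw [integral_mul_const, integral_exp_sum_mul fun i => x i + x' i, ← Real.exp_add,
    ← sub_eq_add_neg, ← Finset.sum_sub_distrib]
  congr 1
  exact Finset.sum_congr rfl fun i _ => by ring

theorem integral_exp_energy (x : ι → ℝ) :
    ∫ y, Real.exp (energy x y) ∂(stdGauss ι) = 1 := by
  have := integral_exp_energy_add x 0
  simpa [energy] using this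

theorem integrable_prod_of_le_exp {Θ : Type*} [MeasurableSpace Θ] {ν : Measure Θ}
    [IsProbabilityMeasure ν] {f : (ι → ℝ) × Θ → ℝ} (hf : Measurable f) {A K : ℝ}
    (hb : ∀ p, |f p| ≤ A * Real.exp (K * ∑ i, |p.1 i|)) :
    Integrable f ((stdGauss ι).prod ν) := by
  refine (((integrable_exp_sum_abs K).const_mul A).comp_fst ν).mono' hf.aestronglyMeasurable
    (ae_of_all _ hb)

theorem integral_partFn {h : Ω → ι → ℝ} (hh : ∀ i, IsBddMeas fun ω => h ω i) :
    ∫ y, partFn π (fun ω => energy (h ω) y) ∂(stdGauss ι) = 1 := by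
  obtain ⟨C, hC0, hC⟩ := exists_field_bound hh
  have hm := measurable_energy_uncurry hh
  unfold partFn
  rw [integral_integral_swap]
  · simp [integral_exp_energy]
  · refine integrable_prod_of_le_exp (A := Real.exp (Fintype.card ι * (C ^ 2 / 2))) (K := C)
      (by simp only [Function.uncurry_def]; fun_prop) fun p => ?_
    simp only [Function.uncurry]
    rw [abs_of_pos (Real.exp_pos _), ← Real.exp_add, add_comm]
    exact Real.exp_le_exp.2 ((le_abs_self _).trans (abs_energy_le (hC _)))

theorem plantedAvg_const {h : Ω → ι → ℝ} (hh : ∀ i, IsBddMeas fun ω => h ω i) {n : ℕ} (c : ℝ) :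
    plantedAvg π h (fun _ : Fin n → Ω => c) = c := by
  have : ∀ y, gibbsAvg π (fun ω => energy (h ω) y) (fun _ : Fin n → Ω => c) = c := fun y => by
    have := isProbabilityMeasure_pi_tilted (κ := Fin n) (integrable_exp_energy (π := π) hh y)
    simp [gibbsAvg]
  simp only [plantedAvg, this, integral_mul_const, integral_partFn hh, one_mul]

/-- Overlap functions under the planted measure are controlled by a second-moment computation. -/
theorem plantedAvg_le_second_moment {h : Ω → ι → ℝ} (hh : ∀ i, IsBddMeas fun ω => h ω i)
    {F : (Fin 2 → Ω) → ℝ} (hF : IsBddMeas F) :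
    plantedAvg π h F ≤ (1 + ∫ ω, F ω ^ 2 * Real.exp (∑ i, h (ω 0) i * h (ω 1) i)
      ∂(Measure.pi fun _ : Fin 2 => π)) / 2 := by
  obtain ⟨C, hC0, hC⟩ := exists_field_bound hh
  obtain ⟨K, hK⟩ := hF.bounded
  have hm := fun i => (hh i).measurable
  have hFm := hF.measurable
  have hint : Integrable (fun p : (ι → ℝ) × (Fin 2 → Ω) =>
      F p.2 ^ 2 * Real.exp (energy (h (p.2 0)) p.1 + energy (h (p.2 1)) p.1))
      ((stdGauss ι).prod (Measure.pi fun _ : Fin 2 => π)) := by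
    refine integrable_prod_of_le_exp
      (A := K ^ 2 * Real.exp (2 * (Fintype.card ι * (C ^ 2 / 2)))) (K := 2 * C)
      (by unfold energy; fun_prop) fun p => ?_
    rw [abs_mul, abs_of_pos (Real.exp_pos _), mul_assoc, ← Real.exp_add, abs_pow]
    have h1 := fun k => (le_abs_self _).trans (abs_energy_le (y := p.1) (hC (p.2 k)))
    have h2 : energy (h (p.2 0)) p.1 + energy (h (p.2 1)) p.1
        ≤ 2 * (Fintype.card ι * (C ^ 2 / 2)) + 2 * C * ∑ i, |p.1 i| := by
      linarith [h1 0, h1 1]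
    have h3 := hK p.2
    gcongr
  -- Pointwise in `y`, `2 Z F ≤ 1 + Z² F²`. The factor `Z²` cancels the normalisation of two
  -- replicas, leaving an integral against the prior whose noise average is explicit.
  have hpt : ∀ y, partFn π (fun ω => energy (h ω) y) * gibbsAvg π (fun ω => energy (h ω) y) F
      ≤ (1 + ∫ ω, F ω ^ 2 * Real.exp (energy (h (ω 0)) y + energy (h (ω 1)) y)
        ∂(Measure.pi fun _ : Fin 2 => π)) / 2 := by
    intro y
    have hi := integrable_exp_energy (π := π) hh y
    have hZ := partFn_pos hi
    have := isProbabilityMeasure_pi_tilted (κ := Fin 2) hi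
    have e : ∫ ω, F ω ^ 2 * Real.exp (energy (h (ω 0)) y + energy (h (ω 1)) y)
        ∂(Measure.pi fun _ : Fin 2 => π) = partFn π (fun ω => energy (h ω) y) ^ 2 *
          gibbsAvg π (fun ω => energy (h ω) y) (fun ω => F ω ^ 2) := by
      rw [gibbsAvg_eq_div _ hi, mul_div_cancel₀ _ (pow_ne_zero 2 hZ.ne')]
      simp [Fin.sum_univ_two]
    rw [e]
    set Z := partFn π (fun ω => energy (h ω) y)
    have h1 : gibbsAvg π (fun ω => energy (h ω) y) F
        ≤ ∫ ω, (Z * F ω ^ 2 / 2 + 1 / (2 * Z)) ∂(Measure.pi fun _ : Fin 2 =>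
          π.tilted (fun ω => energy (h ω) y)) := by
      have hb := ((IsBddMeas.const (Z / 2)).mul (hF.pow 2)).add (IsBddMeas.const (1 / (2 * Z)))
      obtain ⟨L, hL⟩ := hb.bounded
      refine integral_mono (integrable_gibbs_of_bounded hi hF.measurable hK)
        ((integrable_gibbs_of_bounded hi hb.measurable hL).congr
          (ae_of_all _ fun ω => by simp only; ring)) fun ω => ?_
      have : Z * F ω ^ 2 / 2 + 1 / (2 * Z) - F ω = (Z * F ω - 1) ^ 2 / (2 * Z) := by
        field_simp; ring
      have h0 : 0 ≤ (Z * F ω - 1) ^ 2 / (2 * Z) := by positivity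
      simp only; linarith
    have h2 : ∫ ω, (Z * F ω ^ 2 / 2 + 1 / (2 * Z)) ∂(Measure.pi fun _ : Fin 2 =>
          π.tilted (fun ω => energy (h ω) y))
        = Z * gibbsAvg π (fun ω => energy (h ω) y) (fun ω => F ω ^ 2) / 2 + 1 / (2 * Z) := by
      obtain ⟨L, hL⟩ := (hF.pow 2).bounded
      rw [integral_add (((integrable_gibbs_of_bounded hi (hF.pow 2).measurable hL).const_mul
        _).div_const _) (integrable_const _), integral_div, integral_const_mul]
      simp [gibbsAvg]
    calc _ ≤ Z * (Z * gibbsAvg π (fun ω => energy (h ω) y) (fun ω => F ω ^ 2) / 2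
          + 1 / (2 * Z)) := mul_le_mul_of_nonneg_left (h1.trans_eq h2) hZ.le
      _ = _ := by field_simp; ring
  refine (integral_mono (integrable_partFn_mul_gibbsAvg hh hF)
    (((integrable_const 1).add hint.integral_prod_left).div_const 2) hpt).trans (le_of_eq ?_)
  simp only [Pi.add_apply]
  rw [integral_div, integral_add (integrable_const _) hint.integral_prod_left,
    integral_integral_swap hint]
  simp_rw [integral_const_mul, integral_exp_energy_add]
  simp

/-- If averaging over a resampling of one replica annihilates `F`, and the resampling does not
change the Hamiltonian, then the Gibbs average of `F` vanishes. -/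
theorem gibbsAvg_eq_zero_of_resample {X : Type*} [MeasurableSpace X] {P : Measure X}
    [IsProbabilityMeasure P] {ρ : Ω × X → Ω} (hρ : MeasurePreserving ρ (π.prod P) π)
    {H : Ω → ℝ} (hH : Measurable H) (hi : Integrable (fun ω => Real.exp (H ω)) π)
    (hHρ : ∀ ω x, H (ρ (ω, x)) = H ω) {n : ℕ} (c : Fin n) {F : (Fin n → Ω) → ℝ}
    (hF : IsBddMeas F) (h0 : ∀ ω, ∫ x, F (Function.update ω c (ρ (ω c, x))) ∂P = 0) :
    gibbsAvg π H F = 0 := by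
  have := isProbabilityMeasure_tilted hi
  have mp := measurePreserving_update_pi (fun _ : Fin n => π.tilted H) c
  obtain ⟨K, hK⟩ := hF.bounded
  have hFm := hF.measurable
  -- Redraw replica `c` from the Gibbs measure, seen as a density against `π`, then apply `ρ` to it.
  -- The density depends on `H` only, so it is unchanged and factors out of the integral that `h0`
  -- annihilates.
  rw [gibbsAvg, ← mp.map_eq, integral_map mp.measurable.aemeasurable hFm.aestronglyMeasurable,
    integral_prod]
  · refine integral_eq_zero_of_ae (ae_of_all _ fun ω => ?_)
    simp only [Pi.zero_apply]
    rw [integral_tilted]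
    have hρm := hρ.measurable
    have hfm : Measurable fun η => (Real.exp (H η) / ∫ η, Real.exp (H η) ∂π) •
        F (Function.update ω c η) := by fun_prop
    rw [← hρ.map_eq, integral_map hρm.aemeasurable (by rw [hρ.map_eq] ; exact hfm.aestronglyMeasurable),
      hρ.map_eq, integral_prod]
    · simp_rw [hHρ, smul_eq_mul, integral_const_mul]
      refine integral_eq_zero_of_ae (ae_of_all _ fun η => ?_)
      have := h0 (Function.update ω c η)
      simp only [Function.update_self, Function.update_idem] at this
      simp [this]
    · have h1 : Integrable (fun η => (Real.exp (H η) / ∫ η, Real.exp (H η) ∂π) •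
        F (Function.update ω c η)) π := by
        simp only [smul_eq_mul]
        refine (hi.div_const _).mul_bdd (c := K)
          (by fun_prop : Measurable _).aestronglyMeasurable (ae_of_all _ fun η => hK _)
      exact hρ.integrable_comp_of_integrable h1
  · exact Integrable.of_bound (hFm.comp mp.measurable).aestronglyMeasurable K
      (ae_of_all _ fun _ => hK _)

theorem obsAvg_eq_zero_of_resample (q : ℂ) {X : Type*} [MeasurableSpace X] {P : Measure X}
    [IsProbabilityMeasure P] {ρ : Ω × X → Ω} (hρ : MeasurePreserving ρ (π.prod P) π)
    {h : Ω → ι → ℝ} (hh : ∀ i, IsBddMeas fun ω => h ω i)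
    (hhρ : ∀ ω x i, h (ρ (ω, x)) i = h ω i) {n : ℕ} (c : Fin n) {F : (Fin n → Ω) → ℝ}
    (hF : IsBddMeas F) (h0 : ∀ ω, ∫ x, F (Function.update ω c (ρ (ω c, x))) ∂P = 0) :
    obsAvg q π h F = 0 := by
  refine integral_eq_zero_of_ae (ae_of_all _ fun y => ?_)
  change weightedAvg q π (fun ω => energy (h ω) y) F = 0
  rw [weightedAvg, gibbsAvg_eq_zero_of_resample hρ (measurable_energy hh y)
    (integrable_exp_energy hh y) (fun ω x => by simp [energy, hhρ]) c hF h0]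
  simp

end PlantedAverage

/-! ### Cavity coordinates and elementary moment inequalities. -/

section Cavity

variable {Ω : Type*} [MeasurableSpace Ω] {ι : Type*}

/-- The coordinate `g` is resampled by `ρ` according to the law of `γ` under `P`, while the signals
`a` and `r`, which live on disjoint sets of entries, do not depend on it. -/
structure IsCavity {X : Type*} [MeasurableSpace X] (π : Measure Ω) (P : Measure X)
    (ρ : Ω × X → Ω) (a r : Ω → ι → ℝ) (g : Ω → ℝ) (γ : X → ℝ) (L : ℝ) : Prop where
  mp : MeasurePreserving ρ (π.prod P) π
  fixed_inv : ∀ ω x i, a (ρ (ω, x)) i = a ω i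
  signal_inv : ∀ ω x i, r (ρ (ω, x)) i = r ω i
  fixed_bdd : ∀ i, IsBddMeas fun ω => a ω i
  signal_bdd : ∀ i, IsBddMeas fun ω => r ω i
  coord_meas : Measurable g
  coord_le : ∀ ω, |g ω| ≤ L
  coord_resample : ∀ ω x, g (ρ (ω, x)) = γ x
  law_bdd : IsBddMeas γ
  law_mean : ∫ x, γ x ∂P = 0
  law_second : ∫ x, γ x ^ 2 ∂P = 1
  disjoint : ∀ i, (∀ ω, a ω i = 0) ∨ (∀ ω, r ω i = 0)

/-- The path switching on the signal `√lam g r` on top of `a`. -/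
noncomputable def cavityPath (lam : ℝ) (a r : Ω → ι → ℝ) (g : Ω → ℝ) (τ : ℝ) : Ω → ι → ℝ :=
  pathField a (fun ω i => Real.sqrt lam * (g ω * r ω i)) τ

/-- The overlap of two signals. -/
def overlap [Fintype ι] (r : Ω → ι → ℝ) (ω ω' : Ω) : ℝ := ∑ i, r ω i * r ω' i

/-- The total mass of the replica weights in the second-order differentiation formula. -/
noncomputable def weightSum (q : ℂ) (n : ℕ) : ℝ :=
  ∑ x : Fin (n + 1), ∑ z : Fin (n + 2), ‖replicaWeight q n x‖ * ‖replicaWeight q (n + 1) z‖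

theorem weightSum_nonneg (q : ℂ) (n : ℕ) : 0 ≤ weightSum q n :=
  Finset.sum_nonneg fun _ _ => Finset.sum_nonneg fun _ _ => by positivity

theorem norm_weighted_sum_le (q : ℂ) {n : ℕ} {T : Fin (n + 1) → Fin (n + 2) → ℂ} {D : ℝ}
    (hD : 0 ≤ D) (hT : ∀ x z, z ≠ x.castSucc → ‖T x z‖ ≤ D) :
    ‖∑ x : Fin (n + 1), ∑ z : Fin (n + 2), if z = x.castSucc then 0 else
        replicaWeight q n x * replicaWeight q (n + 1) z * T x z‖ ≤ weightSum q n * D := by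
  rw [weightSum, Finset.sum_mul]
  refine (norm_sum_le _ _).trans (Finset.sum_le_sum fun x _ => ?_)
  rw [Finset.sum_mul]
  refine (norm_sum_le _ _).trans (Finset.sum_le_sum fun z _ => ?_)
  split_ifs with h
  · simp only [norm_zero]; positivity
  · rw [norm_mul, norm_mul]
    exact mul_le_mul_of_nonneg_left (hT x z h) (by positivity)

theorem mul_mul_le_cubes {x y z : ℝ} (hx : 0 ≤ x) (hy : 0 ≤ y) (hz : 0 ≤ z) :
    x * y * z ≤ (x ^ 3 + y ^ 3 + z ^ 3) / 3 := by
  nlinarith [mul_nonneg (add_nonneg (add_nonneg hx hy) hz)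
    (add_nonneg (add_nonneg (sq_nonneg (x - y)) (sq_nonneg (y - z))) (sq_nonneg (z - x)))]

theorem IsCavity.coord_bdd {X : Type*} [MeasurableSpace X] {π : Measure Ω} {P : Measure X}
    {ρ : Ω × X → Ω} {a r : Ω → ι → ℝ} {g : Ω → ℝ} {γ : X → ℝ} {L : ℝ}
    (hc : IsCavity π P ρ a r g γ L) : IsBddMeas g := ⟨hc.coord_meas, L, hc.coord_le⟩

theorem isBddMeas_overlap [Fintype ι] {r : Ω → ι → ℝ} (hr : ∀ i, IsBddMeas fun ω => r ω i) :
    IsBddMeas fun p : Ω × Ω => overlap r p.1 p.2 :=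
  IsBddMeas.sum _ fun i => ((hr i).comp measurable_fst).mul ((hr i).comp measurable_snd)

theorem isBddMeas_pair {f : Ω → Ω → ℝ} (hf : IsBddMeas fun p : Ω × Ω => f p.1 p.2) {n : ℕ}
    (x z : Fin n) : IsBddMeas fun ω : Fin n → Ω => f (ω x) (ω z) :=
  hf.comp (by fun_prop : Measurable fun ω : Fin n → Ω => (ω x, ω z))

variable [Fintype ι] {π : Measure Ω} [IsProbabilityMeasure π]

theorem plantedAvg_pair {h : Ω → ι → ℝ} (hh : ∀ i, IsBddMeas fun ω => h ω i) {n : ℕ}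
    {x z : Fin n} (hxz : x ≠ z) {f : Ω → Ω → ℝ} (hf : Measurable fun p : Ω × Ω => f p.1 p.2) :
    plantedAvg π h (fun ω : Fin n → Ω => f (ω x) (ω z))
      = plantedAvg π h (fun ω : Fin 2 → Ω => f (ω 0) (ω 1)) := by
  have he : Function.Injective ![x, z] := by
    intro j k
    fin_cases j <;> fin_cases k <;> simp [hxz, hxz.symm]
  have := plantedAvg_comp (π := π) hh he (F := fun ω : Fin 2 → Ω => f (ω 0) (ω 1))
    (hf.comp (by fun_prop : Measurable fun ω : Fin 2 → Ω => (ω 0, ω 1)))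
  simpa using this

/-- The arithmetic–geometric mean inequality, in place of Hölder, reduces products of three overlaps
to third absolute moments. -/
theorem plantedAvg_mul_mul_le {h : Ω → ι → ℝ} (hh : ∀ i, IsBddMeas fun ω => h ω i) {n : ℕ}
    {f₁ f₂ f₃ : (Fin n → Ω) → ℝ} (h₁ : IsBddMeas f₁) (h₂ : IsBddMeas f₂) (h₃ : IsBddMeas f₃)
    {D : ℝ} (b₁ : plantedAvg π h (fun ω => |f₁ ω| ^ 3) ≤ D)
    (b₂ : plantedAvg π h (fun ω => |f₂ ω| ^ 3) ≤ D)
    (b₃ : plantedAvg π h (fun ω => |f₃ ω| ^ 3) ≤ D) :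
    plantedAvg π h (fun ω => |f₁ ω| * |f₂ ω| * |f₃ ω|) ≤ D := by
  have c₁ := h₁.abs.pow 3
  have c₂ := h₂.abs.pow 3
  have c₃ := h₃.abs.pow 3
  have := plantedAvg_mono (π := π) hh ((h₁.abs.mul h₂.abs).mul h₃.abs)
    ((IsBddMeas.const (1 / 3)).mul ((c₁.add c₂).add c₃)) fun ω => by
      have := mul_mul_le_cubes (abs_nonneg (f₁ ω)) (abs_nonneg (f₂ ω)) (abs_nonneg (f₃ ω))
      linarith
  rw [plantedAvg_const_mul hh, plantedAvg_add hh (c₁.add c₂) c₃, plantedAvg_add hh c₁ c₂] at this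
  linarith

theorem plantedAvg_abs_le {h : Ω → ι → ℝ} (hh : ∀ i, IsBddMeas fun ω => h ω i) {n : ℕ}
    {f : (Fin n → Ω) → ℝ} (hf : IsBddMeas f) {c κ : ℝ} (hκ : 0 < κ)
    (b : plantedAvg π h (fun ω => |f ω| ^ 3) ≤ c * κ ^ 3) :
    plantedAvg π h (fun ω => |f ω|) ≤ (1 + c) * κ := by
  have := plantedAvg_mono (π := π) hh hf.abs
    ((IsBddMeas.const κ).add ((IsBddMeas.const (1 / κ ^ 2)).mul (hf.abs.pow 3))) fun ω => by
      have h0 : 0 ≤ (|f ω| / κ) := by positivity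
      -- `x ≤ 1 + x³` at the scale `κ`, the expected size of `f`, trades the third moment for a
      -- first moment of order `κ`.
      have h1 : |f ω| / κ ≤ 1 + (|f ω| / κ) ^ 3 := by nlinarith [sq_nonneg (|f ω| / κ - 1)]
      have h2 := mul_le_mul_of_nonneg_left h1 hκ.le
      calc |f ω| = κ * (|f ω| / κ) := by field_simp
        _ ≤ _ := h2
        _ = κ + 1 / κ ^ 2 * |f ω| ^ 3 := by field_simp
  rw [plantedAvg_add hh (IsBddMeas.const κ) ((IsBddMeas.const _).mul (hf.abs.pow 3)),
    plantedAvg_const_mul hh, plantedAvg_const hh] at this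
  have h3 : 1 / κ ^ 2 * plantedAvg π h (fun ω => |f ω| ^ 3) ≤ 1 / κ ^ 2 * (c * κ ^ 3) := by gcongr
  calc _ ≤ _ := this
    _ ≤ κ + 1 / κ ^ 2 * (c * κ ^ 3) := by linarith
    _ = _ := by field_simp

end Cavity

/-! ### Estimates along a cavity path. -/

section CavityEstimates

variable {Ω : Type*} [MeasurableSpace Ω] {ι : Type*} {X : Type*} [MeasurableSpace X]
  {π : Measure Ω} {P : Measure X} {ρ : Ω × X → Ω} {a r : Ω → ι → ℝ} {g : Ω → ℝ} {γ : X → ℝ} {L : ℝ}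

theorem IsCavity.path_bdd (hc : IsCavity π P ρ a r g γ L) (lam τ : ℝ) (i : ι) :
    IsBddMeas fun ω => cavityPath lam a r g τ ω i :=
  isBddMeas_pathField hc.fixed_bdd
    (fun i => (IsBddMeas.const _).mul (hc.coord_bdd.mul (hc.signal_bdd i))) τ i

theorem IsCavity.abs_coord_mul_le (hc : IsCavity π P ρ a r g γ L) (ω ω' : Ω) :
    |g ω * g ω'| ≤ L ^ 2 := by
  rw [abs_mul, pow_two]
  exact mul_le_mul (hc.coord_le _) (hc.coord_le _) (abs_nonneg _)
    ((abs_nonneg _).trans (hc.coord_le ω))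

theorem IsCavity.pair_bdd (hc : IsCavity π P ρ a r g γ L) {n : ℕ} (x z : Fin n) :
    IsBddMeas fun ω : Fin n → Ω => g (ω x) * g (ω z) :=
  (hc.coord_bdd.comp (measurable_pi_apply x)).mul (hc.coord_bdd.comp (measurable_pi_apply z))

theorem IsCavity.law_centered_second [IsProbabilityMeasure P] (hc : IsCavity π P ρ a r g γ L) :
    ∫ x, (γ x ^ 2 - 1) ∂P = 0 := by
  have hb := hc.law_bdd.pow 2
  obtain ⟨K, hK⟩ := hb.bounded
  rw [integral_sub (Integrable.of_bound hb.measurable.aestronglyMeasurable K (ae_of_all _ hK))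
    (integrable_const _), hc.law_second]
  simp

theorem IsCavity.overlap_update [Fintype ι] (hc : IsCavity π P ρ a r g γ L) {n : ℕ} (ω : Fin n → Ω)
    (c x z : Fin n) (t : X) :
    overlap r (Function.update ω c (ρ (ω c, t)) x) (Function.update ω c (ρ (ω c, t)) z)
      = overlap r (ω x) (ω z) := by
  have : ∀ k i, r (Function.update ω c (ρ (ω c, t)) k) i = r (ω k) i := fun k i => by
    by_cases hk : k = c
    · subst hk; simp [hc.signal_inv]
    · simp [hk]
  simp [overlap, this]

/-- The cross term between `a` and `r` vanishes since they live on disjoint entries; only the part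
switched on by `τ` contributes, through the overlap. -/
theorem IsCavity.sum_path [Fintype ι] (hc : IsCavity π P ρ a r g γ L) {lam : ℝ} (hl : 0 ≤ lam) (τ : ℝ)
    (ω ω' : Ω) :
    ∑ i, Real.sqrt lam * (g ω * r ω i) * cavityPath lam a r g τ ω' i
      = τ * lam * (g ω * g ω' * overlap r ω ω') := by
  rw [overlap, Finset.mul_sum, Finset.mul_sum]
  refine Finset.sum_congr rfl fun i _ => ?_
  simp only [cavityPath, pathField]
  have hs := Real.mul_self_sqrt hl
  rcases hc.disjoint i with h | h
  · rw [h]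
    linear_combination (g ω * r ω i * τ * g ω' * r ω' i) * hs
  · rw [h, h]; ring

variable [Fintype ι] [IsProbabilityMeasure π]

/-- Each derivative brings out `λ` times an overlap, a gain of order `N^{-1/2}` when `λ` is of order
`1/N` and overlaps are of order `√N`. This is the small parameter of the cavity expansion. -/
theorem IsCavity.hasDerivAt (hc : IsCavity π P ρ a r g γ L) {q : ℂ} (hq : q.re = 1) {lam : ℝ}
    (hl : 0 ≤ lam) {n : ℕ} {F : (Fin n → Ω) → ℝ} (hF : IsBddMeas F) (τ : ℝ) :
    HasDerivAt (fun τ => obsAvg q π (cavityPath lam a r g τ) F)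
      (((τ * lam : ℝ) : ℂ) * ∑ x : Fin (n + 1), ∑ z : Fin (n + 2), if z = x.castSucc then 0 else
        replicaWeight q n x * replicaWeight q (n + 1) z *
        obsAvg q π (cavityPath lam a r g τ) (fun ω : Fin (n + 2) → Ω =>
          F (fun k => ω k.castSucc.castSucc) *
            (g (ω x.castSucc) * g (ω z) * overlap r (ω x.castSucc) (ω z)))) τ := by
  have := hasDerivAt_obsAvg (π := π) hq hc.fixed_bdd
    (b := fun ω i => Real.sqrt lam * (g ω * r ω i))
    (fun i => (IsBddMeas.const _).mul (hc.coord_bdd.mul (hc.signal_bdd i))) hF τ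
  refine this.congr_deriv ?_
  rw [Finset.mul_sum]
  refine Finset.sum_congr rfl fun x _ => ?_
  rw [Finset.mul_sum]
  refine Finset.sum_congr rfl fun z _ => ?_
  split_ifs with hz
  · simp
  · have e : ∀ ω : Fin (n + 2) → Ω, F (fun k => ω k.castSucc.castSucc) *
        ∑ i, Real.sqrt lam * (g (ω x.castSucc) * r (ω x.castSucc) i) *
          pathField a (fun ω i => Real.sqrt lam * (g ω * r ω i)) τ (ω z) i
        = (τ * lam) * (F (fun k => ω k.castSucc.castSucc) *
            (g (ω x.castSucc) * g (ω z) * overlap r (ω x.castSucc) (ω z))) := by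
      intro ω
      have := hc.sum_path hl τ (ω x.castSucc) (ω z)
      rw [cavityPath] at this
      rw [this]; ring
    simp_rw [e]
    rw [obsAvg_const_mul, cavityPath]
    push_cast; ring

theorem IsCavity.norm_deriv_term_le (hc : IsCavity π P ρ a r g γ L) {q : ℂ} (hq : q.re = 1)
    {lam τ : ℝ} {n : ℕ} {F : (Fin n → Ω) → ℝ} (hF : IsBddMeas F) {D : ℝ}
    (x : Fin (n + 1)) (z : Fin (n + 2))
    (hD : plantedAvg π (cavityPath lam a r g τ) (fun ω : Fin (n + 2) → Ω =>
        |F (fun k => ω k.castSucc.castSucc)| * |overlap r (ω x.castSucc) (ω z)|) ≤ D) :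
    ‖obsAvg q π (cavityPath lam a r g τ) (fun ω : Fin (n + 2) → Ω =>
          F (fun k => ω k.castSucc.castSucc) *
            (g (ω x.castSucc) * g (ω z) * overlap r (ω x.castSucc) (ω z)))‖ ≤ L ^ 2 * D := by
  have hh := hc.path_bdd lam τ
  have hFc : IsBddMeas (fun ω : Fin (n + 2) → Ω => F (fun k => ω k.castSucc.castSucc)) :=
    hF.comp (by fun_prop)
  have hR := isBddMeas_pair (isBddMeas_overlap hc.signal_bdd) x.castSucc z
  have hall := hFc.mul ((hc.pair_bdd x.castSucc z).mul hR)
  refine (norm_obsAvg_le hq hh hall).trans ?_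
  refine (plantedAvg_mono hh hall.abs ((IsBddMeas.const (L ^ 2)).mul (hFc.abs.mul hR.abs))
    fun ω => ?_).trans ?_
  · rw [abs_mul, abs_mul]
    have := mul_le_mul_of_nonneg_right (hc.abs_coord_mul_le (ω x.castSucc) (ω z))
      (mul_nonneg (abs_nonneg (F fun k => ω k.castSucc.castSucc))
        (abs_nonneg (overlap r (ω x.castSucc) (ω z))))
    linarith
  · rw [plantedAvg_const_mul hh]
    gcongr

/-- An average that vanishes at the start of the path stays small along it. -/
theorem IsCavity.norm_obsAvg_le_of_zero (hc : IsCavity π P ρ a r g γ L) {q : ℂ} (hq : q.re = 1)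
    {lam : ℝ} (hl : 0 ≤ lam) {n : ℕ} {F : (Fin n → Ω) → ℝ} (hF : IsBddMeas F)
    (h0 : obsAvg q π (cavityPath lam a r g 0) F = 0) {D : ℝ} (hD0 : 0 ≤ D)
    (hD : ∀ τ ∈ Set.Icc (0 : ℝ) 1, ∀ (x : Fin (n + 1)) (z : Fin (n + 2)), z ≠ x.castSucc →
      plantedAvg π (cavityPath lam a r g τ) (fun ω : Fin (n + 2) → Ω =>
        |F (fun k => ω k.castSucc.castSucc)| * |overlap r (ω x.castSucc) (ω z)|) ≤ D) :
    ∀ τ ∈ Set.Icc (0 : ℝ) 1, ‖obsAvg q π (cavityPath lam a r g τ) F‖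
      ≤ lam * (weightSum q n * (L ^ 2 * D)) := by
  intro τ hτ
  have hB : 0 ≤ lam * (weightSum q n * (L ^ 2 * D)) := by
    have := weightSum_nonneg q n
    positivity
  have := norm_image_sub_le_of_norm_deriv_le_segment' (a := (0 : ℝ)) (b := 1)
    (f := fun τ => obsAvg q π (cavityPath lam a r g τ) F)
    (C := lam * (weightSum q n * (L ^ 2 * D)))
    (fun t _ => (hc.hasDerivAt hq hl hF t).hasDerivWithinAt) (fun t ht => ?_) τ hτ
  · simp only [h0, sub_zero] at this
    refine this.trans ?_
    nlinarith [hτ.1, hτ.2]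
  · rw [norm_mul, Complex.norm_real, Real.norm_eq_abs, abs_of_nonneg (mul_nonneg ht.1 hl)]
    have h1 := norm_weighted_sum_le q (n := n) (by positivity : 0 ≤ L ^ 2 * D)
      (fun x z hz => hc.norm_deriv_term_le hq (lam := lam) (τ := t) hF x z
        (hD t ⟨ht.1, ht.2.le⟩ x z hz))
    refine mul_le_mul ?_ h1 (norm_nonneg _) hl
    nlinarith [ht.2]

variable [IsProbabilityMeasure P]

/-- At `τ = 0` the observation carries no information on the cavity coordinate: in each replica it
keeps its prior law, independently of everything else, so a centred function of it averages to zero.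
-/
theorem IsCavity.obsAvg_zero_eq_zero (hc : IsCavity π P ρ a r g γ L) (q : ℂ) (lam : ℝ) {n : ℕ}
    (c : Fin n) {p : ℝ → ℝ} {K : (Fin n → Ω) → ℝ} (hp : ∫ x, p (γ x) ∂P = 0)
    (hb : IsBddMeas fun ω : Fin n → Ω => p (g (ω c)) * K ω)
    (hK : ∀ ω x, K (Function.update ω c (ρ (ω c, x))) = K ω) :
    obsAvg q π (cavityPath lam a r g 0) (fun ω => p (g (ω c)) * K ω) = 0 := by
  refine obsAvg_eq_zero_of_resample q hc.mp (hc.path_bdd lam 0) (fun ω x i => ?_) c hb fun ω => ?_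
  · simp [cavityPath, pathField, hc.fixed_inv]
  · simp only [Function.update_self, hc.coord_resample, hK, integral_mul_const, hp, zero_mul]

/-- At the start of the path the two squares are independent with mean `1`; moving to `τ = 1` costs
one derivative, hence `λ` times a first moment of an overlap. -/
theorem IsCavity.norm_second_moment_sub_le (hc : IsCavity π P ρ a r g γ L) {q : ℂ}
    (hq : q.re = 1) {lam : ℝ} (hl : 0 ≤ lam) {c κ : ℝ} (hκ : 0 < κ)
    (hR : ∀ τ ∈ Set.Icc (0 : ℝ) 1, plantedAvg π (cavityPath lam a r g τ)
      (fun ω : Fin 2 → Ω => |overlap r (ω 0) (ω 1)| ^ 3) ≤ c * κ ^ 3) (hc0 : 0 ≤ c) :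
    ‖obsAvg q π (cavityPath lam a r g 1) (fun ω : Fin 2 → Ω => g (ω 0) ^ 2 * g (ω 1) ^ 2)
      - obsAvg q π (cavityPath lam a r g 1) (fun _ : Fin 2 → Ω => 1)‖
    ≤ lam * (weightSum q 2 * (L ^ 2 * ((L ^ 4 + 1) * ((1 + c) * κ)))) := by
  have hh := hc.path_bdd lam
  have hg2 : ∀ k : Fin 2, IsBddMeas fun ω : Fin 2 → Ω => g (ω k) ^ 2 := fun k =>
    (hc.coord_bdd.comp (measurable_pi_apply k)).pow 2
  have hF := ((hg2 0).mul (hg2 1)).sub (IsBddMeas.const 1)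
  rw [← obsAvg_sub hq (hh 1) ((hg2 0).mul (hg2 1)) (IsBddMeas.const 1)]
  refine hc.norm_obsAvg_le_of_zero hq hl hF ?_ (by positivity) ?_ 1 ⟨zero_le_one, le_rfl⟩
  · have e : (fun ω : Fin 2 → Ω => g (ω 0) ^ 2 * g (ω 1) ^ 2 - 1)
        = fun ω => (g (ω 0) ^ 2 - 1) * g (ω 1) ^ 2 + (g (ω 1) ^ 2 - 1) * 1 := by
      ext ω; ring
    have b0 : IsBddMeas fun ω : Fin 2 → Ω => (g (ω 0) ^ 2 - 1) * g (ω 1) ^ 2 :=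
      ((hg2 0).sub (IsBddMeas.const 1)).mul (hg2 1)
    have b1 : IsBddMeas fun ω : Fin 2 → Ω => (g (ω 1) ^ 2 - 1) * 1 :=
      ((hg2 1).sub (IsBddMeas.const 1)).mul (IsBddMeas.const 1)
    rw [e, obsAvg_add hq (hh 0) b0 b1,
      hc.obsAvg_zero_eq_zero q lam 0 (p := fun t => t ^ 2 - 1) hc.law_centered_second b0
        (fun ω x => by simp),
      hc.obsAvg_zero_eq_zero q lam 1 (p := fun t => t ^ 2 - 1) hc.law_centered_second b1
        (fun ω x => rfl), add_zero]
  · intro τ hτ x z hxz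
    have hRb := isBddMeas_overlap hc.signal_bdd
    have hRp := isBddMeas_pair hRb x.castSucc z
    have hFc : IsBddMeas fun ω : Fin 4 → Ω => g (ω 0) ^ 2 * g (ω 1) ^ 2 - 1 :=
      hF.comp (e := fun (ω : Fin 4 → Ω) (k : Fin 2) => ω k.castSucc.castSucc) (by fun_prop)
    refine (plantedAvg_mono (hh τ) (hFc.abs.mul hRp.abs)
      ((IsBddMeas.const (L ^ 4 + 1)).mul hRp.abs) fun ω => ?_).trans ?_
    · refine mul_le_mul_of_nonneg_right ((abs_sub _ _).trans ?_) (abs_nonneg _)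
      have h1 := hc.abs_coord_mul_le (ω 0) (ω 1)
      have h2 : g (ω 0) ^ 2 * g (ω 1) ^ 2 = |g (ω 0) * g (ω 1)| ^ 2 := by rw [sq_abs]; ring
      have h3 := pow_le_pow_left₀ (abs_nonneg _) h1 2
      rw [h2, abs_of_nonneg (by positivity), abs_one]
      nlinarith
    · rw [plantedAvg_const_mul (hh τ), plantedAvg_pair (hh τ) hxz.symm
        (f := fun ω ω' => |overlap r ω ω'|) hRb.abs.measurable]
      have := plantedAvg_abs_le (hh τ) (isBddMeas_pair hRb 0 1) hκ (hR τ hτ)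
      gcongr

end CavityEstimates

/-! ### Second-order cavity expansion of overlap averages. -/

section CavityOverlap

variable {Ω : Type*} [MeasurableSpace Ω] {ι : Type*} {X : Type*} [MeasurableSpace X]
  {π : Measure Ω} {P : Measure X} {ρ : Ω × X → Ω} {a r : Ω → ι → ℝ} {g : Ω → ℝ} {γ : X → ℝ} {L : ℝ}

/-- `1` on the two ordered pairs of distinct replicas among the first two, `0` elsewhere. -/
def firstPair (x z : Fin 4) : ℝ := if (x = 0 ∧ z = 1) ∨ (x = 1 ∧ z = 0) then 1 else 0

theorem abs_firstPair_le (x z : Fin 4) : |firstPair x z| ≤ 1 := by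
  unfold firstPair; split_ifs <;> simp

/-- Neither of the first two replicas is ever the last one, so their weights are `1` and the leading
coefficient does not depend on `q`. -/
theorem sum_replicaWeight_firstPair (q : ℂ) (T : Fin 3 → Fin 4 → ℂ) :
    ∑ x : Fin 3, ∑ z : Fin 4, (if z = x.castSucc then 0 else
        replicaWeight q 2 x * replicaWeight q 3 z * (firstPair x.castSucc z * T x z))
      = T 0 1 + T 1 0 := by
  have h0 : replicaWeight q 2 0 = 1 := replicaWeight_castSucc q (0 : Fin 2)
  have h1 : replicaWeight q 2 1 = 1 := replicaWeight_castSucc q (1 : Fin 2)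
  have h2 : replicaWeight q 3 0 = 1 := replicaWeight_castSucc q (0 : Fin 3)
  have h3 : replicaWeight q 3 1 = 1 := replicaWeight_castSucc q (1 : Fin 3)
  have e : ∀ (x : Fin 3) (z : Fin 4), (if z = x.castSucc then 0 else
      replicaWeight q 2 x * replicaWeight q 3 z * (firstPair x.castSucc z * T x z))
      = (if x = 0 ∧ z = 1 then T 0 1 else 0) + (if x = 1 ∧ z = 0 then T 1 0 else 0) := by
    intro x z
    fin_cases x <;> fin_cases z <;> simp [firstPair, h0, h1, h2, h3]
  simp_rw [e]
  simp [Fin.sum_univ_succ]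

/-- The four-replica function appearing in the second-order expansion, centred so that it
vanishes when the cavity coordinate decouples. -/
noncomputable def centredTerm [Fintype ι] (g : Ω → ℝ) (r : Ω → ι → ℝ) (G : Ω → Ω → ℝ) (x z : Fin 4)
    (ω : Fin 4 → Ω) : ℝ :=
  (g (ω 0) * g (ω 1) * (g (ω x) * g (ω z)) - firstPair x z) *
    (G (ω 0) (ω 1) * overlap r (ω x) (ω z))

theorem IsCavity.centredTerm_bdd [Fintype ι] (hc : IsCavity π P ρ a r g γ L) {G : Ω → Ω → ℝ}
    (hG : IsBddMeas fun p : Ω × Ω => G p.1 p.2) (x z : Fin 4) :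
    IsBddMeas (centredTerm g r G x z) :=
  (((hc.pair_bdd 0 1).mul (hc.pair_bdd x z)).sub (IsBddMeas.const _)).mul
    ((isBddMeas_pair hG 0 1).mul (isBddMeas_pair (isBddMeas_overlap hc.signal_bdd) x z))

variable [Fintype ι] [IsProbabilityMeasure π]

theorem IsCavity.plantedAvg_triple_le (hc : IsCavity π P ρ a r g γ L) {lam τ : ℝ} {c κ : ℝ}
    {G : Ω → Ω → ℝ} (hG : IsBddMeas fun p : Ω × Ω => G p.1 p.2)
    (hR : plantedAvg π (cavityPath lam a r g τ)
      (fun ω : Fin 2 → Ω => |overlap r (ω 0) (ω 1)| ^ 3) ≤ c * κ ^ 3)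
    (hGm : plantedAvg π (cavityPath lam a r g τ)
      (fun ω : Fin 2 → Ω => |G (ω 0) (ω 1)| ^ 3) ≤ c * κ ^ 3)
    {n : ℕ} {x₁ z₁ x₂ z₂ x₃ z₃ : Fin n} (h₁ : x₁ ≠ z₁) (h₂ : x₂ ≠ z₂) (h₃ : x₃ ≠ z₃) :
    plantedAvg π (cavityPath lam a r g τ) (fun ω : Fin n → Ω => |G (ω x₁) (ω z₁)| *
      |overlap r (ω x₂) (ω z₂)| * |overlap r (ω x₃) (ω z₃)|) ≤ c * κ ^ 3 := by
  have hh := hc.path_bdd lam τ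
  have hRb := isBddMeas_overlap hc.signal_bdd
  refine plantedAvg_mul_mul_le hh (isBddMeas_pair hG x₁ z₁) (isBddMeas_pair hRb x₂ z₂)
    (isBddMeas_pair hRb x₃ z₃) ?_ ?_ ?_
  · rwa [plantedAvg_pair hh h₁ (f := fun ω ω' => |G ω ω'| ^ 3) (hG.abs.pow 3).measurable]
  · rwa [plantedAvg_pair hh h₂ (f := fun ω ω' => |overlap r ω ω'| ^ 3)
      (hRb.abs.pow 3).measurable]
  · rwa [plantedAvg_pair hh h₃ (f := fun ω ω' => |overlap r ω ω'| ^ 3)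
      (hRb.abs.pow 3).measurable]

variable [IsProbabilityMeasure P]

/-- For the first pair, `g₀² g₁² - 1` telescopes into centred squares. For any other pair, some
replica outside the first two carries its coordinate linearly and exactly once, and the mean-zero
law kills the term. -/
theorem IsCavity.obsAvg_centredTerm_zero (hc : IsCavity π P ρ a r g γ L) {q : ℂ}
    (hq : q.re = 1) (lam : ℝ) {G : Ω → Ω → ℝ} (hG : IsBddMeas fun p : Ω × Ω => G p.1 p.2)
    (hG₁ : ∀ ω ω' x, G (ρ (ω, x)) ω' = G ω ω') (hG₂ : ∀ ω ω' x, G ω (ρ (ω', x)) = G ω ω')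
    {x z : Fin 4} (hxz : x ≠ z) :
    obsAvg q π (cavityPath lam a r g 0) (centredTerm g r G x z) = 0 := by
  have hh := hc.path_bdd lam 0
  have hGu : ∀ (ω : Fin 4 → Ω) (k : Fin 4) (t : X),
      G (Function.update ω k (ρ (ω k, t)) 0) (Function.update ω k (ρ (ω k, t)) 1)
        = G (ω 0) (ω 1) := by
    intro ω k t
    by_cases h0 : k = 0
    · subst h0; simp [hG₁]
    · by_cases h1 : k = 1
      · subst h1; simp [hG₂]
      · simp [Ne.symm h0, Ne.symm h1]
  have hgb : ∀ k : Fin 4, IsBddMeas fun ω : Fin 4 → Ω => g (ω k) := fun k =>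
    hc.coord_bdd.comp (measurable_pi_apply k)
  have hGR := fun x z : Fin 4 =>
    (isBddMeas_pair hG 0 1).mul (isBddMeas_pair (isBddMeas_overlap hc.signal_bdd) x z)
  by_cases hp : (x = 0 ∧ z = 1) ∨ (x = 1 ∧ z = 0)
  · have e : centredTerm g r G x z = fun ω => (g (ω 0) ^ 2 - 1) *
          (g (ω 1) ^ 2 * (G (ω 0) (ω 1) * overlap r (ω x) (ω z)))
        + (g (ω 1) ^ 2 - 1) * (G (ω 0) (ω 1) * overlap r (ω x) (ω z)) := by
      ext ω
      rw [centredTerm, firstPair, if_pos hp]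
      rcases hp with ⟨rfl, rfl⟩ | ⟨rfl, rfl⟩ <;> ring
    have b0 : IsBddMeas fun ω : Fin 4 → Ω => (g (ω 0) ^ 2 - 1) *
          (g (ω 1) ^ 2 * (G (ω 0) (ω 1) * overlap r (ω x) (ω z))) :=
      (((hgb 0).pow 2).sub (IsBddMeas.const 1)).mul (((hgb 1).pow 2).mul (hGR x z))
    have b1 : IsBddMeas fun ω : Fin 4 → Ω => (g (ω 1) ^ 2 - 1) *
          (G (ω 0) (ω 1) * overlap r (ω x) (ω z)) :=
      (((hgb 1).pow 2).sub (IsBddMeas.const 1)).mul (hGR x z)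
    rw [e, obsAvg_add hq hh b0 b1,
      hc.obsAvg_zero_eq_zero q lam 0 (p := fun t => t ^ 2 - 1) hc.law_centered_second b0
        (fun ω t => by rw [hGu, hc.overlap_update]; simp),
      hc.obsAvg_zero_eq_zero q lam 1 (p := fun t => t ^ 2 - 1) hc.law_centered_second b1
        (fun ω t => by rw [hGu, hc.overlap_update]), add_zero]
  · have key : ∀ x z : Fin 4, x ≠ z → x ≠ 0 → x ≠ 1 →
        obsAvg q π (cavityPath lam a r g 0) (fun ω : Fin 4 → Ω => g (ω x) *
          (g (ω 0) * g (ω 1) * g (ω z) * (G (ω 0) (ω 1) * overlap r (ω x) (ω z)))) = 0 := by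
      intro x z h h0 h1
      refine hc.obsAvg_zero_eq_zero q lam x (p := fun t => t) hc.law_mean
        ((hgb x).mul ((((hgb 0).mul (hgb 1)).mul (hgb z)).mul (hGR x z))) fun ω t => ?_
      rw [hGu, hc.overlap_update]
      simp [h.symm, h0.symm, h1.symm]
    -- Two distinct indices both in `{0, 1}` would form the first pair.
    have hx : (x ≠ 0 ∧ x ≠ 1) ∨ (z ≠ 0 ∧ z ≠ 1) := by
      revert hp hxz; revert x z; decide
    rcases hx with ⟨h0, h1⟩ | ⟨h0, h1⟩
    · rw [← key x z hxz h0 h1]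
      congr 1; ext ω
      rw [centredTerm, firstPair, if_neg hp]; ring
    · rw [← key z x hxz.symm h0 h1]
      congr 1; ext ω
      have : overlap r (ω z) (ω x) = overlap r (ω x) (ω z) := by
        simp only [overlap, mul_comm]
      rw [centredTerm, firstPair, if_neg hp, this]; ring

/-- The constant in the cavity estimate for the overlap. -/
noncomputable def cavityConst (q : ℂ) (L c : ℝ) : ℝ :=
  weightSum q 2 * (weightSum q 4 * (L ^ 2 * ((L ^ 4 + 1) * c))) + weightSum q 2 * (L ^ 2 * c)

/-- Integrating out one coordinate of the signal, to leading order. -/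
theorem IsCavity.norm_overlap_sub_le (hc : IsCavity π P ρ a r g γ L) {q : ℂ} (hq : q.re = 1)
    {lam : ℝ} (hl : 0 ≤ lam) {c κ : ℝ} (hκ : 0 < κ) (hc0 : 0 ≤ c)
    {G : Ω → Ω → ℝ} (hG : IsBddMeas fun p : Ω × Ω => G p.1 p.2)
    (hGs : ∀ ω ω', G ω ω' = G ω' ω)
    (hG₁ : ∀ ω ω' x, G (ρ (ω, x)) ω' = G ω ω')
    (hR : ∀ τ ∈ Set.Icc (0 : ℝ) 1, plantedAvg π (cavityPath lam a r g τ)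
      (fun ω : Fin 2 → Ω => |overlap r (ω 0) (ω 1)| ^ 3) ≤ c * κ ^ 3)
    (hGm : ∀ τ ∈ Set.Icc (0 : ℝ) 1, plantedAvg π (cavityPath lam a r g τ)
      (fun ω : Fin 2 → Ω => |G (ω 0) (ω 1)| ^ 3) ≤ c * κ ^ 3) :
    ‖obsAvg q π (cavityPath lam a r g 1)
        (fun ω : Fin 2 → Ω => g (ω 0) * g (ω 1) * G (ω 0) (ω 1))
      - lam * obsAvg q π (cavityPath lam a r g 1)
        (fun ω : Fin 2 → Ω => G (ω 0) (ω 1) * overlap r (ω 0) (ω 1))‖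
    ≤ lam ^ 2 * (cavityConst q L c * κ ^ 3) := by
  have hG₂ : ∀ ω ω' x, G ω (ρ (ω', x)) = G ω ω' := fun ω ω' x => by
    rw [hGs, hG₁, hGs]
  have hh := hc.path_bdd lam
  have hRb := isBddMeas_overlap hc.signal_bdd
  have hgb : ∀ (n : ℕ) (k : Fin n), IsBddMeas fun ω : Fin n → Ω => g (ω k) := fun _ k =>
    hc.coord_bdd.comp (measurable_pi_apply k)
  set F₁ : (Fin 2 → Ω) → ℝ := fun ω => g (ω 0) * g (ω 1) * G (ω 0) (ω 1) with hF₁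
  set F₂ : (Fin 2 → Ω) → ℝ := fun ω => G (ω 0) (ω 1) * overlap r (ω 0) (ω 1) with hF₂
  have bF₁ : IsBddMeas F₁ := ((hgb 2 0).mul (hgb 2 1)).mul (isBddMeas_pair hG 0 1)
  have bF₂ : IsBddMeas F₂ := (isBddMeas_pair hG 0 1).mul (isBddMeas_pair hRb 0 1)
  have hdom : 0 ≤ L ^ 2 * ((L ^ 4 + 1) * (c * κ ^ 3)) := by positivity
  -- the centred terms are small along the path
  have hsmall : ∀ τ ∈ Set.Icc (0 : ℝ) 1, ∀ x z : Fin 4, x ≠ z →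
      ‖obsAvg q π (cavityPath lam a r g τ) (centredTerm g r G x z)‖
        ≤ lam * (weightSum q 4 * (L ^ 2 * ((L ^ 4 + 1) * (c * κ ^ 3)))) := by
    intro τ hτ x z hxz
    refine hc.norm_obsAvg_le_of_zero hq hl (hc.centredTerm_bdd hG x z)
      (hc.obsAvg_centredTerm_zero hq lam hG hG₁ hG₂ hxz) (by positivity) ?_ τ hτ
    -- Differentiating a centred term adds a second overlap, so the bound involves `|G|` times two
    -- overlaps: exactly three factors.
    intro t ht x' z' hxz'
    have hb6 : ∀ x z : Fin 6, IsBddMeas fun ω : Fin 6 → Ω => |overlap r (ω x) (ω z)| :=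
      fun x z => (isBddMeas_pair hRb x z).abs
    have bC : IsBddMeas fun ω : Fin 6 → Ω =>
        |centredTerm g r G x z (fun k => ω k.castSucc.castSucc)| :=
      ((hc.centredTerm_bdd hG x z).comp (e := fun (ω : Fin 6 → Ω) (k : Fin 4) =>
        ω k.castSucc.castSucc) (by fun_prop)).abs
    have bG6 : IsBddMeas fun ω : Fin 6 → Ω => |G (ω 0) (ω 1)| := (isBddMeas_pair hG 0 1).abs
    refine (plantedAvg_mono (hh t) (bC.mul (hb6 _ _)) ((IsBddMeas.const (L ^ 4 + 1)).mul
      ((bG6.mul (hb6 x.castSucc.castSucc z.castSucc.castSucc)).mul (hb6 x'.castSucc z')))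
      fun ω => ?_).trans ?_
    · simp only [centredTerm]
      rw [abs_mul, abs_mul]
      have h1 := hc.abs_coord_mul_le (ω 0) (ω 1)
      have h2 := hc.abs_coord_mul_le (ω x.castSucc.castSucc) (ω z.castSucc.castSucc)
      have h3 := abs_firstPair_le x z
      have h4 : |g (ω 0) * g (ω 1) * (g (ω x.castSucc.castSucc) * g (ω z.castSucc.castSucc))
          - firstPair x z| ≤ L ^ 4 + 1 := by
        refine (abs_sub _ _).trans (add_le_add ?_ h3)
        rw [abs_mul]
        calc _ ≤ L ^ 2 * L ^ 2 := mul_le_mul h1 h2 (abs_nonneg _) (by positivity)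
          _ = L ^ 4 := by ring
      calc _ ≤ (L ^ 4 + 1) * (|G (ω 0) (ω 1)| *
            |overlap r (ω x.castSucc.castSucc) (ω z.castSucc.castSucc)|) *
              |overlap r (ω x'.castSucc) (ω z')| :=
            mul_le_mul_of_nonneg_right (mul_le_mul_of_nonneg_right h4 (by positivity))
              (abs_nonneg _)
        _ = _ := by ring
    · rw [plantedAvg_const_mul (hh t)]
      refine mul_le_mul_of_nonneg_left ?_ (by positivity)
      exact hc.plantedAvg_triple_le hG (hR t ht) (hGm t ht) (by decide)
        (by simpa using hxz) hxz'.symm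
  -- Subtracting `λ τ² F₂` rather than `λ F₂` keeps the difference zero at `τ = 0`, and its
  -- derivative `2 λ τ F₂` cancels the two first-pair terms in the derivative of `F₁`.
  have hd : ∀ τ, HasDerivAt (fun τ : ℝ => obsAvg q π (cavityPath lam a r g τ) F₁
      - ((lam * τ ^ 2 : ℝ) : ℂ) * obsAvg q π (cavityPath lam a r g τ) F₂) _ τ := fun τ =>
    (hc.hasDerivAt hq hl bF₁ τ).sub
      ((((hasDerivAt_id τ).pow 2).const_mul lam).ofReal_comp.mul (hc.hasDerivAt hq hl bF₂ τ))
  have main := norm_image_sub_le_of_norm_deriv_le_segment_01'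
    (C := lam ^ 2 * (cavityConst q L c * κ ^ 3))
    (fun τ _ => (hd τ).hasDerivWithinAt) (fun τ hτ => ?_)
  · have h0 : obsAvg q π (cavityPath lam a r g 0) F₁ = 0 := by
      have := hc.obsAvg_zero_eq_zero q lam (0 : Fin 2) (p := fun t => t)
        (K := fun ω : Fin 2 → Ω => g (ω 1) * G (ω 0) (ω 1)) hc.law_mean
        ((hgb 2 0).mul ((hgb 2 1).mul (isBddMeas_pair hG 0 1))) fun ω x => by simp [hG₁]
      rw [← this, hF₁]
      congr 1; ext ω; ring
    simpa [h0] using main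
  · have hτ' : τ ∈ Set.Icc (0 : ℝ) 1 := ⟨hτ.1, hτ.2.le⟩
    set S₂ := ∑ x : Fin (2 + 1), ∑ z : Fin (2 + 2), if z = x.castSucc then 0 else
        replicaWeight q 2 x * replicaWeight q (2 + 1) z *
        obsAvg q π (cavityPath lam a r g τ) (fun ω : Fin (2 + 2) → Ω =>
          F₂ (fun k => ω k.castSucc.castSucc) *
            (g (ω x.castSucc) * g (ω z) * overlap r (ω x.castSucc) (ω z))) with hS₂
    set S₀ := ∑ x : Fin (2 + 1), ∑ z : Fin (2 + 2), if z = x.castSucc then 0 else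
        replicaWeight q 2 x * replicaWeight q (2 + 1) z *
        obsAvg q π (cavityPath lam a r g τ) (centredTerm g r G x.castSucc z) with hS₀
    have hS₁ : (∑ x : Fin (2 + 1), ∑ z : Fin (2 + 2), if z = x.castSucc then 0 else
        replicaWeight q 2 x * replicaWeight q (2 + 1) z *
        obsAvg q π (cavityPath lam a r g τ) (fun ω : Fin (2 + 2) → Ω =>
          F₁ (fun k => ω k.castSucc.castSucc) *
            (g (ω x.castSucc) * g (ω z) * overlap r (ω x.castSucc) (ω z))))
        = S₀ + 2 * obsAvg q π (cavityPath lam a r g τ) F₂ := by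
      -- By symmetry of the overlap both orders of the first pair give the same average, which
      -- accounts for the factor `2`.
      have hT : ∀ x z : Fin 4, x ≠ z → (x = 0 ∧ z = 1) ∨ (x = 1 ∧ z = 0) →
          obsAvg q π (cavityPath lam a r g τ) (fun ω : Fin 4 → Ω =>
            G (ω 0) (ω 1) * overlap r (ω x) (ω z)) = obsAvg q π (cavityPath lam a r g τ) F₂ := by
        intro x z hxz hp
        rw [← obsAvg_comp q (hh τ) (e := fun k : Fin 2 => k.castSucc.castSucc)
          (fun k l h => by simpa using h) bF₂.measurable]
        congr 1; ext ω
        rcases hp with ⟨rfl, rfl⟩ | ⟨rfl, rfl⟩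
        · rfl
        · change _ = G (ω 0) (ω 1) * overlap r (ω 0) (ω 1)
          congr 1
          simp only [overlap, mul_comm]
      have h2 := sum_replicaWeight_firstPair q (fun x z =>
        obsAvg q π (cavityPath lam a r g τ) (fun ω : Fin 4 → Ω =>
            G (ω 0) (ω 1) * overlap r (ω x.castSucc) (ω z)))
      have h3 := hT (0 : Fin 3).castSucc 1 (by decide) (by decide)
      have h4 := hT (1 : Fin 3).castSucc 0 (by decide) (by decide)
      rw [h3, h4, ← two_mul] at h2
      rw [← h2, hS₀, ← Finset.sum_add_distrib]
      refine Finset.sum_congr rfl fun x _ => ?_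
      rw [← Finset.sum_add_distrib]
      refine Finset.sum_congr rfl fun z _ => ?_
      split_ifs with hz
      · simp
      · rw [← mul_add, ← obsAvg_const_mul, ← obsAvg_add hq (hh τ) (hc.centredTerm_bdd hG _ _)
          ((IsBddMeas.const _).mul
            ((isBddMeas_pair hG 0 1).mul (isBddMeas_pair hRb x.castSucc z)))]
        congr 2; ext ω
        change g (ω 0) * g (ω 1) * G (ω 0) (ω 1) * _ = _
        rw [centredTerm]; ring
    rw [hS₁]
    have n₀ : ‖S₀‖ ≤ weightSum q 2 *
        (lam * (weightSum q 4 * (L ^ 2 * ((L ^ 4 + 1) * (c * κ ^ 3))))) := by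
      have := weightSum_nonneg q 4
      exact norm_weighted_sum_le q (n := 2) (by positivity)
        fun x z hz => hsmall τ hτ' x.castSucc z hz.symm
    have n₂ : ‖S₂‖ ≤ weightSum q 2 * (L ^ 2 * (c * κ ^ 3)) := by
      refine norm_weighted_sum_le q (n := 2) (by positivity) fun x z hz => ?_
      refine hc.norm_deriv_term_le hq bF₂ x z ?_
      refine le_trans (le_of_eq ?_) (hc.plantedAvg_triple_le hG (hR τ hτ') (hGm τ hτ')
        (n := 4) (x₁ := 0) (z₁ := 1) (x₂ := 0) (z₂ := 1) (by decide) (by decide) hz.symm)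
      congr 1; ext ω
      change |G (ω 0) (ω 1) * overlap r (ω 0) (ω 1)| * _ = _
      rw [abs_mul]
    -- After the cancellation every remainder is of order `λ²`: explicitly for `S₂`, and for `S₀`
    -- because the centred terms are themselves of order `λ`.
    have e : ((τ * lam : ℝ) : ℂ) * (S₀ + 2 * obsAvg q π (cavityPath lam a r g τ) F₂)
        - (((lam * (((2 : ℕ) : ℝ) * id τ ^ (2 - 1) * 1) : ℝ) : ℂ)
            * obsAvg q π (cavityPath lam a r g τ) F₂
          + ((lam * τ ^ 2 : ℝ) : ℂ) * (((τ * lam : ℝ) : ℂ) * S₂))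
        = ((τ * lam : ℝ) : ℂ) * S₀ - ((lam ^ 2 * τ ^ 3 : ℝ) : ℂ) * S₂ := by
      simp; ring
    refine (congrArg norm e).trans_le ?_
    refine (norm_sub_le _ _).trans ?_
    rw [norm_mul, norm_mul, Complex.norm_real, Complex.norm_real, Real.norm_eq_abs,
      Real.norm_eq_abs, abs_of_nonneg (mul_nonneg hτ.1 hl),
      abs_of_nonneg (mul_nonneg (sq_nonneg lam) (pow_nonneg hτ.1 3))]
    have t1 : τ * lam ≤ lam := by nlinarith [hτ.1, hτ.2]
    have t3 : lam ^ 2 * τ ^ 3 ≤ lam ^ 2 := by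
      have := pow_le_one₀ (n := 3) hτ.1 hτ.2.le
      nlinarith [sq_nonneg lam]
    calc _ ≤ lam * (weightSum q 2 *
          (lam * (weightSum q 4 * (L ^ 2 * ((L ^ 4 + 1) * (c * κ ^ 3))))))
          + lam ^ 2 * (weightSum q 2 * (L ^ 2 * (c * κ ^ 3))) :=
          add_le_add (mul_le_mul t1 n₀ (norm_nonneg _) hl)
            (mul_le_mul t3 n₂ (norm_nonneg _) (sq_nonneg _))
      _ = _ := by rw [cavityConst]; ring

end CavityOverlap

/-! ### Sub-Gaussian overlaps under the prior. -/

section SubGaussian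

/-- A bounded random variable whose moment generating function is at most that of a centred
Gaussian of variance `σ`. -/
structure IsSubG {α : Type*} [MeasurableSpace α] (A : α → ℝ) (μ : Measure α) (σ : ℝ) : Prop where
  bdd : IsBddMeas A
  mgf_le : ∀ t : ℝ, ∫ x, Real.exp (t * A x) ∂μ ≤ Real.exp (σ * t ^ 2 / 2)

theorem integral_exp_sq_gaussianReal {t : ℝ} (ht : t < 1) :
    ∫ g, Real.exp (t * g ^ 2 / 2) ∂(gaussianReal 0 1) = 1 / Real.sqrt (1 - t) := by
  rw [integral_gaussianReal_eq_integral_smul one_ne_zero]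
  have e : ∀ x : ℝ, gaussianPDFReal 0 1 x • Real.exp (t * x ^ 2 / 2)
      = (Real.sqrt (2 * Real.pi))⁻¹ * Real.exp (-((1 - t) / 2) * x ^ 2) := by
    intro x
    rw [gaussianPDFReal, smul_eq_mul, mul_assoc, ← Real.exp_add]
    simp only [NNReal.coe_one, mul_one, sub_zero]
    congr 2
    ring
  simp_rw [e]
  rw [integral_const_mul, integral_gaussian]
  have h1 : 0 < 1 - t := by linarith
  have : Real.pi / ((1 - t) / 2) = (2 * Real.pi) / (1 - t) := by field_simp
  rw [this, Real.sqrt_div (by positivity)]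
  have : Real.sqrt (2 * Real.pi) ≠ 0 := by positivity
  field_simp

theorem integrable_exp_sq_gaussianReal {t : ℝ} (ht : t < 1) :
    Integrable (fun g : ℝ => Real.exp (t * g ^ 2 / 2)) (gaussianReal 0 1) := by
  refine Integrable.of_integral_ne_zero ?_
  rw [integral_exp_sq_gaussianReal ht]
  have : 0 < 1 - t := by linarith
  positivity

variable {α β : Type*} [MeasurableSpace α] [MeasurableSpace β] {μ : Measure α} {ν : Measure β}
  [IsProbabilityMeasure μ] [IsProbabilityMeasure ν] {A : α → ℝ} {B : β → ℝ}

theorem IsBddMeas.integrable {α : Type*} [MeasurableSpace α] {f : α → ℝ} (hf : IsBddMeas f)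
    (μ : Measure α) [IsFiniteMeasure μ] : Integrable f μ := by
  obtain ⟨K, hK⟩ := hf.bounded
  exact Integrable.of_bound hf.measurable.aestronglyMeasurable K (ae_of_all _ hK)

theorem IsBddMeas.exp {α : Type*} [MeasurableSpace α] {f : α → ℝ} (hf : IsBddMeas f) :
    IsBddMeas fun x => Real.exp (f x) := by
  obtain ⟨K, hK⟩ := hf.bounded
  refine ⟨hf.measurable.exp, Real.exp K, fun x => ?_⟩
  rw [abs_of_pos (Real.exp_pos _)]
  exact Real.exp_le_exp.2 ((le_abs_self _).trans (hK x))

/-- Gaussian linearization of the exponential of a square. -/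
theorem IsSubG.integral_exp_sq_le {σ θ : ℝ} (hB : IsSubG B ν σ) (hθ : 0 ≤ θ) (h1 : θ * σ < 1) :
    ∫ x, Real.exp (θ * B x ^ 2 / 2) ∂ν ≤ 1 / Real.sqrt (1 - θ * σ) := by
  obtain ⟨K, hK⟩ := hB.bdd.bounded
  have hBm := hB.bdd.measurable
  -- With an auxiliary standard Gaussian `g` the exponent becomes linear in `B`; the mgf bound then
  -- leaves the explicit integral of `exp (θ σ g² / 2)`, finite since `θ σ < 1`.
  have hlin : ∀ b : ℝ, Real.exp (θ * b ^ 2 / 2)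
      = ∫ g, Real.exp ((Real.sqrt θ * g) * b) ∂(gaussianReal 0 1) := by
    intro b
    have := congrFun (mgf_id_gaussianReal (μ := 0) (v := 1)) (Real.sqrt θ * b)
    simp only [mgf, id, zero_mul, NNReal.coe_one, one_mul, zero_add, mul_pow,
      Real.sq_sqrt hθ] at this
    rw [← this]
    congr 1; ext g; congr 1; ring
  simp_rw [hlin]
  rw [integral_integral_swap]
  · rw [← integral_exp_sq_gaussianReal h1]
    refine integral_mono_of_nonneg (ae_of_all _ fun g => integral_nonneg fun _ =>
      (Real.exp_pos _).le) (integrable_exp_sq_gaussianReal h1) (ae_of_all _ fun g => ?_)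
    refine (hB.mgf_le _).trans (le_of_eq ?_)
    rw [mul_pow, Real.sq_sqrt hθ]
    congr 1; ring
  · have hd : Integrable (fun p : β × ℝ => Real.exp (Real.sqrt θ * K * |p.2|))
        (ν.prod (gaussianReal 0 1)) :=
      (integrable_exp_mul_abs_gaussianReal (Real.sqrt θ * K)).comp_snd ν
    refine hd.mono' (by simp only [Function.uncurry_def]; fun_prop) (ae_of_all _ fun p => ?_)
    simp only [Function.uncurry, Real.norm_eq_abs, abs_of_pos (Real.exp_pos _)]
    refine Real.exp_le_exp.2 ((le_abs_self _).trans ?_)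
    rw [abs_mul, abs_mul, abs_of_nonneg (Real.sqrt_nonneg θ)]
    have := hK p.1
    calc _ ≤ Real.sqrt θ * |p.2| * K := by gcongr
      _ = _ := by ring

theorem cube_le_exp {ε x : ℝ} (hε : 0 < ε) (hx : 0 ≤ x) :
    x ^ 3 ≤ 6 / ε ^ 3 * Real.exp (ε * x) := by
  have := Real.pow_div_factorial_le_exp (ε * x) (by positivity) 3
  have h6 : ((Nat.factorial 3 : ℕ) : ℝ) = 6 := by norm_num [Nat.factorial]
  rw [h6, div_le_iff₀ (by norm_num)] at this
  rw [div_mul_eq_mul_div, le_div_iff₀ (by positivity)]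
  nlinarith

/-- Integrating `A` out first turns the tilt into `exp (λ² σA B² / 2)`. The sixth power of `B` is
absorbed by `exp (ε B² / n)`, and the resulting exponential square is integrable below the threshold
`θ < 1`. -/
theorem IsSubG.tilted_sixth_moment_le {σA σB lam n ε θ : ℝ} (hA : IsSubG A μ σA)
    (hB : IsSubG B ν σB) (hn : 0 < n) (hε : 0 < ε) (hσA : 0 ≤ σA)
    (hθ : (lam ^ 2 * σA + 2 * ε / n) * σB ≤ θ) (hθ1 : θ < 1) :
    ∫ p, (B p.2 ^ 2 / n) ^ 3 * Real.exp (lam * (A p.1 * B p.2)) ∂(μ.prod ν)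
      ≤ 6 / ε ^ 3 * (1 / Real.sqrt (1 - θ)) := by
  have hAb := hA.bdd.comp (measurable_fst : Measurable (Prod.fst : α × β → α))
  have hBb := hB.bdd.comp (measurable_snd : Measurable (Prod.snd : α × β → β))
  have i1 : IsBddMeas fun p : α × β => Real.exp (lam * (A p.1 * B p.2)) :=
    ((IsBddMeas.const lam).mul (hAb.mul hBb)).exp
  have i2 : IsBddMeas fun p : α × β => (B p.2 ^ 2 / n) ^ 3 * Real.exp (lam * (A p.1 * B p.2)) := by
    simpa [div_eq_mul_inv] using (((hBb.pow 2).mul (IsBddMeas.const n⁻¹)).pow 3).mul i1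
  have i3 : IsBddMeas fun x => Real.exp ((lam ^ 2 * σA + 2 * ε / n) * B x ^ 2 / 2) := by
    have := ((IsBddMeas.const ((lam ^ 2 * σA + 2 * ε / n) / 2)).mul (hB.bdd.pow 2)).exp
    convert this using 3
    ring
  have hsub : (lam ^ 2 * σA + 2 * ε / n) * σB < 1 := hθ.trans_lt hθ1
  rw [integral_prod_symm _ (i2.integrable _)]
  calc ∫ y, ∫ x, (B y ^ 2 / n) ^ 3 * Real.exp (lam * (A x * B y)) ∂μ ∂ν
      ≤ ∫ y, 6 / ε ^ 3 * Real.exp ((lam ^ 2 * σA + 2 * ε / n) * B y ^ 2 / 2) ∂ν := by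
        refine integral_mono (i2.integrable (μ.prod ν)).integral_prod_right
          ((i3.integrable ν).const_mul _) fun y => ?_
        simp only
        rw [integral_const_mul]
        have h1 := cube_le_exp hε (by positivity : 0 ≤ B y ^ 2 / n)
        have h2 : ∫ x, Real.exp (lam * (A x * B y)) ∂μ ≤ Real.exp (σA * (lam * B y) ^ 2 / 2) := by
          refine le_trans (le_of_eq ?_) (hA.mgf_le (lam * B y))
          congr 1; ext x; congr 1; ring
        calc _ ≤ 6 / ε ^ 3 * Real.exp (ε * (B y ^ 2 / n)) * Real.exp (σA * (lam * B y) ^ 2 / 2) :=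
              mul_le_mul h1 h2 (integral_nonneg fun _ => (Real.exp_pos _).le) (by positivity)
          _ = _ := by
            rw [mul_assoc, ← Real.exp_add]
            congr 2
            field_simp
            ring
    _ ≤ 6 / ε ^ 3 * (1 / Real.sqrt (1 - (lam ^ 2 * σA + 2 * ε / n) * σB)) := by
        rw [integral_const_mul]
        exact mul_le_mul_of_nonneg_left (hB.integral_exp_sq_le (by positivity) hsub)
          (by positivity)
    _ ≤ _ := by
        have : 0 < 1 - θ := by linarith
        gcongr

/-- A bounded function of a random variable with zero mean and unit second moment. -/
structure IsNormalizedCoord (P : Measure ℝ) (f : ℝ → ℝ) (K : ℝ) : Prop where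
  prob : IsProbabilityMeasure P
  meas : Measurable f
  le : ∀ x, |f x| ≤ K
  mean : ∫ x, f x ∂P = 0
  second : ∫ x, f x ^ 2 ∂P = 1

/-- Hoeffding's lemma on `[-K, K]`, whose half-length squared is `K²`. -/
theorem IsNormalizedCoord.mgf_le {P : Measure ℝ} {f : ℝ → ℝ} {K : ℝ}
    (hf : IsNormalizedCoord P f K) (t : ℝ) :
    ∫ x, Real.exp (t * f x) ∂P ≤ Real.exp (K ^ 2 * t ^ 2 / 2) := by
  have := hf.prob
  have hK : 0 ≤ K := (abs_nonneg _).trans (hf.le 0)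
  have h := hasSubgaussianMGF_of_mem_Icc_of_integral_eq_zero (μ := P) (X := f) (a := -K) (b := K)
    hf.meas.aemeasurable (ae_of_all _ fun x => abs_le.1 (hf.le x)) hf.mean
  refine (h.mgf_le t).trans (le_of_eq ?_)
  congr 1
  simp only [sub_neg_eq_add, NNReal.coe_pow, NNReal.coe_div, coe_nnnorm, Real.norm_eq_abs,
    NNReal.coe_ofNat, abs_of_nonneg (add_nonneg hK hK)]
  ring

/-- With the second vector fixed, the overlap is a sum of independent centred terms with proxy at
most `K² · K²` each, uniformly in that vector. The weights are needed because a cavity path rescales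
one coordinate. -/
theorem isSubG_weighted_overlap {P : Measure ℝ} {f : ℝ → ℝ} {K : ℝ}
    (hf : IsNormalizedCoord P f K) {n : ℕ} (w : Fin n → ℝ) (hw : ∀ i, |w i| ≤ 1) :
    IsSubG (fun p : (Fin n → ℝ) × (Fin n → ℝ) => ∑ i, w i * (f (p.1 i) * f (p.2 i)))
      ((Measure.pi fun _ => P).prod (Measure.pi fun _ => P)) (n * K ^ 4) := by
  have := hf.prob
  have hfb : IsBddMeas f := ⟨hf.meas, K, hf.le⟩
  have hK : 0 ≤ K := (abs_nonneg _).trans (hf.le 0)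
  have hb : IsBddMeas (fun p : (Fin n → ℝ) × (Fin n → ℝ) =>
      ∑ i, w i * (f (p.1 i) * f (p.2 i))) :=
    IsBddMeas.sum _ fun i => (IsBddMeas.const _).mul
      ((hfb.comp (by fun_prop)).mul (hfb.comp (by fun_prop)))
  refine ⟨hb, fun t => ?_⟩
  have he := ((IsBddMeas.const t).mul hb).exp
  rw [integral_prod_symm _ (he.integrable _)]
  have key : ∀ u' : Fin n → ℝ,
      ∫ u, Real.exp (t * ∑ i, w i * (f (u i) * f (u' i))) ∂(Measure.pi fun _ : Fin n => P)
        ≤ Real.exp (n * K ^ 4 * t ^ 2 / 2) := by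
    intro u'
    have e : ∀ u : Fin n → ℝ, Real.exp (t * ∑ i, w i * (f (u i) * f (u' i)))
        = ∏ i, Real.exp (t * w i * f (u' i) * f (u i)) := by
      intro u
      rw [← Real.exp_sum, Finset.mul_sum]
      congr 1
      exact Finset.sum_congr rfl fun i _ => by ring
    simp_rw [e]
    rw [integral_fintype_prod_eq_prod (𝕜 := ℝ)
      (fun i x => Real.exp (t * w i * f (u' i) * f x))]
    have : Real.exp (n * K ^ 4 * t ^ 2 / 2) = ∏ _i : Fin n, Real.exp (K ^ 4 * t ^ 2 / 2) := by
      rw [Finset.prod_const, Finset.card_univ, Fintype.card_fin, ← Real.exp_nat_mul]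
      congr 1; ring
    rw [this]
    refine Finset.prod_le_prod (fun i _ => integral_nonneg fun _ => (Real.exp_pos _).le)
      fun i _ => (hf.mgf_le _).trans (Real.exp_le_exp.2 ?_)
    have h1 : w i ^ 2 ≤ 1 := by rw [← sq_abs]; exact pow_le_one₀ (abs_nonneg _) (hw i)
    have h2 : f (u' i) ^ 2 ≤ K ^ 2 := by
      rw [← sq_abs]; exact pow_le_pow_left₀ (abs_nonneg _) (hf.le _) 2
    have h3 : w i ^ 2 * f (u' i) ^ 2 ≤ 1 * K ^ 2 :=
      mul_le_mul h1 h2 (sq_nonneg _) zero_le_one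
    have h4 : 0 ≤ K ^ 2 * t ^ 2 := by positivity
    calc _ = K ^ 2 * t ^ 2 * (w i ^ 2 * f (u' i) ^ 2) / 2 := by ring
      _ ≤ K ^ 2 * t ^ 2 * (1 * K ^ 2) / 2 := by gcongr
      _ = _ := by ring
  refine (integral_mono (he.integrable (((Measure.pi fun _ => P)).prod
    (Measure.pi fun _ => P))).integral_prod_right (integrable_const _) key).trans ?_
  simp

end SubGaussian

/-! ### Measure-preserving rearrangements of the replicas and of the spikes. -/

section Rearrangement

variable {α β γ δ : Type*} [MeasurableSpace α] [MeasurableSpace β] [MeasurableSpace γ]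
  [MeasurableSpace δ]

theorem measurePreserving_prodProdProdComm (μ : Measure α) (ν : Measure β) (τ : Measure γ)
    (σ : Measure δ) [SFinite μ] [SFinite ν] [SFinite τ] [SFinite σ] :
    MeasurePreserving (fun p : (α × β) × (γ × δ) => ((p.1.1, p.2.1), (p.1.2, p.2.2)))
      ((μ.prod ν).prod (τ.prod σ)) ((μ.prod τ).prod (ν.prod σ)) := by
  have h1 := measurePreserving_prodAssoc μ ν (τ.prod σ)
  have h2 := (MeasurePreserving.id μ).prod ((measurePreserving_prodAssoc ν τ σ).symm)
  have h3 := (MeasurePreserving.id μ).prod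
    ((Measure.measurePreserving_swap (μ := ν) (ν := τ)).prod (MeasurePreserving.id σ))
  have h4 := (MeasurePreserving.id μ).prod (measurePreserving_prodAssoc τ ν σ)
  have h5 := (measurePreserving_prodAssoc μ τ (ν.prod σ)).symm
  exact h5.comp (h4.comp (h3.comp (h2.comp h1)))

theorem measurePreserving_replica_pair (μ : Measure α) (ν : Measure β) [IsProbabilityMeasure μ]
    [IsProbabilityMeasure ν] :
    MeasurePreserving (fun ω : Fin 2 → α × β => (((ω 0).1, (ω 1).1), ((ω 0).2, (ω 1).2)))
      (Measure.pi fun _ => μ.prod ν) ((μ.prod μ).prod (ν.prod ν)) :=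
  (measurePreserving_prodProdProdComm μ ν μ ν).comp (measurePreserving_finTwoArrow (μ.prod ν))

theorem measurePreserving_resample_fst {κ : Type*} [Fintype κ] [DecidableEq κ] (P : Measure ℝ)
    [IsProbabilityMeasure P] (ν : Measure β) [SFinite ν] (i : κ) :
    MeasurePreserving (fun p : ((κ → ℝ) × β) × ℝ => (Function.update p.1.1 i p.2, p.1.2))
      (((Measure.pi fun _ => P).prod ν).prod P) ((Measure.pi fun _ => P).prod ν) := by
  have h1 := measurePreserving_prodAssoc (Measure.pi fun _ : κ => P) ν P
  have h2 := (MeasurePreserving.id (Measure.pi fun _ : κ => P)).prod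
    (Measure.measurePreserving_swap (μ := ν) (ν := P))
  have h3 := (measurePreserving_prodAssoc (Measure.pi fun _ : κ => P) P ν).symm
  have h4 := (measurePreserving_update_pi (fun _ : κ => P) i).prod (MeasurePreserving.id ν)
  exact h4.comp (h3.comp (h2.comp h1))

theorem measurePreserving_resample_snd {κ : Type*} [Fintype κ] [DecidableEq κ] (P : Measure ℝ)
    [IsProbabilityMeasure P] (ν : Measure β) [SFinite ν] (i : κ) :
    MeasurePreserving (fun p : (β × (κ → ℝ)) × ℝ => (p.1.1, Function.update p.1.2 i p.2))
      ((ν.prod (Measure.pi fun _ => P)).prod P) (ν.prod (Measure.pi fun _ => P)) := by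
  have h1 := measurePreserving_prodAssoc ν (Measure.pi fun _ : κ => P) P
  have h2 := (MeasurePreserving.id ν).prod (measurePreserving_update_pi (fun _ : κ => P) i)
  exact h2.comp h1

end Rearrangement

/-! ### Overlap moments in the rank-one model. -/

section SpikedModel

variable {N M : ℕ}

/-- The law of the pair of spikes. -/
noncomputable def spikePrior (Pu Pv : Measure ℝ) (N M : ℕ) : Measure ((Fin N → ℝ) × (Fin M → ℝ)) :=
  (Measure.pi fun _ : Fin N => Pu).prod (Measure.pi fun _ : Fin M => Pv)

instance {Pu Pv : Measure ℝ} [IsProbabilityMeasure Pu] [IsProbabilityMeasure Pv] :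
    IsProbabilityMeasure (spikePrior Pu Pv N M) := by
  unfold spikePrior; infer_instance

/-- The rank-one signal, with the rows and columns rescaled by `κ` and `κ'`. -/
noncomputable def spikeField (lam : ℝ) (fu fv : ℝ → ℝ) (κ : Fin N → ℝ) (κ' : Fin M → ℝ)
    (ω : (Fin N → ℝ) × (Fin M → ℝ)) (p : Fin N × Fin M) : ℝ :=
  Real.sqrt lam * ((κ p.1 * fu (ω.1 p.1)) * (κ' p.2 * fv (ω.2 p.2)))

/-- The weighted overlap of two vectors whose coordinates are transformed by `f`. -/
def coordOverlap {n : ℕ} (f : ℝ → ℝ) (w : Fin n → ℝ) (x x' : Fin n → ℝ) : ℝ :=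
  ∑ i, w i * (f (x i) * f (x' i))

theorem isBddMeas_spikeField {fu fv : ℝ → ℝ} (hu : IsBddMeas fu) (hv : IsBddMeas fv) (lam : ℝ)
    (κ : Fin N → ℝ) (κ' : Fin M → ℝ) (p : Fin N × Fin M) :
    IsBddMeas fun ω => spikeField lam fu fv κ κ' ω p :=
  (IsBddMeas.const _).mul (((IsBddMeas.const _).mul (hu.comp (by fun_prop))).mul
    ((IsBddMeas.const _).mul (hv.comp (by fun_prop))))

/-- Rank one makes the two-replica exponent a product of the left and right overlaps, which is the
form the sub-Gaussian estimate handles. -/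
theorem sum_spikeField_mul {lam : ℝ} (hl : 0 ≤ lam) (fu fv : ℝ → ℝ) (κ : Fin N → ℝ)
    (κ' : Fin M → ℝ) (ω ω' : (Fin N → ℝ) × (Fin M → ℝ)) :
    ∑ p, spikeField lam fu fv κ κ' ω p * spikeField lam fu fv κ κ' ω' p
      = lam * (coordOverlap fu (fun i => κ i ^ 2) ω.1 ω'.1 *
          coordOverlap fv (fun j => κ' j ^ 2) ω.2 ω'.2) := by
  rw [coordOverlap, coordOverlap, Finset.sum_mul_sum, ← Finset.sum_product',
    Finset.univ_product_univ, Finset.mul_sum]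
  refine Finset.sum_congr rfl fun p _ => ?_
  have hs := Real.mul_self_sqrt hl
  simp only [spikeField]
  linear_combination (κ p.1 * fu (ω.1 p.1) * (κ' p.2 * fv (ω.2 p.2)) *
    (κ p.1 * fu (ω'.1 p.1) * (κ' p.2 * fv (ω'.2 p.2)))) * hs

theorem isBddMeas_coordOverlap {n : ℕ} {f : ℝ → ℝ} (hf : IsBddMeas f) (w : Fin n → ℝ) :
    IsBddMeas fun p : (Fin n → ℝ) × (Fin n → ℝ) => coordOverlap f w p.1 p.2 :=
  IsBddMeas.sum _ fun i => (IsBddMeas.const _).mul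
    ((hf.comp (by fun_prop)).mul (hf.comp (by fun_prop)))

theorem isBddMeas_fstOverlap {fu : ℝ → ℝ} (hu : IsBddMeas fu) (w : Fin N → ℝ) :
    IsBddMeas fun p : ((Fin N → ℝ) × (Fin M → ℝ)) × ((Fin N → ℝ) × (Fin M → ℝ)) =>
      coordOverlap fu w p.1.1 p.2.1 :=
  (isBddMeas_coordOverlap hu w).comp
    (e := fun p : ((Fin N → ℝ) × (Fin M → ℝ)) × ((Fin N → ℝ) × (Fin M → ℝ)) => (p.1.1, p.2.1))
    (by fun_prop)

theorem isBddMeas_sndOverlap {fv : ℝ → ℝ} (hv : IsBddMeas fv) (w : Fin M → ℝ) :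
    IsBddMeas fun p : ((Fin N → ℝ) × (Fin M → ℝ)) × ((Fin N → ℝ) × (Fin M → ℝ)) =>
      coordOverlap fv w p.1.2 p.2.2 :=
  (isBddMeas_coordOverlap hv w).comp
    (e := fun p : ((Fin N → ℝ) × (Fin M → ℝ)) × ((Fin N → ℝ) × (Fin M → ℝ)) => (p.1.2, p.2.2))
    (by fun_prop)

/-- The subcriticality conditions under which overlaps are of order `√n`. -/
structure IsSubcritical (N M : ℕ) (Ku Kv lam n ε θ : ℝ) : Prop where
  lam_nonneg : 0 ≤ lam
  n_ge : 1 ≤ n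
  ε_pos : 0 < ε
  fst_le : (lam ^ 2 * (M * Kv ^ 4) + 2 * ε / n) * (N * Ku ^ 4) ≤ θ
  snd_le : (lam ^ 2 * (N * Ku ^ 4) + 2 * ε / n) * (M * Kv ^ 4) ≤ θ
  lt_one : θ < 1

/-- The constant bounding the cubic moments of the overlaps. -/
noncomputable def momentConst (ε θ : ℝ) : ℝ := (1 + 6 / ε ^ 3 * (1 / Real.sqrt (1 - θ))) / 2

theorem momentConst_nonneg {ε θ : ℝ} (hε : 0 < ε) : 0 ≤ momentConst ε θ := by
  unfold momentConst; positivity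

variable {Pu Pv : Measure ℝ} [IsProbabilityMeasure Pu] [IsProbabilityMeasure Pv]
  {fu fv : ℝ → ℝ} {Ku Kv lam n ε θ : ℝ}

theorem IsNormalizedCoord.bdd {P : Measure ℝ} {f : ℝ → ℝ} {K : ℝ}
    (hf : IsNormalizedCoord P f K) : IsBddMeas f := ⟨hf.meas, K, hf.le⟩

/-- The second-moment bound applied to `|S|³ / n^{3/2}`, whose square is `(S² / n)³`. -/
theorem plantedAvg_cube_le_of_integral_le {Ω ι : Type*} [MeasurableSpace Ω] [Fintype ι]
    {π : Measure Ω} [IsProbabilityMeasure π] {h : Ω → ι → ℝ} (hh : ∀ i, IsBddMeas fun ω => h ω i)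
    {S : (Fin 2 → Ω) → ℝ} (hS : IsBddMeas S) {n D : ℝ} (hn : 0 < n)
    (hD : ∫ ω, (S ω ^ 2 / n) ^ 3 * Real.exp (∑ i, h (ω 0) i * h (ω 1) i)
      ∂(Measure.pi fun _ : Fin 2 => π) ≤ D) :
    plantedAvg π h (fun ω => |S ω| ^ 3) ≤ (1 + D) / 2 * Real.sqrt n ^ 3 := by
  have hs : 0 < Real.sqrt n := Real.sqrt_pos.2 hn
  have hF : IsBddMeas fun ω => (Real.sqrt n ^ 3)⁻¹ * |S ω| ^ 3 :=
    (IsBddMeas.const _).mul (hS.abs.pow 3)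
  have h1 := plantedAvg_le_second_moment (π := π) hh hF
  rw [plantedAvg_const_mul hh] at h1
  have h2 : ∀ ω, ((Real.sqrt n ^ 3)⁻¹ * |S ω| ^ 3) ^ 2 = (S ω ^ 2 / n) ^ 3 := fun ω => by
    have e1 : (|S ω| ^ 3) ^ 2 = (S ω ^ 2) ^ 3 := by rw [← pow_mul, mul_comm, pow_mul, sq_abs]
    have e2 : (Real.sqrt n ^ 3) ^ 2 = n ^ 3 := by
      rw [← pow_mul, mul_comm, pow_mul, Real.sq_sqrt hn.le]
    rw [mul_pow, inv_pow, e1, e2, div_pow]; field_simp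
  simp_rw [h2] at h1
  have h3 : (Real.sqrt n ^ 3)⁻¹ * plantedAvg π h (fun ω => |S ω| ^ 3) ≤ (1 + D) / 2 := by
    linarith
  rwa [inv_mul_le_iff₀ (by positivity), mul_comm] at h3

/-- Uniformity over rescalings in `[-1, 1]` gives the moment bounds all along every cavity path. -/
theorem IsSubcritical.plantedAvg_snd_le (hs : IsSubcritical N M Ku Kv lam n ε θ)
    (hu : IsNormalizedCoord Pu fu Ku) (hv : IsNormalizedCoord Pv fv Kv)
    {κ : Fin N → ℝ} {κ' : Fin M → ℝ} (hκ : ∀ i, |κ i| ≤ 1) (hκ' : ∀ j, |κ' j| ≤ 1) :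
    plantedAvg (spikePrior Pu Pv N M) (spikeField lam fu fv κ κ')
      (fun ω : Fin 2 → (Fin N → ℝ) × (Fin M → ℝ) =>
        |coordOverlap fv (fun j => κ' j ^ 2) (ω 0).2 (ω 1).2| ^ 3)
      ≤ momentConst ε θ * Real.sqrt n ^ 3 := by
  have hn : 0 < n := one_pos.trans_le hs.n_ge
  have hsq : ∀ x : ℝ, |x| ≤ 1 → |x ^ 2| ≤ 1 := fun x hx => by
    rw [abs_pow]; exact pow_le_one₀ (abs_nonneg _) hx
  have bv := isBddMeas_sndOverlap (N := N) hv.bdd (fun j => κ' j ^ 2)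
  refine plantedAvg_cube_le_of_integral_le (isBddMeas_spikeField hu.bdd hv.bdd lam κ κ')
    (isBddMeas_pair (f := fun ω ω' : (Fin N → ℝ) × (Fin M → ℝ) =>
      coordOverlap fv (fun j => κ' j ^ 2) ω.2 ω'.2) bv 0 1) hn ?_
  have hA := isSubG_weighted_overlap hu (fun i => κ i ^ 2) fun i => hsq _ (hκ i)
  have hB := isSubG_weighted_overlap hv (fun j => κ' j ^ 2) fun j => hsq _ (hκ' j)
  have key := hA.tilted_sixth_moment_le hB hn hs.ε_pos (by positivity) hs.snd_le hs.lt_one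
  refine le_trans (le_of_eq ?_) key
  have mp := measurePreserving_replica_pair (Measure.pi fun _ : Fin N => Pu)
    (Measure.pi fun _ : Fin M => Pv)
  have hum := hu.meas
  have hvm := hv.meas
  rw [← mp.map_eq, integral_map mp.measurable.aemeasurable
    (by fun_prop : Measurable _).aestronglyMeasurable]
  simp_rw [sum_spikeField_mul hs.lam_nonneg]
  rfl

theorem IsSubcritical.plantedAvg_fst_le (hs : IsSubcritical N M Ku Kv lam n ε θ)
    (hu : IsNormalizedCoord Pu fu Ku) (hv : IsNormalizedCoord Pv fv Kv)
    {κ : Fin N → ℝ} {κ' : Fin M → ℝ} (hκ : ∀ i, |κ i| ≤ 1) (hκ' : ∀ j, |κ' j| ≤ 1) :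
    plantedAvg (spikePrior Pu Pv N M) (spikeField lam fu fv κ κ')
      (fun ω : Fin 2 → (Fin N → ℝ) × (Fin M → ℝ) =>
        |coordOverlap fu (fun i => κ i ^ 2) (ω 0).1 (ω 1).1| ^ 3)
      ≤ momentConst ε θ * Real.sqrt n ^ 3 := by
  have hn : 0 < n := one_pos.trans_le hs.n_ge
  have hsq : ∀ x : ℝ, |x| ≤ 1 → |x ^ 2| ≤ 1 := fun x hx => by
    rw [abs_pow]; exact pow_le_one₀ (abs_nonneg _) hx
  have bu := isBddMeas_fstOverlap (M := M) hu.bdd (fun i => κ i ^ 2)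
  refine plantedAvg_cube_le_of_integral_le (isBddMeas_spikeField hu.bdd hv.bdd lam κ κ')
    (isBddMeas_pair (f := fun ω ω' : (Fin N → ℝ) × (Fin M → ℝ) =>
      coordOverlap fu (fun i => κ i ^ 2) ω.1 ω'.1) bu 0 1) hn ?_
  have hA := isSubG_weighted_overlap hu (fun i => κ i ^ 2) fun i => hsq _ (hκ i)
  have hB := isSubG_weighted_overlap hv (fun j => κ' j ^ 2) fun j => hsq _ (hκ' j)
  have key := hB.tilted_sixth_moment_le hA hn hs.ε_pos (by positivity) hs.fst_le hs.lt_one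
  refine le_trans (le_of_eq ?_) key
  have mp := (Measure.measurePreserving_swap.comp (measurePreserving_replica_pair
    (Measure.pi fun _ : Fin N => Pu) (Measure.pi fun _ : Fin M => Pv)))
  have hum := hu.meas
  have hvm := hv.meas
  rw [← mp.map_eq, integral_map mp.measurable.aemeasurable
    (by fun_prop : Measurable _).aestronglyMeasurable]
  simp_rw [sum_spikeField_mul hs.lam_nonneg, mul_comm (coordOverlap fu _ _ _)]
  rfl

end SpikedModel

/-! ### Rows and columns of the rank-one signal as cavities. -/

section SpikedCavity

variable {N M : ℕ}

/-- The full rank-one signal. -/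
noncomputable def spikeSignal (lam : ℝ) (fu fv : ℝ → ℝ) :
    (Fin N → ℝ) × (Fin M → ℝ) → Fin N × Fin M → ℝ :=
  spikeField lam fu fv (fun _ => 1) (fun _ => 1)

/-- The overlap of the left spikes. -/
def leftOverlap (fu : ℝ → ℝ) (ω ω' : (Fin N → ℝ) × (Fin M → ℝ)) : ℝ :=
  coordOverlap fu (fun _ => 1) ω.1 ω'.1

/-- The overlap of the right spikes. -/
def rightOverlap (fv : ℝ → ℝ) (ω ω' : (Fin N → ℝ) × (Fin M → ℝ)) : ℝ :=
  coordOverlap fv (fun _ => 1) ω.2 ω'.2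

/-- The overlap of the right spikes without the coordinate `j`. -/
def rightOverlapErase (fv : ℝ → ℝ) (j : Fin M) (ω ω' : (Fin N → ℝ) × (Fin M → ℝ)) : ℝ :=
  coordOverlap fv (fun k => if k = j then 0 else 1) ω.2 ω'.2

theorem rightOverlap_eq_add (fv : ℝ → ℝ) (j : Fin M) (ω ω' : (Fin N → ℝ) × (Fin M → ℝ)) :
    rightOverlap fv ω ω' = fv (ω.2 j) * fv (ω'.2 j) + rightOverlapErase fv j ω ω' := by
  rw [rightOverlap, rightOverlapErase, coordOverlap, coordOverlap,
    ← Finset.add_sum_erase _ _ (Finset.mem_univ j),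
    ← Finset.add_sum_erase Finset.univ (fun k => (if k = j then (0 : ℝ) else 1) *
      (fv (ω.2 k) * fv (ω'.2 k))) (Finset.mem_univ j)]
  simp only [one_mul, if_true, zero_mul, zero_add]
  congr 1
  exact Finset.sum_congr rfl fun k hk => by simp [Finset.ne_of_mem_erase hk]

theorem coordOverlap_update_sq (fv : ℝ → ℝ) (j : Fin M) (τ : ℝ)
    (ω ω' : (Fin N → ℝ) × (Fin M → ℝ)) :
    coordOverlap fv (fun k => (if k = j then τ else 1) ^ 2) ω.2 ω'.2
      = τ ^ 2 * (fv (ω.2 j) * fv (ω'.2 j)) + rightOverlapErase fv j ω ω' := by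
  rw [rightOverlapErase, coordOverlap, coordOverlap,
    ← Finset.add_sum_erase _ _ (Finset.mem_univ j),
    ← Finset.add_sum_erase Finset.univ (fun k => (if k = j then (0 : ℝ) else 1) *
      (fv (ω.2 k) * fv (ω'.2 k))) (Finset.mem_univ j)]
  simp only [if_true, zero_mul, zero_add]
  congr 1
  exact Finset.sum_congr rfl fun k hk => by simp [Finset.ne_of_mem_erase hk]

variable {Pu Pv : Measure ℝ} [IsProbabilityMeasure Pu] [IsProbabilityMeasure Pv]
  {fu fv : ℝ → ℝ} {Ku Kv lam n ε θ : ℝ}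

/-- Only row `i` depends on the left coordinate `i`, and along that row the signal is the right
spike; the overlap of this cavity is therefore the right overlap. -/
theorem isCavity_row (hu : IsNormalizedCoord Pu fu Ku) (hv : IsNormalizedCoord Pv fv Kv)
    (lam : ℝ) (i : Fin N) :
    IsCavity (spikePrior Pu Pv N M) Pu (fun p => (Function.update p.1.1 i p.2, p.1.2))
      (fun ω (p : Fin N × Fin M) =>
        if p.1 = i then 0 else Real.sqrt lam * (fu (ω.1 p.1) * fv (ω.2 p.2)))
      (fun ω p => if p.1 = i then fv (ω.2 p.2) else 0) (fun ω => fu (ω.1 i)) fu Ku where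
  mp := measurePreserving_resample_fst Pu _ i
  fixed_inv ω x p := by
    by_cases hp : p.1 = i <;> simp [hp]
  signal_inv ω x p := rfl
  fixed_bdd p := by
    split_ifs
    · exact IsBddMeas.const 0
    · exact (IsBddMeas.const _).mul ((hu.bdd.comp (by fun_prop)).mul (hv.bdd.comp (by fun_prop)))
  signal_bdd p := by
    split_ifs
    · exact hv.bdd.comp (by fun_prop)
    · exact IsBddMeas.const 0
  coord_meas := hu.meas.comp (by fun_prop)
  coord_le ω := hu.le _
  coord_resample ω x := by simp
  law_bdd := hu.bdd
  law_mean := hu.mean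
  law_second := hu.second
  disjoint p := by
    by_cases hp : p.1 = i <;> simp [hp]

theorem isCavity_col (hu : IsNormalizedCoord Pu fu Ku) (hv : IsNormalizedCoord Pv fv Kv)
    (lam : ℝ) (j : Fin M) :
    IsCavity (spikePrior Pu Pv N M) Pv (fun p => (p.1.1, Function.update p.1.2 j p.2))
      (fun ω (p : Fin N × Fin M) =>
        if p.2 = j then 0 else Real.sqrt lam * (fu (ω.1 p.1) * fv (ω.2 p.2)))
      (fun ω p => if p.2 = j then fu (ω.1 p.1) else 0) (fun ω => fv (ω.2 j)) fv Kv where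
  mp := measurePreserving_resample_snd Pv _ j
  fixed_inv ω x p := by
    by_cases hp : p.2 = j <;> simp [hp]
  signal_inv ω x p := rfl
  fixed_bdd p := by
    split_ifs
    · exact IsBddMeas.const 0
    · exact (IsBddMeas.const _).mul ((hu.bdd.comp (by fun_prop)).mul (hv.bdd.comp (by fun_prop)))
  signal_bdd p := by
    split_ifs
    · exact hu.bdd.comp (by fun_prop)
    · exact IsBddMeas.const 0
  coord_meas := hv.meas.comp (by fun_prop)
  coord_le ω := hv.le _
  coord_resample ω x := by simp
  law_bdd := hv.bdd
  law_mean := hv.mean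
  law_second := hv.second
  disjoint p := by
    by_cases hp : p.2 = j <;> simp [hp]

theorem cavityPath_row (lam : ℝ) (fu fv : ℝ → ℝ) (i : Fin N) (τ : ℝ) :
    cavityPath lam (fun ω (p : Fin N × Fin M) =>
        if p.1 = i then 0 else Real.sqrt lam * (fu (ω.1 p.1) * fv (ω.2 p.2)))
      (fun ω p => if p.1 = i then fv (ω.2 p.2) else 0) (fun ω => fu (ω.1 i)) τ
      = spikeField lam fu fv (fun k => if k = i then τ else 1) (fun _ => 1) := by
  ext ω ⟨k, l⟩
  by_cases hp : k = i
  · subst hp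
    simp [cavityPath, pathField, spikeField]; ring
  · simp [cavityPath, pathField, spikeField, hp]

theorem cavityPath_col (lam : ℝ) (fu fv : ℝ → ℝ) (j : Fin M) (τ : ℝ) :
    cavityPath lam (fun ω (p : Fin N × Fin M) =>
        if p.2 = j then 0 else Real.sqrt lam * (fu (ω.1 p.1) * fv (ω.2 p.2)))
      (fun ω p => if p.2 = j then fu (ω.1 p.1) else 0) (fun ω => fv (ω.2 j)) τ
      = spikeField lam fu fv (fun _ => 1) (fun l => if l = j then τ else 1) := by
  ext ω ⟨k, l⟩
  by_cases hp : l = j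
  · subst hp
    simp [cavityPath, pathField, spikeField]; ring
  · simp [cavityPath, pathField, spikeField, hp]

theorem overlap_row (fv : ℝ → ℝ) (i : Fin N) (ω ω' : (Fin N → ℝ) × (Fin M → ℝ)) :
    overlap (fun (ω : (Fin N → ℝ) × (Fin M → ℝ)) (p : Fin N × Fin M) =>
      if p.1 = i then fv (ω.2 p.2) else 0) ω ω' = rightOverlap fv ω ω' := by
  rw [overlap, Fintype.sum_prod_type, rightOverlap, coordOverlap]
  rw [Finset.sum_eq_single i (fun k _ hk => by simp [hk]) (by simp)]
  simp

theorem overlap_col (fu : ℝ → ℝ) (j : Fin M) (ω ω' : (Fin N → ℝ) × (Fin M → ℝ)) :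
    overlap (fun (ω : (Fin N → ℝ) × (Fin M → ℝ)) (p : Fin N × Fin M) =>
      if p.2 = j then fu (ω.1 p.1) else 0) ω ω' = leftOverlap fu ω ω' := by
  rw [overlap, Fintype.sum_prod_type, leftOverlap, coordOverlap]
  refine Finset.sum_congr rfl fun k _ => ?_
  rw [Finset.sum_eq_single j (fun l _ hl => by simp [hl]) (by simp)]
  simp

/-- A common bound for the cubic moments of the overlaps along the cavity paths. -/
noncomputable def overlapConst (Kv ε θ : ℝ) : ℝ := 4 * momentConst ε θ + 4 * Kv ^ 6

theorem momentConst_le_overlapConst (Kv : ℝ) {ε θ : ℝ} (hε : 0 < ε) :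
    momentConst ε θ ≤ overlapConst Kv ε θ := by
  have := momentConst_nonneg (θ := θ) hε
  have : 0 ≤ Kv ^ 6 := by positivity
  unfold overlapConst; linarith

theorem overlapConst_nonneg (Kv : ℝ) {ε θ : ℝ} (hε : 0 < ε) : 0 ≤ overlapConst Kv ε θ :=
  (momentConst_nonneg hε).trans (momentConst_le_overlapConst Kv hε)

theorem abs_ite_le {k : ℕ} {τ : ℝ} (hτ : τ ∈ Set.Icc (0 : ℝ) 1) (i l : Fin k) :
    |if l = i then τ else 1| ≤ 1 := by
  split_ifs
  · rw [abs_of_nonneg hτ.1]; exact hτ.2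
  · simp

namespace IsSubcritical

theorem right_cube_le (hs : IsSubcritical N M Ku Kv lam n ε θ)
    (hu : IsNormalizedCoord Pu fu Ku) (hv : IsNormalizedCoord Pv fv Kv)
    {κ : Fin N → ℝ} (hκ : ∀ i, |κ i| ≤ 1) :
    plantedAvg (spikePrior Pu Pv N M) (spikeField lam fu fv κ (fun _ => 1))
      (fun ω : Fin 2 → (Fin N → ℝ) × (Fin M → ℝ) => |rightOverlap fv (ω 0) (ω 1)| ^ 3)
      ≤ overlapConst Kv ε θ * Real.sqrt n ^ 3 := by
  have h := hs.plantedAvg_snd_le hu hv hκ (κ' := fun _ => 1) (by simp)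
  simp only [one_pow] at h
  refine h.trans (mul_le_mul_of_nonneg_right (momentConst_le_overlapConst Kv hs.ε_pos)
    (by positivity))

theorem left_cube_le (hs : IsSubcritical N M Ku Kv lam n ε θ)
    (hu : IsNormalizedCoord Pu fu Ku) (hv : IsNormalizedCoord Pv fv Kv)
    {κ' : Fin M → ℝ} (hκ' : ∀ i, |κ' i| ≤ 1) :
    plantedAvg (spikePrior Pu Pv N M) (spikeField lam fu fv (fun _ => 1) κ')
      (fun ω : Fin 2 → (Fin N → ℝ) × (Fin M → ℝ) => |leftOverlap fu (ω 0) (ω 1)| ^ 3)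
      ≤ overlapConst Kv ε θ * Real.sqrt n ^ 3 := by
  have h := hs.plantedAvg_fst_le hu hv (κ := fun _ => 1) (by simp) hκ'
  simp only [one_pow] at h
  refine h.trans (mul_le_mul_of_nonneg_right (momentConst_le_overlapConst Kv hs.ε_pos)
    (by positivity))

/-- The moment bound at hand is for the overlap weighted by `τ²` at `j`; erasing `j` altogether
changes it by at most `Kv²`. -/
theorem rightErase_cube_le (hs : IsSubcritical N M Ku Kv lam n ε θ)
    (hu : IsNormalizedCoord Pu fu Ku) (hv : IsNormalizedCoord Pv fv Kv) (j : Fin M)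
    {τ : ℝ} (hτ : τ ∈ Set.Icc (0 : ℝ) 1) :
    plantedAvg (spikePrior Pu Pv N M)
      (spikeField lam fu fv (fun _ => 1) (fun l => if l = j then τ else 1))
      (fun ω : Fin 2 → (Fin N → ℝ) × (Fin M → ℝ) => |rightOverlapErase fv j (ω 0) (ω 1)| ^ 3)
      ≤ overlapConst Kv ε θ * Real.sqrt n ^ 3 := by
  have h := hs.plantedAvg_snd_le hu hv (κ := fun _ => 1) (by simp)
    (fun l => abs_ite_le hτ j l)
  have hh := isBddMeas_spikeField (N := N) (M := M) hu.bdd hv.bdd lam (fun _ => 1)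
    (fun l => if l = j then τ else 1)
  have b1 := isBddMeas_pair (n := 2) (f := fun ω ω' : (Fin N → ℝ) × (Fin M → ℝ) =>
    coordOverlap fv (fun k => (if k = j then τ else 1) ^ 2) ω.2 ω'.2)
    (isBddMeas_sndOverlap hv.bdd _) 0 1
  have b2 := isBddMeas_pair (n := 2) (f := fun ω ω' : (Fin N → ℝ) × (Fin M → ℝ) =>
    rightOverlapErase fv j ω ω') (isBddMeas_sndOverlap hv.bdd _) 0 1
  have hm := plantedAvg_mono (π := spikePrior Pu Pv N M) hh (b2.abs.pow 3)
    (((IsBddMeas.const 4).mul (b1.abs.pow 3)).add (IsBddMeas.const (4 * Kv ^ 6))) fun ω => by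
      have e := coordOverlap_update_sq fv j τ (ω 0) (ω 1)
      have h1 : |τ ^ 2 * (fv ((ω 0).2 j) * fv ((ω 1).2 j))| ≤ Kv ^ 2 := by
        have ht : |τ ^ 2| ≤ 1 := by
          rw [abs_of_nonneg (sq_nonneg τ)]; exact pow_le_one₀ hτ.1 hτ.2
        rw [abs_mul, abs_mul]
        calc _ ≤ 1 * (Kv * Kv) := mul_le_mul ht (mul_le_mul (hv.le _) (hv.le _) (abs_nonneg _)
              ((abs_nonneg _).trans (hv.le 0))) (by positivity) zero_le_one
          _ = Kv ^ 2 := by ring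
      have h2 : |rightOverlapErase fv j (ω 0) (ω 1)| ≤
          |coordOverlap fv (fun k => (if k = j then τ else 1) ^ 2) (ω 0).2 (ω 1).2| + Kv ^ 2 := by
        have : rightOverlapErase fv j (ω 0) (ω 1)
            = coordOverlap fv (fun k => (if k = j then τ else 1) ^ 2) (ω 0).2 (ω 1).2
              - τ ^ 2 * (fv ((ω 0).2 j) * fv ((ω 1).2 j)) := by rw [e]; ring
        rw [this]
        exact (abs_sub _ _).trans (by gcongr)
      have h3 := pow_le_pow_left₀ (abs_nonneg _) h2 3
      have hx := abs_nonneg (coordOverlap fv (fun k => (if k = j then τ else 1) ^ 2) (ω 0).2 (ω 1).2)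
      have hy : 0 ≤ Kv ^ 2 := sq_nonneg _
      refine h3.trans ?_
      generalize |coordOverlap fv (fun k => (if k = j then τ else 1) ^ 2) (ω 0).2 (ω 1).2| = x at *
      have : Kv ^ 6 = (Kv ^ 2) ^ 3 := by ring
      rw [this]
      generalize Kv ^ 2 = y at *
      -- `4 (x³ + y³) - (x + y)³ = 3 (x + y) (x - y)²`.
      nlinarith [mul_nonneg (add_nonneg hx hy) (sq_nonneg (x - y))]
  refine hm.trans ?_
  rw [plantedAvg_add hh ((IsBddMeas.const 4).mul (b1.abs.pow 3)) (IsBddMeas.const _),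
    plantedAvg_const_mul hh, plantedAvg_const hh, overlapConst]
  -- Since `n ≥ 1`, the additive constant is absorbed in `√n³`.
  have h1 : 1 ≤ Real.sqrt n ^ 3 := one_le_pow₀ (Real.one_le_sqrt.2 hs.n_ge)
  have h2 : 0 ≤ Kv ^ 6 := by positivity
  nlinarith

/-- The right overlap does not involve the left coordinate `i`, so it can serve directly as the
spectator `G`, and it is also the overlap of the cavity. -/
theorem row_cavity (hs : IsSubcritical N M Ku Kv lam n ε θ)
    (hu : IsNormalizedCoord Pu fu Ku) (hv : IsNormalizedCoord Pv fv Kv) {q : ℂ} (hq : q.re = 1)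
    (i : Fin N) :
    ‖obsAvg q (spikePrior Pu Pv N M) (spikeSignal lam fu fv)
        (fun ω : Fin 2 → (Fin N → ℝ) × (Fin M → ℝ) =>
          fu ((ω 0).1 i) * fu ((ω 1).1 i) * rightOverlap fv (ω 0) (ω 1))
      - lam * obsAvg q (spikePrior Pu Pv N M) (spikeSignal lam fu fv)
        (fun ω : Fin 2 → (Fin N → ℝ) × (Fin M → ℝ) =>
          rightOverlap fv (ω 0) (ω 1) * rightOverlap fv (ω 0) (ω 1))‖
    ≤ lam ^ 2 * (cavityConst q Ku (overlapConst Kv ε θ) * Real.sqrt n ^ 3) := by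
  have hc := isCavity_row (M := M) hu hv lam i
  have hR : ∀ τ ∈ Set.Icc (0 : ℝ) 1, _ := fun τ hτ =>
    hs.right_cube_le hu hv (κ := fun k => if k = i then τ else 1) (fun l => abs_ite_le hτ i l)
  have := hc.norm_overlap_sub_le hq hs.lam_nonneg (c := overlapConst Kv ε θ)
    (κ := Real.sqrt n) (Real.sqrt_pos.2 (one_pos.trans_le hs.n_ge))
    (overlapConst_nonneg Kv hs.ε_pos) (G := rightOverlap fv) (isBddMeas_sndOverlap hv.bdd _)
    (fun ω ω' => by simp only [rightOverlap, coordOverlap, mul_comm (fv (ω.2 _))])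
    (fun ω ω' x => rfl)
    (by simp_rw [overlap_row, cavityPath_row]; exact hR)
    (by simp_rw [cavityPath_row]; exact hR)
  simp_rw [overlap_row, cavityPath_row] at this
  simp only [ite_self] at this
  exact this

theorem col_cavity_diag (hs : IsSubcritical N M Ku Kv lam n ε θ)
    (hu : IsNormalizedCoord Pu fu Ku) (hv : IsNormalizedCoord Pv fv Kv) {q : ℂ} (hq : q.re = 1)
    (j : Fin M) :
    ‖obsAvg q (spikePrior Pu Pv N M) (spikeSignal lam fu fv)
        (fun ω : Fin 2 → (Fin N → ℝ) × (Fin M → ℝ) => fv ((ω 0).2 j) ^ 2 * fv ((ω 1).2 j) ^ 2)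
      - obsAvg q (spikePrior Pu Pv N M) (spikeSignal lam fu fv)
        (fun _ : Fin 2 → (Fin N → ℝ) × (Fin M → ℝ) => 1)‖
    ≤ lam * (weightSum q 2 * (Kv ^ 2 * ((Kv ^ 4 + 1) *
        ((1 + overlapConst Kv ε θ) * Real.sqrt n)))) := by
  have hc := isCavity_col (N := N) hu hv lam j
  have := hc.norm_second_moment_sub_le hq hs.lam_nonneg (c := overlapConst Kv ε θ)
    (κ := Real.sqrt n) (Real.sqrt_pos.2 (one_pos.trans_le hs.n_ge))
    (by
      simp_rw [overlap_col, cavityPath_col]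
      exact fun τ hτ => hs.left_cube_le hu hv (fun l => abs_ite_le hτ j l))
    (overlapConst_nonneg Kv hs.ε_pos)
  simp_rw [cavityPath_col] at this
  simp only [ite_self] at this
  exact this

/-- Here the spectator must not depend on the right coordinate `j`, hence the erased overlap; the
removed diagonal part is `col_cavity_diag`. -/
theorem col_cavity (hs : IsSubcritical N M Ku Kv lam n ε θ)
    (hu : IsNormalizedCoord Pu fu Ku) (hv : IsNormalizedCoord Pv fv Kv) {q : ℂ} (hq : q.re = 1)
    (j : Fin M) :
    ‖obsAvg q (spikePrior Pu Pv N M) (spikeSignal lam fu fv)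
        (fun ω : Fin 2 → (Fin N → ℝ) × (Fin M → ℝ) =>
          fv ((ω 0).2 j) * fv ((ω 1).2 j) * rightOverlapErase fv j (ω 0) (ω 1))
      - lam * obsAvg q (spikePrior Pu Pv N M) (spikeSignal lam fu fv)
        (fun ω : Fin 2 → (Fin N → ℝ) × (Fin M → ℝ) =>
          rightOverlapErase fv j (ω 0) (ω 1) * leftOverlap fu (ω 0) (ω 1))‖
    ≤ lam ^ 2 * (cavityConst q Kv (overlapConst Kv ε θ) * Real.sqrt n ^ 3) := by
  have hc := isCavity_col (N := N) hu hv lam j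
  have := hc.norm_overlap_sub_le hq hs.lam_nonneg (c := overlapConst Kv ε θ)
    (κ := Real.sqrt n) (Real.sqrt_pos.2 (one_pos.trans_le hs.n_ge))
    (overlapConst_nonneg Kv hs.ε_pos) (G := rightOverlapErase fv j)
    (isBddMeas_sndOverlap hv.bdd _)
    (fun ω ω' => by simp only [rightOverlapErase, coordOverlap, mul_comm (fv (ω.2 _))])
    (fun ω ω' x => by
      simp only [rightOverlapErase, coordOverlap]
      refine Finset.sum_congr rfl fun k _ => ?_
      by_cases hk : k = j <;> simp [hk])
    (by
      simp_rw [overlap_col, cavityPath_col]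
      exact fun τ hτ => hs.left_cube_le hu hv (fun l => abs_ite_le hτ j l))
    (by
      simp_rw [cavityPath_col]
      exact fun τ hτ => hs.rightErase_cube_le hu hv j hτ)
  simp_rw [overlap_col, cavityPath_col] at this
  simp only [ite_self] at this
  exact this

end IsSubcritical

end SpikedCavity

/-! ### Approximate fixed-point equation for the overlap product. -/

section OverlapEquation

variable {N M : ℕ} {Pu Pv : Measure ℝ} [IsProbabilityMeasure Pu] [IsProbabilityMeasure Pv]
  {fu fv : ℝ → ℝ} {Ku Kv lam n ε θ : ℝ}

theorem isBddMeas_left (hu : IsBddMeas fu) : IsBddMeas fun ω : Fin 2 → (Fin N → ℝ) × (Fin M → ℝ) =>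
    leftOverlap fu (ω 0) (ω 1) :=
  isBddMeas_pair (f := leftOverlap fu) (isBddMeas_fstOverlap hu _) 0 1

theorem isBddMeas_right (hv : IsBddMeas fv) :
    IsBddMeas fun ω : Fin 2 → (Fin N → ℝ) × (Fin M → ℝ) => rightOverlap fv (ω 0) (ω 1) :=
  isBddMeas_pair (f := rightOverlap fv) (isBddMeas_sndOverlap hv _) 0 1

theorem isBddMeas_rightErase (hv : IsBddMeas fv) (j : Fin M) :
    IsBddMeas fun ω : Fin 2 → (Fin N → ℝ) × (Fin M → ℝ) => rightOverlapErase fv j (ω 0) (ω 1) :=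
  isBddMeas_pair (f := rightOverlapErase fv j) (isBddMeas_sndOverlap hv _) 0 1

theorem isBddMeas_left_coord (hu : IsBddMeas fu) (i : Fin N) :
    IsBddMeas fun ω : Fin 2 → (Fin N → ℝ) × (Fin M → ℝ) => fu ((ω 0).1 i) * fu ((ω 1).1 i) :=
  (hu.comp (by fun_prop)).mul (hu.comp (by fun_prop))

theorem isBddMeas_right_coord (hv : IsBddMeas fv) (j : Fin M) :
    IsBddMeas fun ω : Fin 2 → (Fin N → ℝ) × (Fin M → ℝ) => fv ((ω 0).2 j) * fv ((ω 1).2 j) :=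
  (hv.comp (by fun_prop)).mul (hv.comp (by fun_prop))

theorem isBddMeas_spikeSignal (hu : IsBddMeas fu) (hv : IsBddMeas fv) (lam : ℝ)
    (p : Fin N × Fin M) : IsBddMeas fun ω => spikeSignal lam fu fv ω p :=
  isBddMeas_spikeField hu hv lam _ _ p

theorem norm_sum_sub_card_mul_le {k : ℕ} {f : Fin k → ℂ} {z : ℂ} {D : ℝ}
    (h : ∀ i, ‖f i - z‖ ≤ D) : ‖∑ i, f i - k * z‖ ≤ k * D := by
  have : ∑ i, f i - k * z = ∑ i, (f i - z) := by simp [Finset.sum_sub_distrib]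
  rw [this]
  refine (norm_sum_le _ _).trans ((Finset.sum_le_sum fun i _ => h i).trans (by simp))

namespace IsSubcritical

/-- The averaged row cavity estimate. -/
theorem norm_left_right_sub_le (hs : IsSubcritical N M Ku Kv lam n ε θ)
    (hu : IsNormalizedCoord Pu fu Ku) (hv : IsNormalizedCoord Pv fv Kv) {q : ℂ} (hq : q.re = 1) :
    ‖obsAvg q (spikePrior Pu Pv N M) (spikeSignal lam fu fv)
        (fun ω : Fin 2 → (Fin N → ℝ) × (Fin M → ℝ) =>
          leftOverlap fu (ω 0) (ω 1) * rightOverlap fv (ω 0) (ω 1))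
      - N * (lam * obsAvg q (spikePrior Pu Pv N M) (spikeSignal lam fu fv)
        (fun ω : Fin 2 → (Fin N → ℝ) × (Fin M → ℝ) =>
          rightOverlap fv (ω 0) (ω 1) * rightOverlap fv (ω 0) (ω 1)))‖
    ≤ N * (lam ^ 2 * (cavityConst q Ku (overlapConst Kv ε θ) * Real.sqrt n ^ 3)) := by
  have hh := isBddMeas_spikeSignal (N := N) (M := M) hu.bdd hv.bdd lam
  have e : (fun ω : Fin 2 → (Fin N → ℝ) × (Fin M → ℝ) =>
      leftOverlap fu (ω 0) (ω 1) * rightOverlap fv (ω 0) (ω 1))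
      = fun ω => ∑ i, fu ((ω 0).1 i) * fu ((ω 1).1 i) * rightOverlap fv (ω 0) (ω 1) := by
    ext ω
    rw [leftOverlap, coordOverlap, Finset.sum_mul]
    simp
  rw [e, obsAvg_sum hq hh _ fun i => (isBddMeas_left_coord hu.bdd i).mul (isBddMeas_right hv.bdd)]
  exact norm_sum_sub_card_mul_le fun i => hs.row_cavity hu hv hq i

/-- The cost of restoring the erased coordinate in the column estimate: a bounded factor times a
single overlap. -/
theorem norm_left_mul_coord_le (hs : IsSubcritical N M Ku Kv lam n ε θ)
    (hu : IsNormalizedCoord Pu fu Ku) (hv : IsNormalizedCoord Pv fv Kv) {q : ℂ} (hq : q.re = 1)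
    (j : Fin M) :
    ‖obsAvg q (spikePrior Pu Pv N M) (spikeSignal lam fu fv)
        (fun ω : Fin 2 → (Fin N → ℝ) × (Fin M → ℝ) =>
          fv ((ω 0).2 j) * fv ((ω 1).2 j) * leftOverlap fu (ω 0) (ω 1))‖
    ≤ Kv ^ 2 * ((1 + overlapConst Kv ε θ) * Real.sqrt n) := by
  have hh := isBddMeas_spikeSignal (N := N) (M := M) hu.bdd hv.bdd lam
  have b1 := (isBddMeas_right_coord (N := N) hv.bdd j).mul (isBddMeas_left (M := M) hu.bdd)
  refine (norm_obsAvg_le hq hh b1).trans ?_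
  refine (plantedAvg_mono hh b1.abs ((IsBddMeas.const (Kv ^ 2)).mul (isBddMeas_left hu.bdd).abs)
    fun ω => ?_).trans ?_
  · rw [abs_mul, abs_mul, pow_two]
    have := hv.le ((ω 0).2 j)
    have := hv.le ((ω 1).2 j)
    have : 0 ≤ Kv := (abs_nonneg _).trans (hv.le 0)
    gcongr
  · rw [plantedAvg_const_mul hh]
    refine mul_le_mul_of_nonneg_left (plantedAvg_abs_le hh (isBddMeas_left hu.bdd)
      (Real.sqrt_pos.2 (one_pos.trans_le hs.n_ge)) ?_) (sq_nonneg _)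
    exact hs.left_cube_le hu hv (κ' := fun _ => 1) (by simp)

/-- The averaged column cavity estimate. -/
theorem norm_right_right_sub_le (hs : IsSubcritical N M Ku Kv lam n ε θ)
    (hu : IsNormalizedCoord Pu fu Ku) (hv : IsNormalizedCoord Pv fv Kv) {q : ℂ} (hq : q.re = 1) :
    ‖obsAvg q (spikePrior Pu Pv N M) (spikeSignal lam fu fv)
        (fun ω : Fin 2 → (Fin N → ℝ) × (Fin M → ℝ) =>
          rightOverlap fv (ω 0) (ω 1) * rightOverlap fv (ω 0) (ω 1))
      - M * (obsAvg q (spikePrior Pu Pv N M) (spikeSignal lam fu fv)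
          (fun _ : Fin 2 → (Fin N → ℝ) × (Fin M → ℝ) => 1)
        + lam * obsAvg q (spikePrior Pu Pv N M) (spikeSignal lam fu fv)
        (fun ω : Fin 2 → (Fin N → ℝ) × (Fin M → ℝ) =>
          leftOverlap fu (ω 0) (ω 1) * rightOverlap fv (ω 0) (ω 1)))‖
    ≤ M * (lam * (weightSum q 2 * (Kv ^ 2 * ((Kv ^ 4 + 1) *
        ((1 + overlapConst Kv ε θ) * Real.sqrt n))))
      + lam ^ 2 * (cavityConst q Kv (overlapConst Kv ε θ) * Real.sqrt n ^ 3)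
      + lam * (Kv ^ 2 * ((1 + overlapConst Kv ε θ) * Real.sqrt n))) := by
  have hh := isBddMeas_spikeSignal (N := N) (M := M) hu.bdd hv.bdd lam
  have bR := isBddMeas_right (N := N) (M := M) hv.bdd
  have bL := isBddMeas_left (N := N) (M := M) hu.bdd
  have bE := isBddMeas_rightErase (N := N) (M := M) hv.bdd
  have bc := isBddMeas_right_coord (N := N) (M := M) hv.bdd
  have e : (fun ω : Fin 2 → (Fin N → ℝ) × (Fin M → ℝ) =>
      rightOverlap fv (ω 0) (ω 1) * rightOverlap fv (ω 0) (ω 1))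
      = fun ω => ∑ j, fv ((ω 0).2 j) * fv ((ω 1).2 j) * rightOverlap fv (ω 0) (ω 1) := by
    ext ω
    rw [← Finset.sum_mul]
    congr 1
    simp [rightOverlap, coordOverlap]
  rw [e, obsAvg_sum hq hh _ fun j => (bc j).mul bR]
  refine norm_sum_sub_card_mul_le fun j => ?_
  have e1 : (fun ω : Fin 2 → (Fin N → ℝ) × (Fin M → ℝ) =>
      fv ((ω 0).2 j) * fv ((ω 1).2 j) * rightOverlap fv (ω 0) (ω 1))
      = fun ω => fv ((ω 0).2 j) ^ 2 * fv ((ω 1).2 j) ^ 2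
        + fv ((ω 0).2 j) * fv ((ω 1).2 j) * rightOverlapErase fv j (ω 0) (ω 1) := by
    ext ω
    rw [rightOverlap_eq_add fv j]; ring
  have bsq : IsBddMeas fun ω : Fin 2 → (Fin N → ℝ) × (Fin M → ℝ) =>
      fv ((ω 0).2 j) ^ 2 * fv ((ω 1).2 j) ^ 2 := by
    simpa only [mul_pow] using (bc j).pow 2
  have e2 : (fun ω : Fin 2 → (Fin N → ℝ) × (Fin M → ℝ) =>
      rightOverlapErase fv j (ω 0) (ω 1) * leftOverlap fu (ω 0) (ω 1))
      = fun ω => leftOverlap fu (ω 0) (ω 1) * rightOverlap fv (ω 0) (ω 1)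
        - fv ((ω 0).2 j) * fv ((ω 1).2 j) * leftOverlap fu (ω 0) (ω 1) := by
    ext ω
    rw [rightOverlap_eq_add fv j]; ring
  have h1 := hs.col_cavity_diag hu hv hq j
  have h2 := hs.col_cavity hu hv hq j
  have h3 := hs.norm_left_mul_coord_le hu hv hq j
  rw [e1, obsAvg_add hq hh bsq ((bc j).mul (bE j))]
  rw [e2, obsAvg_sub hq hh (bL.mul bR) ((bc j).mul bL)] at h2
  generalize obsAvg q (spikePrior Pu Pv N M) (spikeSignal lam fu fv)
    (fun ω : Fin 2 → (Fin N → ℝ) × (Fin M → ℝ) => fv ((ω 0).2 j) ^ 2 * fv ((ω 1).2 j) ^ 2) = A1 at *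
  generalize obsAvg q (spikePrior Pu Pv N M) (spikeSignal lam fu fv)
    (fun _ : Fin 2 → (Fin N → ℝ) × (Fin M → ℝ) => (1 : ℝ)) = A0 at *
  generalize obsAvg q (spikePrior Pu Pv N M) (spikeSignal lam fu fv)
    (fun ω : Fin 2 → (Fin N → ℝ) × (Fin M → ℝ) =>
      fv ((ω 0).2 j) * fv ((ω 1).2 j) * rightOverlapErase fv j (ω 0) (ω 1)) = A2 at *
  generalize obsAvg q (spikePrior Pu Pv N M) (spikeSignal lam fu fv)
    (fun ω : Fin 2 → (Fin N → ℝ) × (Fin M → ℝ) =>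
      leftOverlap fu (ω 0) (ω 1) * rightOverlap fv (ω 0) (ω 1)) = A3 at *
  generalize obsAvg q (spikePrior Pu Pv N M) (spikeSignal lam fu fv)
    (fun ω : Fin 2 → (Fin N → ℝ) × (Fin M → ℝ) =>
      fv ((ω 0).2 j) * fv ((ω 1).2 j) * leftOverlap fu (ω 0) (ω 1)) = A4 at *
  -- Diagonal cavity error, off-diagonal cavity error, and the cost of restoring the erased
  -- coordinate.
  have e3 : A1 + A2 - (A0 + lam * A3) = (A1 - A0) + (A2 - lam * (A3 - A4)) - lam * A4 := by ring
  rw [e3]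
  refine (norm_sub_le _ _).trans (add_le_add ((norm_add_le _ _).trans (add_le_add h1 h2)) ?_)
  rw [norm_mul, Complex.norm_real, Real.norm_eq_abs, abs_of_nonneg hs.lam_nonneg]
  exact mul_le_mul_of_nonneg_left h3 hs.lam_nonneg

theorem norm_left_right_le (hs : IsSubcritical N M Ku Kv lam n ε θ)
    (hu : IsNormalizedCoord Pu fu Ku) (hv : IsNormalizedCoord Pv fv Kv) {q : ℂ} (hq : q.re = 1) :
    ‖obsAvg q (spikePrior Pu Pv N M) (spikeSignal lam fu fv)
        (fun ω : Fin 2 → (Fin N → ℝ) × (Fin M → ℝ) =>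
          leftOverlap fu (ω 0) (ω 1) * rightOverlap fv (ω 0) (ω 1))‖
      ≤ overlapConst Kv ε θ * n := by
  have hn : 0 < n := one_pos.trans_le hs.n_ge
  have hr : 0 < Real.sqrt n := Real.sqrt_pos.2 hn
  have hh := isBddMeas_spikeSignal (N := N) (M := M) hu.bdd hv.bdd lam
  have bR := isBddMeas_right (N := N) (M := M) hv.bdd
  have bL := isBddMeas_left (N := N) (M := M) hu.bdd
  have h1 : 1 ≤ overlapConst Kv ε θ := by
    have h0 : 1 / 2 ≤ momentConst ε θ := by
      have := hs.ε_pos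
      have : 0 ≤ 6 / ε ^ 3 * (1 / Real.sqrt (1 - θ)) := by positivity
      unfold momentConst; linarith
    have : 0 ≤ Kv ^ 6 := by positivity
    unfold overlapConst; linarith
  -- The constant `√n` plays the third factor, so the third-moment bounds control the product of two
  -- overlaps; this requires the constant to be at least `1`.
  have key := plantedAvg_mul_mul_le (π := spikePrior Pu Pv N M) hh bL bR
    (IsBddMeas.const (Real.sqrt n)) (D := overlapConst Kv ε θ * Real.sqrt n ^ 3)
    (hs.left_cube_le hu hv (κ' := fun _ => 1) (by simp))
    (hs.right_cube_le hu hv (κ := fun _ => 1) (by simp))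
    (by
      rw [plantedAvg_const hh, abs_of_pos hr]
      exact le_mul_of_one_le_left (by positivity) h1)
  have e : (fun ω : Fin 2 → (Fin N → ℝ) × (Fin M → ℝ) => |leftOverlap fu (ω 0) (ω 1)| *
      |rightOverlap fv (ω 0) (ω 1)| * |Real.sqrt n|)
      = fun ω => Real.sqrt n * |leftOverlap fu (ω 0) (ω 1) * rightOverlap fv (ω 0) (ω 1)| := by
    ext ω; rw [abs_of_pos hr, abs_mul]; ring
  rw [e, plantedAvg_const_mul hh] at key
  refine (norm_obsAvg_le hq hh (bL.mul bR)).trans ?_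
  refine le_of_mul_le_mul_left (key.trans_eq ?_) hr
  have := Real.sq_sqrt hn.le
  calc _ = overlapConst Kv ε θ * (Real.sqrt n ^ 2) * Real.sqrt n := by ring
    _ = _ := by rw [this]; ring

end IsSubcritical

theorem norm_obsAvg_one_le {Ω ι : Type*} [MeasurableSpace Ω] [Fintype ι] {π : Measure Ω}
    [IsProbabilityMeasure π] {h : Ω → ι → ℝ} (hh : ∀ i, IsBddMeas fun ω => h ω i) {q : ℂ}
    (hq : q.re = 1) (k : ℕ) : ‖obsAvg q π h (fun _ : Fin k → Ω => 1)‖ ≤ 1 := by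
  refine (norm_obsAvg_le hq hh (IsBddMeas.const 1)).trans (le_of_eq ?_)
  simpa using plantedAvg_const (π := π) hh (n := k) 1

/-- The constant in the approximate fixed-point equation for the overlap. -/
noncomputable def fixedPointConst (q : ℂ) (Ku Kv ε θ β A C : ℝ) : ℝ :=
  β ^ 2 * cavityConst q Ku (overlapConst Kv ε θ)
    + β * (A * (β * (weightSum q 2 * (Kv ^ 2 * ((Kv ^ 4 + 1) * (1 + overlapConst Kv ε θ))))
      + β ^ 2 * cavityConst q Kv (overlapConst Kv ε θ)
      + β * (Kv ^ 2 * (1 + overlapConst Kv ε θ))))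
    + β * (C * (1 + β * overlapConst Kv ε θ))

theorem cavityConst_nonneg (q : ℂ) {L c : ℝ} (hc : 0 ≤ c) : 0 ≤ cavityConst q L c := by
  have := weightSum_nonneg q 2
  have := weightSum_nonneg q 4
  unfold cavityConst; positivity

/-- The mean overlap product solves its limiting fixed-point equation up to `O(1 / √N)`. -/
theorem IsSubcritical.norm_fixedPoint_le {b β α A C : ℝ} (hN : 1 ≤ N)
    (hs : IsSubcritical N M Ku Kv (b / N) N ε θ)
    (hu : IsNormalizedCoord Pu fu Ku) (hv : IsNormalizedCoord Pv fv Kv) {q : ℂ} (hq : q.re = 1)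
    (hb : 0 ≤ b) (hbβ : b ≤ β) (hA : (M : ℝ) / N ≤ A)
    (hM : |(M : ℝ) / N - α| ≤ C / Real.sqrt N) :
    ‖(1 - α * b ^ 2) * (obsAvg q (spikePrior Pu Pv N M) (spikeSignal (b / N) fu fv)
        (fun ω : Fin 2 → (Fin N → ℝ) × (Fin M → ℝ) =>
          leftOverlap fu (ω 0) (ω 1) * rightOverlap fv (ω 0) (ω 1)) / N)
      - α * b * obsAvg q (spikePrior Pu Pv N M) (spikeSignal (b / N) fu fv)
          (fun _ : Fin 2 → (Fin N → ℝ) × (Fin M → ℝ) => 1)‖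
    ≤ fixedPointConst q Ku Kv ε θ β A C / Real.sqrt N := by
  have h1 := hs.norm_left_right_sub_le hu hv hq
  have h2 := hs.norm_right_right_sub_le hu hv hq
  have h3 := hs.norm_left_right_le hu hv hq
  have h4 := norm_obsAvg_one_le (π := spikePrior Pu Pv N M)
    (isBddMeas_spikeSignal (N := N) (M := M) hu.bdd hv.bdd (b / N)) hq 2
  have hc0 : 0 ≤ overlapConst Kv ε θ := overlapConst_nonneg Kv hs.ε_pos
  have hC1 := cavityConst_nonneg q (L := Ku) hc0
  have hC2 := cavityConst_nonneg q (L := Kv) hc0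
  have hW := weightSum_nonneg q 2
  unfold fixedPointConst
  generalize obsAvg q (spikePrior Pu Pv N M) (spikeSignal (b / N) fu fv)
    (fun _ : Fin 2 → (Fin N → ℝ) × (Fin M → ℝ) => (1 : ℝ)) = φ at *
  generalize obsAvg q (spikePrior Pu Pv N M) (spikeSignal (b / N) fu fv)
    (fun ω : Fin 2 → (Fin N → ℝ) × (Fin M → ℝ) =>
      leftOverlap fu (ω 0) (ω 1) * rightOverlap fv (ω 0) (ω 1)) = X at *
  generalize obsAvg q (spikePrior Pu Pv N M) (spikeSignal (b / N) fu fv)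
    (fun ω : Fin 2 → (Fin N → ℝ) × (Fin M → ℝ) =>
      rightOverlap fv (ω 0) (ω 1) * rightOverlap fv (ω 0) (ω 1)) = V at *
  generalize overlapConst Kv ε θ = c at *
  generalize cavityConst q Ku c = C1 at *
  generalize cavityConst q Kv c = C2 at *
  generalize weightSum q 2 = W at *
  have hNpos : (0 : ℝ) < N := by exact_mod_cast hN
  have hr : 0 < Real.sqrt N := Real.sqrt_pos.2 hNpos
  have hr2 : Real.sqrt N ^ 2 = N := Real.sq_sqrt hNpos.le
  have hNc : (N : ℂ) ≠ 0 := by exact_mod_cast hNpos.ne'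
  set r := Real.sqrt N with hrdef
  have hNr : (N : ℝ) = r ^ 2 := hr2.symm
  -- the two cavity estimates, divided by `N`
  have k1 : ‖X / N - b * (V / N)‖ ≤ b ^ 2 * C1 / r := by
    have e : X / N - b * (V / N) = (X - N * (((b / N : ℝ) : ℂ) * V)) / N := by
      push_cast; field_simp
    rw [e, norm_div, Complex.norm_natCast, div_le_iff₀ hNpos]
    refine h1.trans (le_of_eq ?_)
    rw [hNr]; field_simp
  have k2 : ‖V / N - ((M / N : ℝ) : ℂ) * (φ + b * (X / N))‖
      ≤ (M : ℝ) / N * (b * (W * (Kv ^ 2 * ((Kv ^ 4 + 1) * (1 + c)))) + b ^ 2 * C2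
        + b * (Kv ^ 2 * (1 + c))) / r := by
    have e : V / N - ((M / N : ℝ) : ℂ) * (φ + b * (X / N))
        = (V - M * (φ + ((b / N : ℝ) : ℂ) * X)) / N := by
      push_cast; field_simp
    rw [e, norm_div, Complex.norm_natCast, div_le_iff₀ hNpos]
    refine h2.trans (le_of_eq ?_)
    rw [hNr]; field_simp
  have k3 : ‖X / N‖ ≤ c := by
    rw [norm_div, Complex.norm_natCast, div_le_iff₀ hNpos]; exact h3
  have hβ : 0 ≤ β := hb.trans hbβ
  have hC : 0 ≤ C := by
    have := (abs_nonneg _).trans hM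
    rw [le_div_iff₀ hr, zero_mul] at this
    exact this
  have hMN : 0 ≤ (M : ℝ) / N := by positivity
  have hT : 0 ≤ b * (W * (Kv ^ 2 * ((Kv ^ 4 + 1) * (1 + c)))) + b ^ 2 * C2
      + b * (Kv ^ 2 * (1 + c)) := by positivity
  -- An exact identity: row error, plus `b` times the column error, plus the error from replacing `M
  -- / N` by `α`.
  have e : (1 - α * b ^ 2) * (X / N) - α * b * φ
      = (X / N - b * (V / N)) + b * (V / N - ((M / N : ℝ) : ℂ) * (φ + b * (X / N)))
        + b * ((((M : ℝ) / N - α : ℝ) : ℂ) * (φ + b * (X / N))) := by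
    push_cast; ring
  rw [e]
  have n4 : ‖φ + b * (X / N)‖ ≤ 1 + β * c := by
    refine (norm_add_le _ _).trans (add_le_add h4 ?_)
    rw [norm_mul, Complex.norm_real, Real.norm_eq_abs, abs_of_nonneg hb]
    exact mul_le_mul hbβ k3 (norm_nonneg _) hβ
  have nb : ‖(b : ℂ)‖ = b := by rw [Complex.norm_real, Real.norm_eq_abs, abs_of_nonneg hb]
  calc _ ≤ b ^ 2 * C1 / r + b * ((M : ℝ) / N * (b * (W * (Kv ^ 2 * ((Kv ^ 4 + 1) * (1 + c))))
          + b ^ 2 * C2 + b * (Kv ^ 2 * (1 + c))) / r) + b * (C / r * (1 + β * c)) := by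
        refine (norm_add_le _ _).trans (add_le_add ((norm_add_le _ _).trans
          (add_le_add k1 ?_)) ?_)
        · rw [norm_mul, nb]
          exact mul_le_mul_of_nonneg_left k2 hb
        · rw [norm_mul, nb, norm_mul, Complex.norm_real, Real.norm_eq_abs]
          refine mul_le_mul_of_nonneg_left (mul_le_mul hM n4 (norm_nonneg _) (by positivity)) hb
    _ = (b ^ 2 * C1 + b * ((M : ℝ) / N * (b * (W * (Kv ^ 2 * ((Kv ^ 4 + 1) * (1 + c))))
          + b ^ 2 * C2 + b * (Kv ^ 2 * (1 + c)))) + b * (C * (1 + β * c))) / r := by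
        field_simp
    _ ≤ _ := by
        have hA0 : 0 ≤ A := hMN.trans hA
        gcongr

end OverlapEquation

/-! ### The limiting differential equation. -/

section LimitingEquation

/-- A perturbed linear equation whose exact solution is `exp (-(c / 4) log (1 - α τ ^ 4))`. -/
theorem norm_sub_exp_log_le {Φ X : ℝ → ℂ} {c : ℂ} {α T E : ℝ} (hc : c.re ≤ 0) (hα : 0 ≤ α)
    (hT : 0 ≤ T) (hlt : α * T ^ 4 < 1) (h0 : Φ 0 = 1)
    (hΦ : ∀ τ ∈ Set.Icc 0 T, HasDerivAt Φ (τ * (c * X τ)) τ)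
    (hE : ∀ τ ∈ Set.Icc 0 T, ‖(1 - α * (τ : ℂ) ^ 4) * X τ - α * τ ^ 2 * Φ τ‖ ≤ E) :
    ‖Φ T - Complex.exp (c * (-(1 / 4) * Real.log (1 - α * T ^ 4) : ℝ))‖
      ≤ Real.exp (-c.re * (-(1 / 4) * Real.log (1 - α * T ^ 4)))
        * (T / (1 - α * T ^ 4) * ‖c‖ * E) * T := by
  set ψ : ℝ → ℝ := fun τ => -(1 / 4) * Real.log (1 - α * τ ^ 4) with hψ
  have h1T : 0 < 1 - α * T ^ 4 := by linarith
  have hτ : ∀ τ ∈ Set.Icc 0 T, 1 - α * T ^ 4 ≤ 1 - α * τ ^ 4 := fun τ h => by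
    have : τ ^ 4 ≤ T ^ 4 := pow_le_pow_left₀ h.1 h.2 4
    nlinarith
  have hpos : ∀ τ ∈ Set.Icc 0 T, 0 < 1 - α * τ ^ 4 := fun τ h => h1T.trans_le (hτ τ h)
  have hψle : ∀ τ ∈ Set.Icc 0 T, ψ τ ≤ ψ T := fun τ h => by
    have := Real.log_le_log h1T (hτ τ h)
    simp only [hψ]; linarith
  have hψT : 0 ≤ ψ T := by
    have := hψle 0 ⟨le_rfl, hT⟩
    simpa [hψ] using this
  have hdψ : ∀ τ ∈ Set.Icc 0 T, HasDerivAt ψ (α * τ ^ 3 / (1 - α * τ ^ 4)) τ := fun τ h => by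
    have := ((((hasDerivAt_pow 4 τ).const_mul α).const_sub 1).log (hpos τ h).ne').const_mul
      (-(1 / 4) : ℝ)
    refine this.congr_deriv ?_
    push_cast; ring
  -- Integrating factor: with `ψ' = α τ³ / (1 - α τ⁴)`, the derivative of `Y` contains only the
  -- defect of the linear relation between `X` and `Φ`.
  set Y : ℝ → ℂ := fun τ => Complex.exp (-c * (ψ τ : ℂ)) * Φ τ with hY
  have hdY : ∀ τ ∈ Set.Icc 0 T, HasDerivAt Y (Complex.exp (-c * (ψ τ : ℂ)) *
      (τ / ((1 - α * τ ^ 4 : ℝ) : ℂ) * c *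
        ((1 - α * (τ : ℂ) ^ 4) * X τ - α * τ ^ 2 * Φ τ))) τ := fun τ h => by
    have := ((((hdψ τ h).ofReal_comp).const_mul (-c)).cexp).mul (hΦ τ h)
    refine this.congr_deriv ?_
    have hne : ((1 - α * τ ^ 4 : ℝ) : ℂ) ≠ 0 := by exact_mod_cast (hpos τ h).ne'
    push_cast at hne ⊢
    field_simp
    ring
  have hbd : ∀ τ ∈ Set.Icc 0 T, ‖Complex.exp (-c * (ψ τ : ℂ)) *
      (τ / ((1 - α * τ ^ 4 : ℝ) : ℂ) * c *
        ((1 - α * (τ : ℂ) ^ 4) * X τ - α * τ ^ 2 * Φ τ))‖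
      ≤ Real.exp (-c.re * ψ T) * (T / (1 - α * T ^ 4) * ‖c‖ * E) := fun τ h => by
    have hE' := hE τ h
    have hE0 := (norm_nonneg _).trans hE'
    rw [norm_mul, norm_mul, norm_mul, norm_div, Complex.norm_real, Complex.norm_real,
      Real.norm_of_nonneg h.1, Real.norm_of_nonneg (hpos τ h).le, Complex.norm_exp]
    have e : (-c * (ψ τ : ℂ)).re = -c.re * ψ τ := by simp
    rw [e]
    have h2 := h.2
    have h3 := hτ τ h
    have h4 := hψle τ h
    have h5 : 0 ≤ -c.re := by linarith
    have h6 := h.1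
    have h7 := hpos τ h
    gcongr
  have key := (convex_Icc 0 T).norm_image_sub_le_of_norm_hasDerivWithin_le
    (fun τ h => (hdY τ h).hasDerivWithinAt) hbd (Set.left_mem_Icc.2 hT) (Set.right_mem_Icc.2 hT)
  have hY0 : Y 0 = 1 := by simp [hY, hψ, h0]
  rw [hY0, sub_zero, Real.norm_of_nonneg hT] at key
  have e : Φ T - Complex.exp (c * (ψ T : ℝ)) = Complex.exp (c * (ψ T : ℝ)) * (Y T - 1) := by
    rw [mul_sub, mul_one, hY]
    simp only
    rw [← mul_assoc, ← Complex.exp_add]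
    simp
  change ‖Φ T - Complex.exp (c * (ψ T : ℝ))‖ ≤ _
  rw [e, norm_mul, Complex.norm_exp]
  have e2 : (c * (ψ T : ℂ)).re = c.re * ψ T := by simp
  rw [e2]
  -- `Re c ≤ 0` and `ψ T ≥ 0`, so undoing the integrating factor costs nothing.
  have : Real.exp (c.re * ψ T) ≤ 1 := Real.exp_le_one_iff.2 (mul_nonpos_of_nonpos_of_nonneg hc hψT)
  exact (mul_le_of_le_one_left (norm_nonneg _) this).trans key

variable {N M : ℕ} {Pu Pv : Measure ℝ} {fu fv : ℝ → ℝ} {Ku Kv ε θ : ℝ}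

/-- Using the amplitude `τ`, the square root of the signal strength, makes the path affine, hence
differentiable at the origin too. -/
theorem pathField_zero_eq_spikeSignal {τ : ℝ} (hτ : 0 ≤ τ) :
    pathField 0 (fun (ω : (Fin N → ℝ) × (Fin M → ℝ)) (p : Fin N × Fin M) =>
      (Real.sqrt N)⁻¹ * (fu (ω.1 p.1) * fv (ω.2 p.2))) τ = spikeSignal (τ ^ 2 / N) fu fv := by
  ext ω p
  rw [pathField, spikeSignal, spikeField, Real.sqrt_div (sq_nonneg τ), Real.sqrt_sq hτ]
  simp only [Pi.zero_apply]
  ring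

theorem obsAvg_zero {Ω ι : Type*} [MeasurableSpace Ω] [Fintype ι] {π : Measure Ω}
    [IsProbabilityMeasure π] (q : ℂ) (b : Ω → ι → ℝ) :
    obsAvg q π (pathField 0 b 0) (fun _ : Fin 0 → Ω => 1) = 1 := by
  have : pathField 0 b 0 = 0 := by ext; simp [pathField]
  rw [this]
  simp [obsAvg, weightedAvg, energy, partFn, gibbsAvg]

/-- Starting from no replica, the only distinct pair has weights `q` and `q - 1`; both spikes then
contract into the product of overlaps. -/
theorem hasDerivAt_obsAvg_spikeSignal [IsProbabilityMeasure Pu] [IsProbabilityMeasure Pv]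
    (hN : 1 ≤ N) (hu : IsBddMeas fu) (hv : IsBddMeas fv) {q : ℂ} (hq : q.re = 1) {τ : ℝ}
    (hτ : 0 ≤ τ) :
    HasDerivAt (fun τ => obsAvg q (spikePrior Pu Pv N M) (pathField 0
        (fun (ω : (Fin N → ℝ) × (Fin M → ℝ)) (p : Fin N × Fin M) =>
          (Real.sqrt N)⁻¹ * (fu (ω.1 p.1) * fv (ω.2 p.2))) τ)
        (fun _ : Fin 0 → (Fin N → ℝ) × (Fin M → ℝ) => 1))
      (τ * (q * (q - 1) * (obsAvg q (spikePrior Pu Pv N M) (spikeSignal (τ ^ 2 / N) fu fv)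
        (fun ω : Fin 2 → (Fin N → ℝ) × (Fin M → ℝ) =>
          leftOverlap fu (ω 0) (ω 1) * rightOverlap fv (ω 0) (ω 1)) / N))) τ := by
  have hb : ∀ p : Fin N × Fin M, IsBddMeas fun ω : (Fin N → ℝ) × (Fin M → ℝ) =>
      (Real.sqrt N)⁻¹ * (fu (ω.1 p.1) * fv (ω.2 p.2)) := fun p =>
    (IsBddMeas.const _).mul ((hu.comp (by fun_prop)).mul (hv.comp (by fun_prop)))
  have key := hasDerivAt_obsAvg (π := spikePrior Pu Pv N M) hq (a := 0)
    (fun p => IsBddMeas.const 0) hb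
    (F := fun _ : Fin 0 → (Fin N → ℝ) × (Fin M → ℝ) => 1) (IsBddMeas.const 1) τ
  refine key.congr_deriv ?_
  rw [pathField_zero_eq_spikeSignal hτ]
  have hNpos : (0 : ℝ) < N := by exact_mod_cast hN
  have e : (fun ω : Fin 2 → (Fin N → ℝ) × (Fin M → ℝ) => (1 : ℝ) *
      ∑ p : Fin N × Fin M, (Real.sqrt N)⁻¹ * (fu ((ω 0).1 p.1) * fv ((ω 0).2 p.2)) *
        spikeSignal (τ ^ 2 / N) fu fv (ω 1) p)
      = fun ω => τ / N * (leftOverlap fu (ω 0) (ω 1) * rightOverlap fv (ω 0) (ω 1)) := by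
    ext ω
    rw [leftOverlap, rightOverlap, coordOverlap, coordOverlap, Finset.sum_mul_sum,
      ← Finset.sum_product', one_mul, Finset.mul_sum, Finset.univ_product_univ]
    refine Finset.sum_congr rfl fun p _ => ?_
    rw [spikeSignal, spikeField, Real.sqrt_div (sq_nonneg τ), Real.sqrt_sq hτ]
    have := Real.mul_self_sqrt hNpos.le
    have h2 : (Real.sqrt N)⁻¹ * (τ / Real.sqrt N) = τ / N := by
      rw [← this]; field_simp; simp
    rw [← h2]; ring
  rw [Fin.sum_univ_one, Fin.sum_univ_two]
  have x0 : ((0 : Fin 1).castSucc : Fin 2) = 0 := rfl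
  simp only [x0, if_true, zero_add, one_ne_zero, if_false]
  rw [e, obsAvg_const_mul]
  simp [replicaWeight]
  field_simp

/-- The constant in the Gaussian approximation. -/
noncomputable def charFunConst (q : ℂ) (Ku Kv ε θ α β A C : ℝ) : ℝ :=
  Real.exp (-(q * (q - 1)).re * (-(1 / 4) * Real.log (1 - α * β ^ 2)))
    * (Real.sqrt β / (1 - α * β ^ 2) * ‖q * (q - 1)‖ * fixedPointConst q Ku Kv ε θ β A C)
    * Real.sqrt β

theorem norm_obsAvg_sub_exp_le {α β A C : ℝ} (hN : 1 ≤ N) (hα : 0 ≤ α) (hβ : 0 ≤ β)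
    (hlt : α * β ^ 2 < 1) (hs : ∀ b, 0 ≤ b → b ≤ β → IsSubcritical N M Ku Kv (b / N) N ε θ)
    (hu : IsNormalizedCoord Pu fu Ku) (hv : IsNormalizedCoord Pv fv Kv) {q : ℂ} (hq : q.re = 1)
    (hq1 : (q * (q - 1)).re ≤ 0) (hA : (M : ℝ) / N ≤ A)
    (hM : |(M : ℝ) / N - α| ≤ C / Real.sqrt N) :
    ‖obsAvg q (spikePrior Pu Pv N M) (spikeSignal (β / N) fu fv)
        (fun _ : Fin 0 → (Fin N → ℝ) × (Fin M → ℝ) => 1)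
      - Complex.exp (q * (q - 1) * (-(1 / 4) * Real.log (1 - α * β ^ 2) : ℝ))‖
      ≤ charFunConst q Ku Kv ε θ α β A C / Real.sqrt N := by
  have := hu.prob
  have := hv.prob
  have hT := Real.sqrt_nonneg β
  have hT2 : Real.sqrt β ^ 2 = β := Real.sq_sqrt hβ
  have hT4 : Real.sqrt β ^ 4 = β ^ 2 := by rw [← hT2]; ring_nf; rw [hT2]
  have key := norm_sub_exp_log_le (T := Real.sqrt β) (α := α) hq1 hα hT (by rwa [hT4])
    (obsAvg_zero (π := spikePrior Pu Pv N M) q _)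
    (fun τ hτ => hasDerivAt_obsAvg_spikeSignal (M := M) hN hu.bdd hv.bdd hq hτ.1)
    (E := fixedPointConst q Ku Kv ε θ β A C / Real.sqrt N) (fun τ hτ => by
      have hb : τ ^ 2 ≤ β := by rw [← hT2]; exact pow_le_pow_left₀ hτ.1 hτ.2 2
      have h1 := (hs _ (sq_nonneg τ) hb).norm_fixedPoint_le hN hu hv hq (sq_nonneg τ) hb hA hM
      rw [pathField_zero_eq_spikeSignal hτ.1]
      -- The fixed-point equation averages the constant `1` over two replicas, the path over none;
      -- the values agree.
      have e := obsAvg_comp (π := spikePrior Pu Pv N M) q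
        (isBddMeas_spikeSignal (N := N) (M := M) hu.bdd hv.bdd (τ ^ 2 / N)) (n := 2)
        (e := (Fin.elim0 : Fin 0 → Fin 2)) (fun x => x.elim0)
        (F := fun _ : Fin 0 → (Fin N → ℝ) × (Fin M → ℝ) => 1) measurable_const
      rw [e] at h1
      have e4 : (τ : ℂ) ^ 4 = ((τ : ℂ) ^ 2) ^ 2 := by ring
      rw [e4]
      push_cast at h1
      exact h1)
  rw [pathField_zero_eq_spikeSignal hT, hT2, hT4] at key
  refine key.trans (le_of_eq ?_)
  rw [charFunConst]
  ring

end LimitingEquation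

/-! ### Clipping the prior to its support. -/

section ClippedPrior

/-- Projection onto `[-K, K]`. -/
def clip (K x : ℝ) : ℝ := max (-K) (min K x)

theorem clip_eq_self {K x : ℝ} (h : |x| ≤ K) : clip K x = x := by
  rw [clip, min_eq_right (abs_le.1 h).2, max_eq_right (abs_le.1 h).1]

theorem IsBoundedPrior.nonneg {P : Measure ℝ} {K : ℝ} (h : IsBoundedPrior P K) : 0 ≤ K := by
  have := h.isProbabilityMeasure
  obtain ⟨x, hx⟩ := h.bounded_support.exists
  exact (abs_nonneg x).trans hx

theorem IsBoundedPrior.clip_ae_eq {P : Measure ℝ} {K : ℝ} (h : IsBoundedPrior P K) :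
    ∀ᵐ x ∂P, clip K x = x := by
  filter_upwards [h.bounded_support] with x hx using clip_eq_self hx

theorem IsBoundedPrior.integral_sq {P : Measure ℝ} {K : ℝ} (h : IsBoundedPrior P K) :
    ∫ x, x ^ 2 ∂P = 1 := by
  have := h.isProbabilityMeasure
  have h1 := variance_of_integral_eq_zero (X := (id : ℝ → ℝ)) (μ := P) aemeasurable_id h.mean_zero
  rw [h.unit_variance] at h1
  exact h1.symm

/-- Unit variance forces `K ≥ 1`, so the hypothesis on `α β² Ku⁴ Kv⁴` also yields `α β² < 1`. -/
theorem IsBoundedPrior.one_le {P : Measure ℝ} {K : ℝ} (h : IsBoundedPrior P K) : 1 ≤ K := by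
  have := h.isProbabilityMeasure
  have h1 : ∫ x, x ^ 2 ∂P ≤ ∫ _, K ^ 2 ∂P := by
    refine integral_mono_of_nonneg (ae_of_all _ fun x => sq_nonneg x) (integrable_const _) ?_
    filter_upwards [h.bounded_support] with x hx
    exact sq_le_sq' (abs_le.1 hx).1 (abs_le.1 hx).2
  rw [h.integral_sq] at h1
  simp only [integral_const, probReal_univ, one_smul] at h1
  exact (one_le_sq_iff₀ h.nonneg).1 h1

/-- Clipping alters coordinates on a null set only, and makes signals bounded everywhere rather than
almost everywhere. -/
theorem IsBoundedPrior.isNormalizedCoord {P : Measure ℝ} {K : ℝ} (h : IsBoundedPrior P K) :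
    IsNormalizedCoord P (clip K) K where
  prob := h.isProbabilityMeasure
  meas := by unfold clip; fun_prop
  le x := by
    have := h.nonneg
    rw [clip, abs_le]
    exact ⟨le_max_left _ _, max_le (by linarith) (min_le_left _ _)⟩
  mean := by
    rw [← h.mean_zero]
    exact integral_congr_ae h.clip_ae_eq
  second := by
    rw [← h.integral_sq]
    refine integral_congr_ae ?_
    filter_upwards [h.clip_ae_eq] with x hx
    rw [hx]

end ClippedPrior

/-! ### The Gaussian shift and the matrix noise. -/

section GaussianShift

theorem tilted_gaussianReal_one (m : ℝ) :
    (gaussianReal 0 1).tilted (fun x => x * m - m ^ 2 / 2)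
      = (gaussianReal 0 1).map (fun x => m + x) := by
  have h1 : ∫ x, Real.exp (x * m - m ^ 2 / 2) ∂(gaussianReal 0 1) = 1 := by
    have := congrFun (mgf_id_gaussianReal (μ := 0) (v := 1)) m
    simp only [mgf, id, zero_mul, NNReal.coe_one, one_mul, zero_add] at this
    simp_rw [Real.exp_sub, mul_comm _ m, integral_div, this]
    exact div_self (Real.exp_pos _).ne'
  rw [gaussianReal_map_const_add, Measure.tilted, h1, gaussianReal_of_var_ne_zero _ one_ne_zero,
    gaussianReal_of_var_ne_zero _ one_ne_zero, ← withDensity_mul _ (by fun_prop) (by fun_prop)]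
  congr 1
  ext x
  simp only [Pi.mul_apply, gaussianPDF, gaussianPDFReal]
  rw [← ENNReal.ofReal_mul (by positivity), div_one, mul_assoc, ← Real.exp_add]
  congr 4
  simp only [NNReal.coe_one]
  ring

/-- The Gaussian shift, with its density. -/
theorem stdGauss_map_add {ι : Type*} [Fintype ι] (x : ι → ℝ) :
    (stdGauss ι).map (fun y => x + y)
      = (stdGauss ι).withDensity (fun y => ENNReal.ofReal (Real.exp (energy x y))) := by
  have h1 : (stdGauss ι).map (fun y => x + y)
      = Measure.pi fun i => (gaussianReal 0 1).map (fun t => x i + t) := by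
    have := Measure.pi_map_pi (μ := fun _ : ι => gaussianReal 0 1) (f := fun i t => x i + t)
      (fun i => by fun_prop)
    exact this
  have hi : ∀ i, Integrable (fun t => Real.exp (t * x i - x i ^ 2 / 2)) (gaussianReal 0 1) :=
    fun i => by
      simp_rw [Real.exp_sub, mul_comm _ (x i)]
      exact (integrable_exp_mul_gaussianReal (x i)).div_const _
  rw [h1]
  simp_rw [← tilted_gaussianReal_one]
  rw [pi_tilted _ hi, Measure.tilted]
  have e : ∫ y, Real.exp (∑ i, (y i * x i - x i ^ 2 / 2))
      ∂(Measure.pi fun _ : ι => gaussianReal 0 1) = 1 := integral_exp_energy x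
  simp_rw [e, div_one]
  rfl

theorem measurePreserving_curry_stdGauss (N M : ℕ) :
    MeasurePreserving (MeasurableEquiv.curry (Fin N) (Fin M) ℝ) (stdGauss (Fin N × Fin M))
      (noiseLaw N M) where
  measurable := by fun_prop
  map_eq := by
    have := Measure.infinitePi_map_curry (fun (_ : Fin N) (_ : Fin M) => gaussianReal 0 1)
    simp_rw [Measure.infinitePi_eq_pi] at this
    exact this

instance (N M : ℕ) : IsProbabilityMeasure (noiseLaw N M) := by
  unfold noiseLaw; infer_instance

end GaussianShift

/-! ### The likelihood ratio as a partition function. -/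

section LikelihoodRatio

variable {Pu Pv : Measure ℝ} {N M : ℕ} {Ku Kv : ℝ}

/-- The partition function of the rank-one signal, as a function of the observed matrix. -/
noncomputable def spikePartFn (Pu Pv : Measure ℝ) (lam : ℝ) (fu fv : ℝ → ℝ)
    (Y : Fin N → Fin M → ℝ) : ℝ :=
  partFn (spikePrior Pu Pv N M) fun ω => energy (spikeSignal lam fu fv ω) fun p => Y p.1 p.2

theorem ae_spikeSignal_clip (hu : IsBoundedPrior Pu Ku) (hv : IsBoundedPrior Pv Kv) (lam : ℝ) :
    ∀ᵐ ω ∂(spikePrior Pu Pv N M), ∀ p : Fin N × Fin M,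
      spikeSignal lam (clip Ku) (clip Kv) ω p = Real.sqrt lam * (ω.1 p.1 * ω.2 p.2) := by
  have := hu.isProbabilityMeasure
  have := hv.isProbabilityMeasure
  have h1 : ∀ i, ∀ᵐ ω ∂(spikePrior Pu Pv N M), clip Ku (ω.1 i) = ω.1 i := fun i =>
    ((measurePreserving_eval (fun _ : Fin N => Pu) i).comp
      (measurePreserving_fst (μ := Measure.pi fun _ : Fin N => Pu)
        (ν := Measure.pi fun _ : Fin M => Pv))).quasiMeasurePreserving.ae hu.clip_ae_eq
  have h2 : ∀ j, ∀ᵐ ω ∂(spikePrior Pu Pv N M), clip Kv (ω.2 j) = ω.2 j := fun j =>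
    ((measurePreserving_eval (fun _ : Fin M => Pv) j).comp
      (measurePreserving_snd (μ := Measure.pi fun _ : Fin N => Pu)
        (ν := Measure.pi fun _ : Fin M => Pv))).quasiMeasurePreserving.ae hv.clip_ae_eq
  filter_upwards [ae_all_iff.2 h1, ae_all_iff.2 h2] with ω g1 g2 p
  rw [spikeSignal, spikeField, g1, g2, one_mul, one_mul]

theorem measurable_spikePartFn [IsProbabilityMeasure Pu] [IsProbabilityMeasure Pv] {lam : ℝ}
    {fu fv : ℝ → ℝ} (hu : IsBddMeas fu) (hv : IsBddMeas fv) :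
    Measurable (spikePartFn (N := N) (M := M) Pu Pv lam fu fv) :=
  (measurable_partFn (π := spikePrior Pu Pv N M) (isBddMeas_spikeSignal hu hv lam)).comp
    (by fun_prop)

theorem spikePartFn_pos [IsProbabilityMeasure Pu] [IsProbabilityMeasure Pv] {lam : ℝ}
    {fu fv : ℝ → ℝ} (hu : IsBddMeas fu) (hv : IsBddMeas fv) (Y : Fin N → Fin M → ℝ) :
    0 < spikePartFn Pu Pv lam fu fv Y :=
  partFn_pos (integrable_exp_energy (isBddMeas_spikeSignal hu hv lam) _)

theorem noiseLaw_shift (X : Fin N → Fin M → ℝ) {s : Set (Fin N → Fin M → ℝ)}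
    (hs : MeasurableSet s) :
    noiseLaw N M {W | X + W ∈ s} = ∫⁻ Y in s, ENNReal.ofReal
      (Real.exp (energy (fun p : Fin N × Fin M => X p.1 p.2) fun p => Y p.1 p.2))
        ∂(noiseLaw N M) := by
  have mp := measurePreserving_curry_stdGauss N M
  have hX : MeasurableSet {W | X + W ∈ s} := by
    have : Measurable fun W : Fin N → Fin M → ℝ => X + W := by fun_prop
    exact this hs
  rw [← mp.measure_preimage hX.nullMeasurableSet, ← mp.setLIntegral_comp_preimage hs (by
    unfold energy; fun_prop)]
  have h := congrArg (fun ν => ν (MeasurableEquiv.curry (Fin N) (Fin M) ℝ ⁻¹' s))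
    (stdGauss_map_add (fun p : Fin N × Fin M => X p.1 p.2))
  rw [Measure.map_apply (by fun_prop) (mp.measurable hs),
    withDensity_apply _ (mp.measurable hs)] at h
  exact h

/-- Given the spikes, the observation is shifted noise with an explicit density; Tonelli averages
that density over the prior. -/
theorem spikedLaw_eq_withDensity (hu : IsBoundedPrior Pu Ku) (hv : IsBoundedPrior Pv Kv) (β : ℝ) :
    spikedLaw Pu Pv N M β = (noiseLaw N M).withDensity fun Y =>
      ENNReal.ofReal (spikePartFn Pu Pv (β / N) (clip Ku) (clip Kv) Y) := by
  have := hu.isProbabilityMeasure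
  have := hv.isProbabilityMeasure
  have cu := hu.isNormalizedCoord.bdd
  have cv := hv.isNormalizedCoord.bdd
  have hsig := isBddMeas_spikeSignal (N := N) (M := M) cu cv (β / N)
  have hm : Measurable fun p : ((Fin N → ℝ) × (Fin M → ℝ)) × (Fin N → Fin M → ℝ) =>
      spikedMatrix β p.1.1 p.1.2 p.2 := by
    unfold spikedMatrix; fun_prop
  ext s hs
  rw [spikedLaw, Measure.map_apply hm hs, Measure.prod_apply (hm hs), withDensity_apply _ hs]
  have h1 : ∀ᵐ ω ∂(spikePrior Pu Pv N M),
      noiseLaw N M (Prod.mk ω ⁻¹' ((fun p : ((Fin N → ℝ) × (Fin M → ℝ)) × (Fin N → Fin M → ℝ) =>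
        spikedMatrix β p.1.1 p.1.2 p.2) ⁻¹' s))
      = ∫⁻ Y in s, ENNReal.ofReal (Real.exp (energy (spikeSignal (β / N) (clip Ku) (clip Kv) ω)
          fun p => Y p.1 p.2)) ∂(noiseLaw N M) := by
    filter_upwards [ae_spikeSignal_clip hu hv (β / N)] with ω hω
    have := noiseLaw_shift (fun i j => Real.sqrt (β / N) * (ω.1 i * ω.2 j)) hs
    rw [show spikeSignal (β / N) (clip Ku) (clip Kv) ω
      = fun p : Fin N × Fin M => Real.sqrt (β / N) * (ω.1 p.1 * ω.2 p.2) from funext hω, ← this]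
    rfl
  refine (lintegral_congr_ae h1).trans ?_
  have hmeas : Measurable fun p : (Fin N → Fin M → ℝ) × ((Fin N → ℝ) × (Fin M → ℝ)) =>
      ENNReal.ofReal (Real.exp (energy (spikeSignal (β / N) (clip Ku) (clip Kv) p.2)
        fun k => p.1 k.1 k.2)) :=
    (((measurable_energy_uncurry hsig).comp (f := fun p : (Fin N → Fin M → ℝ) ×
      ((Fin N → ℝ) × (Fin M → ℝ)) => ((fun k : Fin N × Fin M => p.1 k.1 k.2), p.2))
        (by fun_prop)).exp).ennreal_ofReal
  rw [lintegral_lintegral_swap (f := fun ω (Y : Fin N → Fin M → ℝ) => ENNReal.ofReal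
    (Real.exp (energy (spikeSignal (β / N) (clip Ku) (clip Kv) ω) fun p => Y p.1 p.2)))
    (hmeas.comp measurable_swap).aemeasurable]
  refine lintegral_congr fun Y => ?_
  rw [spikePartFn, partFn, ofReal_integral_eq_lintegral_ofReal (integrable_exp_energy hsig _)
    (ae_of_all _ fun ω => (Real.exp_pos _).le)]

theorem spikedLaw_zero [IsProbabilityMeasure Pu] [IsProbabilityMeasure Pv] :
    spikedLaw Pu Pv N M 0 = noiseLaw N M := by
  have : (fun p : ((Fin N → ℝ) × (Fin M → ℝ)) × (Fin N → Fin M → ℝ) =>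
      spikedMatrix 0 p.1.1 p.1.2 p.2) = Prod.snd := by
    ext p; simp [spikedMatrix]
  rw [spikedLaw, this, measurePreserving_snd.map_eq]

/-- The likelihood ratio is the partition function of the planted model. -/
theorem likelihoodRatio_ae_eq (hu : IsBoundedPrior Pu Ku) (hv : IsBoundedPrior Pv Kv) (β : ℝ) :
    likelihoodRatio Pu Pv N M β =ᵐ[noiseLaw N M]
      spikePartFn Pu Pv (β / N) (clip Ku) (clip Kv) := by
  have := hu.isProbabilityMeasure
  have := hv.isProbabilityMeasure
  have cu := hu.isNormalizedCoord.bdd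
  have cv := hv.isNormalizedCoord.bdd
  have h := Measure.rnDeriv_withDensity (noiseLaw N M)
    (measurable_spikePartFn (N := N) (M := M) (Pu := Pu) (Pv := Pv) (lam := β / N) cu cv).ennreal_ofReal
  filter_upwards [h] with Y hY
  rw [likelihoodRatio, spikedLaw_zero, spikedLaw_eq_withDensity hu hv, hY,
    ENNReal.toReal_ofReal (spikePartFn_pos cu cv Y).le]

/-- The change of measure from `P_β` to noise supplies one factor `Z`, the `1` in the exponent `1 +
i s`. -/
theorem llrCharFun_eq_obsAvg (hu : IsBoundedPrior Pu Ku) (hv : IsBoundedPrior Pv Kv) (β s : ℝ) :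
    llrCharFun Pu Pv N M β s = obsAvg (1 + Complex.I * s) (spikePrior Pu Pv N M)
      (spikeSignal (β / N) (clip Ku) (clip Kv))
      (fun _ : Fin 0 → (Fin N → ℝ) × (Fin M → ℝ) => 1) := by
  have := hu.isProbabilityMeasure
  have := hv.isProbabilityMeasure
  have cu := hu.isNormalizedCoord.bdd
  have cv := hv.isNormalizedCoord.bdd
  have hm := measurable_spikePartFn (N := N) (M := M) (Pu := Pu) (Pv := Pv) (lam := β / N) cu cv
  -- The Radon–Nikodym derivative is identified only almost everywhere under the noise, while the
  -- integral is under `P_β`.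
  have hac : spikedLaw Pu Pv N M β ≪ noiseLaw N M := by
    rw [spikedLaw_eq_withDensity hu hv]; exact withDensity_absolutelyContinuous _ _
  have h1 : llrCharFun Pu Pv N M β s = ∫ Y, Complex.exp (Complex.I * s *
      Real.log (spikePartFn Pu Pv (β / N) (clip Ku) (clip Kv) Y)) ∂(spikedLaw Pu Pv N M β) := by
    refine integral_congr_ae ?_
    filter_upwards [hac.ae_le (likelihoodRatio_ae_eq hu hv β)] with Y hY
    rw [hY]
  rw [h1, spikedLaw_eq_withDensity hu hv, integral_withDensity_eq_integral_toReal_smul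
    hm.ennreal_ofReal (ae_of_all _ fun _ => ENNReal.ofReal_lt_top),
    ← (measurePreserving_curry_stdGauss N M).integral_comp', obsAvg]
  congr 1
  ext y
  have hZ := spikePartFn_pos (Pu := Pu) (Pv := Pv) (lam := β / N) cu cv
    (MeasurableEquiv.curry (Fin N) (Fin M) ℝ y)
  rw [ENNReal.toReal_ofReal hZ.le, weightedAvg]
  have e : partFn (spikePrior Pu Pv N M) (fun ω =>
      energy (spikeSignal (β / N) (clip Ku) (clip Kv) ω) y)
      = spikePartFn Pu Pv (β / N) (clip Ku) (clip Kv)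
        (MeasurableEquiv.curry (Fin N) (Fin M) ℝ y) := rfl
  rw [e, add_mul, one_mul, Complex.exp_add, ← Complex.ofReal_exp, Real.exp_log hZ]
  have := isProbabilityMeasure_pi_tilted (κ := Fin 0)
    (integrable_exp_energy (π := spikePrior Pu Pv N M)
      (isBddMeas_spikeSignal (N := N) (M := M) cu cv (β / N)) y)
  simp [gibbsAvg]

end LikelihoodRatio

/-! ### Choice of constants and conclusion. -/

section MainTheorem

theorem isSubcritical_of_aspect_le {N M : ℕ} (hN : 1 ≤ N) {Ku Kv β A ε θ b : ℝ}
    (hε : 0 < ε) (hb : 0 ≤ b) (hbβ : b ≤ β) (hM : (M : ℝ) / N ≤ A)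
    (h1 : β ^ 2 * A * Ku ^ 4 * Kv ^ 4 + 2 * ε * Ku ^ 4 ≤ θ)
    (h2 : β ^ 2 * A * Ku ^ 4 * Kv ^ 4 + 2 * ε * (A * Kv ^ 4) ≤ θ) (hθ : θ < 1) :
    IsSubcritical N M Ku Kv (b / N) N ε θ := by
  have hNpos : (0 : ℝ) < N := by exact_mod_cast hN
  have hr : 0 ≤ (M : ℝ) / N := by positivity
  have hA := hr.trans hM
  have hu : 0 ≤ Ku ^ 4 := by positivity
  have hv : 0 ≤ Kv ^ 4 := by positivity
  have h3 : b ^ 2 * ((M : ℝ) / N) * Ku ^ 4 * Kv ^ 4 ≤ β ^ 2 * A * Ku ^ 4 * Kv ^ 4 := by gcongr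
  refine ⟨by positivity, by exact_mod_cast hN, hε, ?_, ?_, hθ⟩
  · calc _ = b ^ 2 * ((M : ℝ) / N) * Ku ^ 4 * Kv ^ 4 + 2 * ε * Ku ^ 4 := by field_simp
      _ ≤ _ := by linarith
  · have h4 : 2 * ε * ((M : ℝ) / N * Kv ^ 4) ≤ 2 * ε * (A * Kv ^ 4) := by gcongr
    calc _ = b ^ 2 * ((M : ℝ) / N) * Ku ^ 4 * Kv ^ 4 + 2 * ε * ((M : ℝ) / N * Kv ^ 4) := by
          field_simp
      _ ≤ _ := by linarith

/-- Here `q (q - 1) = i s - s²` and `σ² = 2 μ`, so the exponent is `q (q - 1) μ`. -/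
theorem limitCharFun_eq (α β s : ℝ) :
    limitCharFun α β s = Complex.exp ((1 + Complex.I * s) * (1 + Complex.I * s - 1)
      * (-(1 / 4) * Real.log (1 - α * β ^ 2) : ℝ)) := by
  rw [limitCharFun, limitMean, limitVar]
  congr 1
  push_cast
  ring_nf
  rw [Complex.I_sq]
  ring

theorem theorem2 (s α β Ku Kv C : ℝ) (hα : 0 ≤ α) (hβ : 0 ≤ β)
    (hsub : α * β ^ 2 * Ku ^ 4 * Kv ^ 4 < 1) :
    ∃ K : ℝ, ∃ N₀ : ℕ, ∀ Pu Pv : Measure ℝ, IsBoundedPrior Pu Ku → IsBoundedPrior Pv Kv →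
      ∀ N M : ℕ, 1 ≤ N → N₀ ≤ N → |(M : ℝ) - α * N| ≤ C * Real.sqrt N →
        ‖llrCharFun Pu Pv N M β s - limitCharFun α β s‖ ≤ K / Real.sqrt N := by
  set t : ℝ := α * β ^ 2 * Ku ^ 4 * Kv ^ 4 with ht
  set κ : ℝ := β ^ 2 * Ku ^ 4 * Kv ^ 4 with hκ
  have hκ0 : 0 ≤ κ := by positivity
  -- The slack `1 - t` is shared out: `δ`, the allowed excess of `M / N` over `α`, uses at most half
  -- of it, and `ε` a quarter, leaving `θ = t + 3 (1 - t) / 4 = (3 + t) / 4 < 1`.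
  set δ : ℝ := (1 - t) / (2 * (κ + 1)) with hδ
  have h1t : 0 < 1 - t := by linarith
  have hδ0 : 0 < δ := by positivity
  set ε : ℝ := (1 - t) / (8 * (Ku ^ 4 + (α + δ) * Kv ^ 4 + 1)) with hε
  have hε0 : 0 < ε := by positivity
  have hu4 : 0 ≤ Ku ^ 4 := by positivity
  have hv4 : 0 ≤ (α + δ) * Kv ^ 4 := by positivity
  have hδκ : δ * κ ≤ (1 - t) / 2 := by
    rw [hδ, div_mul_eq_mul_div, div_le_div_iff₀ (by positivity) two_pos]
    nlinarith
  have hεle : ∀ x, 0 ≤ x → x ≤ Ku ^ 4 + (α + δ) * Kv ^ 4 → 2 * ε * x ≤ (1 - t) / 4 :=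
    fun x hx hxle => by
      have : ε * (8 * (Ku ^ 4 + (α + δ) * Kv ^ 4 + 1)) = 1 - t := by
        rw [hε]; field_simp
      nlinarith
  have hmain : β ^ 2 * (α + δ) * Ku ^ 4 * Kv ^ 4 ≤ t + (1 - t) / 2 := by
    calc _ = t + δ * κ := by rw [ht, hκ]; ring
      _ ≤ _ := by linarith
  -- The threshold on `N` is what makes `C / √N ≤ δ`.
  refine ⟨charFunConst (1 + Complex.I * s) Ku Kv ε ((3 + t) / 4) α β (α + δ) C,
    ⌈(C / δ) ^ 2⌉₊, fun Pu Pv hu hv N M hN hN₀ hM => ?_⟩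
  have hNpos : (0 : ℝ) < N := by exact_mod_cast hN
  have hr : 0 < Real.sqrt N := Real.sqrt_pos.2 hNpos
  have hMN : |(M : ℝ) / N - α| ≤ C / Real.sqrt N := by
    have e : (M : ℝ) / N - α = ((M : ℝ) - α * N) / N := by field_simp
    rw [e, abs_div, abs_of_pos hNpos, div_le_div_iff₀ hNpos hr]
    calc _ ≤ C * Real.sqrt N * Real.sqrt N := by gcongr
      _ = _ := by rw [mul_assoc, Real.mul_self_sqrt hNpos.le]
  have hCδ : C / Real.sqrt N ≤ δ := by
    have h1 : (C / δ) ^ 2 ≤ N := Nat.ceil_le.1 hN₀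
    have h2 : C / δ ≤ Real.sqrt N := (le_abs_self _).trans (Real.abs_le_sqrt h1)
    rw [div_le_iff₀ hδ0] at h2
    rw [div_le_iff₀ hr]; linarith
  have hA : (M : ℝ) / N ≤ α + δ := by
    have := (abs_le.1 hMN).2
    linarith
  have hlt : α * β ^ 2 < 1 := by
    have h1 : 1 ≤ Ku ^ 4 := one_le_pow₀ hu.one_le
    have h2 : 1 ≤ Kv ^ 4 := one_le_pow₀ hv.one_le
    have h3 : 0 ≤ α * β ^ 2 := by positivity
    calc α * β ^ 2 ≤ α * β ^ 2 * Ku ^ 4 := le_mul_of_one_le_right h3 h1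
      _ ≤ t := le_mul_of_one_le_right (by positivity) h2
      _ < 1 := hsub
  rw [llrCharFun_eq_obsAvg hu hv, limitCharFun_eq]
  exact norm_obsAvg_sub_exp_le hN hα hβ hlt
    (fun b hb hbβ => isSubcritical_of_aspect_le hN hε0 hb hbβ hA
      (by linarith [hεle (Ku ^ 4) hu4 (by linarith)])
      (by linarith [hεle ((α + δ) * Kv ^ 4) hv4 (by linarith)]) (by linarith))
    hu.isNormalizedCoord hv.isNormalizedCoord (by simp)
    (by simp; nlinarith) hA hMN

end MainTheorem
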